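/- **Theorem 6.** Let $M$ be an almost Hermitian manifold of indefinite metric: a smooth manifold with a smooth pseudo-Riemannian metric $g$ of signature $(2s,2(n-s))$ ($2s$ negative and $2(n-s)$ positive squares) and a smooth almost complex structure $J$ with $J^2=-\mathrm{id}$, $g(JX,JY)=g(X,Y)$. Assume $s\ge 2$ and $n-s\ge 2$. Let $R(x,y,z,u)=g(R(x,y)z,u)$, $R(X,Y)=[\nabla_X,\nabla_Y]-\nabla_{[X,Y]}$, be the curvature tensor of the Levi-Civita connection $\nabla$ of $g$. A 2-plane $\alpha\subset T_pM$ is called strongly isotropic if $g|_\alpha=0$, and antiholomorphic if $J\alpha\perp\alpha$ and $J\alpha\neq\alpha$. The following conditions are equivalent: 1) $R(\xi,\eta,\eta,\xi)=0$ for all $p\in M$ and all $\xi,\eta\in T_pM$ such that $\mathrm{span}\{\xi,\eta\}$ is a strongly isotropic antiholomorphic 2-plane; 2) the Bochner curvature tensor $B(R)$ (Tricerri–Vanhecke) vanishes at every point of $M$. Here $B(R)$ is defined as follows. For a tensor $T$ of type $(0,4)$ on $T_pM$ and an orthonormal basis $e_1,\dots,e_{2n}$ of $T_pM$ put $$\rho(T)(y,z)=\sum_{i=1}^{2n}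 g(e_i,e_i)T(e_i,y,z,e_i),\qquad \rho^*(T)(y,z)=\sum_{i=1}^{2n} g(e_i,e_i)T(e_i,y,Jz,Je_i),$$ $$\tau(T)=\sum_{i=1}^{2n} g(e_i,e_i)\rho(T)(e_i,e_i),\qquad \tau^*(T)=\sum_{i=1}^{2n} g(e_i,e_i)\rho^*(T)(e_i,e_i),\qquad \overline T(x,y,z,u)=T(Jx,Jy,Jz,Ju),$$ and for a tensor $S$ of type $(0,2)$ put $$\varphi(S)(x,y,z,u)=g(y,z)S(x,u)-g(x,z)S(y,u)+g(x,u)S(y,z)-g(y,u)S(x,z),$$ $$\psi(S)(x,y,z,u)=g(y,Jz)S(x,Ju)-g(x,Jz)S(y,Ju)-2g(x,Jy)S(z,Ju)+g(x,Ju)S(y,Jz)-g(y,Ju)S(x,Jz)-2g(z,Ju)S(x,Jy),$$ $$\pi_1(x,y,z,u)=g(y,z)g(x,u)-g(x,z)g(y,u),$$ $$\pi_2(x,y,z,u)=g(y,Jz)g(x,Ju)-g(x,Jz)g(y,Ju)-2g(x,Jy)g(z,Ju).$$ Then $$B(R)=R-\frac{1}{16(n+2)}(\varphi+\psi)\bigl((\rho+3\rho^*)(R+\overline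 R)\bigr)-\frac{1}{16(n-2)}(3\varphi-\psi)\bigl((\rho-\rho^*)(R+\overline R)\bigr)$$ $$-\frac{1}{4(n+1)}\psi\bigl(\rho^*(R-\overline R)\bigr)-\frac{1}{4(n-1)}\varphi\bigl(\rho(R-\overline R)\bigr)$$ $$+\frac{\tau(R)+3\tau^*(R)}{16(n+1)(n+2)}(\pi_1+\pi_2)+\frac{\tau(R)-\tau^*(R)}{16(n-1)(n-2)}(3\pi_1-\pi_2).$$ -/

import Mathlib

open Module
open scoped Manifold ContDiff Bundle

noncomputable section

/-! ### Pseudo-Riemannian geometry on a vector space `E`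

`G y` is the metric at the point `y`, for `y` in an open subset of `E` (a chart domain). -/

namespace LocalMetric

variable {E : Type*} [NormedAddCommGroup E] [NormedSpace ℝ E]

/-- The Christoffel symbols of the first kind, as the linear form
`z ↦ ½ (∂ᵥ G(w, z) + ∂_w G(v, z) - ∂_z G(v, w))` at the point `y`. -/
def christoffelForm (G : E → E →L[ℝ] E →L[ℝ] ℝ) (y v w : E) : E →L[ℝ] ℝ :=
  (1 / 2 : ℝ) • (fderiv ℝ G y v w + fderiv ℝ G y w v - ((fderiv ℝ G y).flip v).flip w)

/-- The Christoffel symbols `Γ_y(v, w)` of the second kind: the vector which the (nondegenerate)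
metric `G y` turns into `christoffelForm G y v w`. -/
def christoffel (G : E → E →L[ℝ] E →L[ℝ] ℝ) (y v w : E) : E :=
  (G y).inverse (christoffelForm G y v w)

/-- The Levi-Civita connection of `G` on vector fields: `∇_X Y = D_X Y + Γ(X, Y)`. -/
def nabla (G : E → E →L[ℝ] E →L[ℝ] ℝ) (X Y : E → E) : E → E :=
  fun y => fderiv ℝ Y y (X y) + christoffel G y (X y) (Y y)

/-- The curvature operator `R(X, Y) Z = ∇_X ∇_Y Z - ∇_Y ∇_X Z - ∇_[X, Y] Z`. -/
def curvatureOperator (G : E → E →L[ℝ] E →L[ℝ] ℝ) (X Y Z : E → E) : E → E :=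
  nabla G X (nabla G Y Z) - nabla G Y (nabla G X Z) - nabla G (VectorField.lieBracket ℝ X Y) Z

/-- The curvature tensor `R(x, y, z, u) = G(R(x, y) z, u)` at the point `a`. As the curvature
operator is tensorial, the vectors may be extended to constant vector fields. -/
def curvature (G : E → E →L[ℝ] E →L[ℝ] ℝ) (a x y z u : E) : ℝ :=
  G a (curvatureOperator G (fun _ => x) (fun _ => y) (fun _ => z) a) u

end LocalMetric

/-! ### Algebra on a tangent space -/

namespace HermitianAlgebra

variable {V : Type*} [AddCommGroup V] [Module ℝ V]

/-- `e` is an orthonormal basis for the scalar product `g` of arbitrary signature. -/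
def IsOrthonormalBasis {ι : Type*} (g : V → V → ℝ) (e : Basis ι ℝ V) : Prop :=
  (∀ i, g (e i) (e i) = 1 ∨ g (e i) (e i) = -1) ∧ ∀ i j, i ≠ j → g (e i) (e j) = 0

open Classical in
/-- The trace `∑ g(eᵢ, eᵢ) b(eᵢ, eᵢ)` of a bilinear form `b` with respect to `g`, where `e` is an
orthonormal basis; see `metricTrace_eq` for the independence of the choice of `e`. -/
def metricTrace (g b : V → V → ℝ) : ℝ :=
  if h : ∃ e : Basis (Fin (finrank ℝ V)) ℝ V, IsOrthonormalBasis g e then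
    ∑ i, g (h.choose i) (h.choose i) * b (h.choose i) (h.choose i)
  else 0

/-- The Ricci tensor `ρ(T)(y, z) = ∑ g(eᵢ, eᵢ) T(eᵢ, y, z, eᵢ)`. -/
def ricci (g : V → V → ℝ) (T : V → V → V → V → ℝ) (y z : V) : ℝ :=
  metricTrace g fun a b => T a y z b

/-- The Ricci `*`-tensor `ρ*(T)(y, z) = ∑ g(eᵢ, eᵢ) T(eᵢ, y, J z, J eᵢ)`. -/
def ricciStar (g : V → V → ℝ) (J : V → V) (T : V → V → V → V → ℝ) (y z : V) : ℝ :=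
  metricTrace g fun a b => T a y (J z) (J b)

/-- The scalar curvature `τ(T)`. -/
def scalar (g : V → V → ℝ) (T : V → V → V → V → ℝ) : ℝ :=
  metricTrace g (ricci g T)

/-- The scalar `*`-curvature `τ*(T)`. -/
def scalarStar (g : V → V → ℝ) (J : V → V) (T : V → V → V → V → ℝ) : ℝ :=
  metricTrace g (ricciStar g J T)

/-- The tensor `φ(S)` of type (0,4). -/
def phi (g S : V → V → ℝ) (x y z u : V) : ℝ :=
  g y z * S x u - g x z * S y u + g x u * S y z - g y u * S x z

/-- The tensor `ψ(S)` of type (0,4). -/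
def psi (g : V → V → ℝ) (J : V → V) (S : V → V → ℝ) (x y z u : V) : ℝ :=
  g y (J z) * S x (J u) - g x (J z) * S y (J u) - 2 * g x (J y) * S z (J u)
    + g x (J u) * S y (J z) - g y (J u) * S x (J z) - 2 * g z (J u) * S x (J y)

/-- The tensor `π₁`. -/
def pi1 (g : V → V → ℝ) (x y z u : V) : ℝ :=
  g y z * g x u - g x z * g y u

/-- The tensor `π₂`. -/
def pi2 (g : V → V → ℝ) (J : V → V) (x y z u : V) : ℝ :=
  g y (J z) * g x (J u) - g x (J z) * g y (J u) - 2 * g x (J y) * g z (J u)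

/-- The tensor `T̄(x, y, z, u) = T(Jx, Jy, Jz, Ju)`. -/
def bar (J : V → V) (T : V → V → V → V → ℝ) (x y z u : V) : ℝ :=
  T (J x) (J y) (J z) (J u)

/-- The Bochner tensor `B(T)` (Tricerri-Vanhecke) of a curvature-like tensor `T` on a Hermitian
vector space `(V, g, J)` of real dimension `2 n`. -/
def bochner (n : ℕ) (g : V → V → ℝ) (J : V → V) (T : V → V → V → V → ℝ) (x y z u : V) : ℝ :=
  let P := T + bar J T
  let Q := T - bar J T
  let S₁ := ricci g P + (3 : ℝ) • ricciStar g J P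
  let S₂ := ricci g P - ricciStar g J P
  T x y z u
    - 1 / (16 * ((n : ℝ) + 2)) * (phi g S₁ x y z u + psi g J S₁ x y z u)
    - 1 / (16 * ((n : ℝ) - 2)) * (3 * phi g S₂ x y z u - psi g J S₂ x y z u)
    - 1 / (4 * ((n : ℝ) + 1)) * psi g J (ricciStar g J Q) x y z u
    - 1 / (4 * ((n : ℝ) - 1)) * phi g (ricci g Q) x y z u
    + 1 / (16 * ((n : ℝ) + 1) * ((n : ℝ) + 2)) * (scalar g T + 3 * scalarStar g J T)
        * (pi1 g x y z u + pi2 g J x y z u)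
    + 1 / (16 * ((n : ℝ) - 1) * ((n : ℝ) - 2)) * (scalar g T - scalarStar g J T)
        * (3 * pi1 g x y z u - pi2 g J x y z u)

/-- A strongly isotropic 2-plane: `g` restricts to `0` on it. -/
def IsStronglyIsotropicPlane (g : V → V → ℝ) (α : Submodule ℝ V) : Prop :=
  finrank ℝ α = 2 ∧ ∀ x ∈ α, ∀ y ∈ α, g x y = 0

/-- An antiholomorphic 2-plane: `J α ⟂ α` and `J α ≠ α`. -/
def IsAntiholomorphicPlane (g : V → V → ℝ) (J : V →ₗ[ℝ] V) (α : Submodule ℝ V) : Prop :=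
  finrank ℝ α = 2 ∧ (∀ x ∈ α, ∀ y ∈ α, g (J x) y = 0) ∧ α.map J ≠ α

theorem expand {ι : Type*} [Fintype ι] (g : V →ₗ[ℝ] V →ₗ[ℝ] ℝ) (e : Basis ι ℝ V)
    (he : IsOrthonormalBasis (fun x y => g x y) e) (x : V) :
    x = ∑ j, (g (e j) (e j) * g x (e j)) • e j := by
  classical
  conv_lhs => rw [← e.sum_repr x]
  refine Finset.sum_congr rfl fun j _ => ?_
  congr 1
  have h1 : g x (e j) = e.repr x j * g (e j) (e j) := by
    conv_lhs => rw [← e.sum_repr x]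
    simp only [map_sum, map_smul, LinearMap.sum_apply, LinearMap.smul_apply, smul_eq_mul]
    rw [Finset.sum_eq_single j]
    · intro b _ hb
      have h0 : g (e b) (e j) = 0 := he.2 b j hb
      rw [h0, mul_zero]
    · simp
  rw [h1]
  rcases he.1 j with h | h <;> simp only at h <;> rw [h] <;> ring

theorem sum_eq_sum {ι κ : Type*} [Fintype ι] [Fintype κ] (g b : V →ₗ[ℝ] V →ₗ[ℝ] ℝ)
    (hg : ∀ x y, g x y = g y x)
    (e : Basis ι ℝ V) (he : IsOrthonormalBasis (fun x y => g x y) e)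
    (f : Basis κ ℝ V) (hf : IsOrthonormalBasis (fun x y => g x y) f) :
    ∑ i, g (e i) (e i) * b (e i) (e i) = ∑ j, g (f j) (f j) * b (f j) (f j) := by
  have key : ∀ i, b (e i) (e i) = ∑ j, (g (f j) (f j) * g (e i) (f j)) * b (f j) (e i) := by
    intro i
    have := congrArg (fun v => b v (e i)) (expand g f hf (e i))
    simpa only [map_sum, map_smul, LinearMap.sum_apply, LinearMap.smul_apply, smul_eq_mul] using this
  have key2 : ∀ j, b (f j) (f j) = ∑ i, (g (e i) (e i) * g (f j) (e i)) * b (f j) (e i) := by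
    intro j
    have := congrArg (b (f j)) (expand g e he (f j))
    simpa only [map_sum, map_smul, smul_eq_mul] using this
  simp only [key, key2, Finset.mul_sum]
  rw [Finset.sum_comm]
  refine Finset.sum_congr rfl fun j _ => Finset.sum_congr rfl fun i _ => ?_
  rw [hg (e i) (f j)]
  ring

/-- The metric trace can be computed in every orthonormal basis. -/
theorem metricTrace_eq {ι : Type*} [Fintype ι] (g b : V →ₗ[ℝ] V →ₗ[ℝ] ℝ)
    (hg : ∀ x y, g x y = g y x)
    (e : Basis ι ℝ V) (he : IsOrthonormalBasis (fun x y => g x y) e) :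
    metricTrace (fun x y => g x y) (fun x y => b x y) = ∑ i, g (e i) (e i) * b (e i) (e i) := by
  have h : ∃ e : Basis (Fin (finrank ℝ V)) ℝ V, IsOrthonormalBasis (fun x y => g x y) e := by
    refine ⟨e.reindex (Fintype.equivFinOfCardEq (finrank_eq_card_basis e).symm), ?_, ?_⟩
    · intro i
      simpa using he.1 _
    · intro i j hij
      simpa using he.2 _ _ (fun h => hij (by simpa using h))
  rw [metricTrace, dif_pos h]
  exact sum_eq_sum g b hg _ h.choose_spec e he

end HermitianAlgebra

/-! ### Almost Hermitian manifolds of indefinite metric -/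

/-- An almost Hermitian structure on the manifold `M`, with metric `g` of signature
`(2 s, 2 (n - s))`: each tangent space has an orthonormal basis of `2 n` vectors, of which the first
`2 s` have square `-1` and the others have square `1`. -/
structure AlmostHermitianStructure (E : Type*) [NormedAddCommGroup E] [NormedSpace ℝ E]
    (M : Type*) [TopologicalSpace M] [ChartedSpace E M] [IsManifold 𝓘(ℝ, E) ∞ M] (n s : ℕ) where
  /-- the metric tensor -/
  g : ∀ p : M, TangentSpace 𝓘(ℝ, E) p →L[ℝ] TangentSpace 𝓘(ℝ, E) p →L[ℝ] ℝ
  /-- the almost complex structure -/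
  J : ∀ p : M, TangentSpace 𝓘(ℝ, E) p →L[ℝ] TangentSpace 𝓘(ℝ, E) p
  contMDiff_g : ContMDiff 𝓘(ℝ, E) (𝓘(ℝ, E).prod 𝓘(ℝ, E →L[ℝ] E →L[ℝ] ℝ)) ∞
    (fun p => Bundle.TotalSpace.mk' (E →L[ℝ] E →L[ℝ] ℝ) p (g p))
  contMDiff_J : ContMDiff 𝓘(ℝ, E) (𝓘(ℝ, E).prod 𝓘(ℝ, E →L[ℝ] E)) ∞
    (fun p => Bundle.TotalSpace.mk' (E →L[ℝ] E) p (J p))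
  symm : ∀ p v w, g p v w = g p w v
  signature : ∀ p, ∃ e : Basis (Fin (2 * n)) ℝ (TangentSpace 𝓘(ℝ, E) p), ∀ i j,
    g p (e i) (e j) = if i = j then (if (i : ℕ) < 2 * s then -1 else 1) else 0
  J_sq : ∀ p v, J p (J p v) = -v
  J_isometry : ∀ p v w, g p (J p v) (J p w) = g p v w

namespace AlmostHermitianStructure

variable {E : Type*} [NormedAddCommGroup E] [NormedSpace ℝ E]
  {M : Type*} [TopologicalSpace M] [ChartedSpace E M] [IsManifold 𝓘(ℝ, E) ∞ M] {n s : ℕ}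

/-- The metric in the chart `φ` around `p`, i.e. its pullback by `φ⁻¹`:
`G_y(v, w) = g(dφ⁻¹ v, dφ⁻¹ w)` at `φ⁻¹ y`. -/
def chartMetric (A : AlmostHermitianStructure E M n s) (p : M) (y : E) : E →L[ℝ] E →L[ℝ] ℝ :=
  let D : E →L[ℝ] E := mfderiv 𝓘(ℝ, E) 𝓘(ℝ, E) (extChartAt 𝓘(ℝ, E) p).symm y
  let B : E →L[ℝ] E →L[ℝ] ℝ := A.g ((extChartAt 𝓘(ℝ, E) p).symm y)
  B.bilinearComp D D

/-- The curvature tensor `R(x, y, z, u) = g(R(x, y) z, u)` of type (0,4) of the Levi-Civita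
connection of `g` at `p`, computed in the chart `φ` around `p`. -/
def curvature (A : AlmostHermitianStructure E M n s) (p : M)
    (x y z u : TangentSpace 𝓘(ℝ, E) p) : ℝ :=
  let d := mfderiv 𝓘(ℝ, E) 𝓘(ℝ, E) (extChartAt 𝓘(ℝ, E) p) p
  LocalMetric.curvature (A.chartMetric p) (extChartAt 𝓘(ℝ, E) p p) (d x) (d y) (d z) (d u)

end AlmostHermitianStructure

end

/-! For a symmetric `S` adapted to `J`, the tensors `phi g S` and `psi g J S` vanish on `(ξ, η, η,
ξ)` as soon as `ξ` and `η` are null and span orthogonal complex lines, because every term contains a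
factor such as `g ξ η` or `g ξ (J η)`. In fact no symmetry of `S` is needed for this. Hence the
Bochner tensor and the curvature agree on strongly isotropic antiholomorphic planes
(`bochnerCombination_isotropic`), and vanishing of `B(R)` implies the first condition.

Conversely, `B(R)` is again an algebraic curvature tensor, it inherits the vanishing on those
planes, and both of its Ricci contractions are zero (`frameTrace_bochnerTensor`). It remains to
prove a statement of linear algebra: a curvature tensor `T` with these properties is zero
(`IsFlatOnIsotropic.eq_zero`).

Polarising `T(x + a, y + b, y + b, x + a) = 0` in the signs of `a` and `b`, and using the Bianchi
identity, kills the components of `T` on four orthogonal complex lines, two positive and two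
negative. Since a small perturbation of a negative vector by a positive one stays negative, the
signs can then be changed one at a time (`IsFlatOnIsotropic.vanishesOn`).

Rotating two of the four lines into each other shows that components such as `T(x, z, x, w) / g(x,
x)` do not depend on `x`. The off-diagonal Ricci equations thus become a small linear system, whose
determinant is nonzero for `n > 2`; so the components on three lines vanish, as do those with three
entries in one line (`vanishesOnTriples`). Rotating once more leaves, for each unit `x`, only two
unknowns, and the diagonal Ricci equations kill them (`VanishesOnTriples.unit_eq_zero`). Finally
`T(x, v, x, v') = 0` extends from nonnull `x` to all `x`, and the Bianchi identity gives `T = 0`.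

The remaining work is analytic: the curvature computed in a chart must be shown to have the
symmetries of a curvature tensor. -/

open Function

noncomputable section

/-! ### Symmetries of the curvature of a metric on a vector space. -/

section

/-- The algebraic symmetries of a curvature tensor of type (0,4). -/
structure IsCurvatureTensor {V : Type*} [AddCommGroup V] [Module ℝ V]
    (T : V → V → V → V → ℝ) : Prop where
  add_left : ∀ x x' y z u, T (x + x') y z u = T x y z u + T x' y z u
  smul_left : ∀ (c : ℝ) x y z u, T (c • x) y z u = c * T x y z u
  swap_left : ∀ x y z u, T y x z u = -T x y z u
  swap_right : ∀ x y z u, T x y u z = -T x y z u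
  swap_pairs : ∀ x y z u, T z u x y = T x y z u
  bianchi : ∀ x y z u, T x y z u + T y z x u + T z x y u = 0

/-- In finite dimension an operator amounts to its values on a basis, so smoothness may be tested on
fixed vectors. -/
theorem contDiffAt_of_forall_apply {D E F : Type*} [NormedAddCommGroup D] [NormedSpace ℝ D]
    [NormedAddCommGroup E] [NormedSpace ℝ E] [NormedAddCommGroup F] [NormedSpace ℝ F]
    [FiniteDimensional ℝ E] {f : D → E →L[ℝ] F} {x : D} {n : ℕ∞ω}
    (h : ∀ y, ContDiffAt ℝ n (fun x => f x y) x) : ContDiffAt ℝ n f x := by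
  let d := finrank ℝ E
  have hd : d = finrank ℝ (Fin d → ℝ) := (finrank_fin_fun ℝ).symm
  let e₁ := ContinuousLinearEquiv.ofFinrankEq hd
  let e₂ := (e₁.arrowCongr (1 : F ≃L[ℝ] F)).trans (ContinuousLinearEquiv.piRing (Fin d))
  rw [← id_comp f, ← e₂.symm_comp_self]
  exact e₂.symm.contDiff.contDiffAt.comp x (contDiffAt_pi.mpr fun i => h _)

namespace LocalMetric

open Filter Topology

variable {E : Type*} [NormedAddCommGroup E] [NormedSpace ℝ E]

local instance normedAddCommGroupForm : NormedAddCommGroup (E →L[ℝ] E →L[ℝ] ℝ) :=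
  inferInstance
local instance normedSpaceForm : NormedSpace ℝ (E →L[ℝ] E →L[ℝ] ℝ) :=
  inferInstance

/-- The second derivative `D²G(x, y)(v, w)` of the metric at `a`. -/
def secondDeriv (G : E → E →L[ℝ] E →L[ℝ] ℝ) (a x y v w : E) : ℝ :=
  fderiv ℝ (fderiv ℝ G) a x y v w

variable {G : E → E →L[ℝ] E →L[ℝ] ℝ} {a : E}

theorem hasFDerivAt_apply_apply {B : E → E →L[ℝ] E →L[ℝ] ℝ} {B' : E →L[ℝ] E →L[ℝ] E →L[ℝ] ℝ}
    {y : E} (hd : HasFDerivAt B B' y) (v w : E) :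
    HasFDerivAt (fun y' => B y' v w) ((B'.flip v).flip w) y := by
  have h1 := (hd.clm_apply (hasFDerivAt_const v y)).clm_apply (hasFDerivAt_const w y)
  refine h1.congr_fderiv ?_
  ext; simp

theorem fderiv_symm {y : E} (hG : ∀ᶠ y' in 𝓝 y, ∀ v w, G y' v w = G y' w v)
    (hd : DifferentiableAt ℝ G y) (x v w : E) : fderiv ℝ G y x v w = fderiv ℝ G y x w v := by
  have h2 := (hasFDerivAt_apply_apply hd.hasFDerivAt v w).congr_of_eventuallyEq
    (f₁ := fun y' => G y' w v) (by filter_upwards [hG] with y' hy'; exact hy' w v)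
  have h3 := h2.unique (hasFDerivAt_apply_apply hd.hasFDerivAt w v)
  simpa using congrArg (fun L => L x) h3

theorem christoffelForm_apply (y v w z : E) : christoffelForm G y v w z =
    (1 / 2 : ℝ) * (fderiv ℝ G y v w z + fderiv ℝ G y w v z - fderiv ℝ G y z v w) := by
  simp [christoffelForm]

theorem hasFDerivAt_fderiv_apply (hdd : DifferentiableAt ℝ (fderiv ℝ G) a) (u v w : E) :
    ∃ L : E →L[ℝ] ℝ, HasFDerivAt (fun y => fderiv ℝ G y u v w) L a ∧
      ∀ x, L x = secondDeriv G a x u v w := by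
  have h1 := ((hdd.hasFDerivAt.clm_apply (hasFDerivAt_const u a)).clm_apply
    (hasFDerivAt_const v a)).clm_apply (hasFDerivAt_const w a)
  refine ⟨_, h1, fun x => ?_⟩
  simp [secondDeriv]

theorem secondDeriv_symm (hG : ∀ᶠ y in 𝓝 a, ∀ v w, G y v w = G y w v)
    (hd : ∀ᶠ y in 𝓝 a, DifferentiableAt ℝ G y) (hdd : DifferentiableAt ℝ (fderiv ℝ G) a)
    (x u v w : E) : secondDeriv G a x u v w = secondDeriv G a x u w v := by
  obtain ⟨L, hL, hLx⟩ := hasFDerivAt_fderiv_apply hdd u v w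
  obtain ⟨L', hL', hLx'⟩ := hasFDerivAt_fderiv_apply hdd u w v
  rw [← hLx, ← hLx', (hL'.congr_of_eventuallyEq (f₁ := fun y => fderiv ℝ G y u v w) ?_).unique hL]
  filter_upwards [hG.eventually_nhds, hd] with y hy hy'
  exact fderiv_symm hy hy' u v w

variable [FiniteDimensional ℝ E]

/-- The classical coordinate formula: second derivatives of the metric plus terms quadratic in the
Christoffel symbols. All the symmetries of the curvature are read off from it. -/
theorem curvature_eq (hG : ContDiffAt ℝ 2 G a)
    (hsymm : ∀ᶠ y in 𝓝 a, ∀ v w, G y v w = G y w v) (hinv : (G a).IsInvertible)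
    (x y z u : E) : curvature G a x y z u =
      (1 / 2 : ℝ) * (secondDeriv G a x y z u + secondDeriv G a x z y u
        - secondDeriv G a x u y z - secondDeriv G a y x z u
        - secondDeriv G a y z x u + secondDeriv G a y u x z)
      - christoffelForm G a y z (christoffel G a x u)
      + christoffelForm G a x z (christoffel G a y u) := by
  have := FiniteDimensional.complete ℝ E
  have hd : DifferentiableAt ℝ G a := hG.differentiableAt (by norm_num)
  have hG' : ContDiffAt ℝ 1 (fderiv ℝ G) a := hG.fderiv_right (by norm_num)
  have hdd : DifferentiableAt ℝ (fderiv ℝ G) a := hG'.differentiableAt (by norm_num)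
  have hinv' : ∀ᶠ y in 𝓝 a, (G y).IsInvertible := by
    obtain ⟨e, he⟩ := hinv
    have := e.nhds
    rw [he] at this
    filter_upwards [hd.continuousAt this] with y hy
    exact hy
  -- Differentiating this identity by the product rule gives `G(∂Γ, u)` without differentiating the
  -- inverse metric explicitly.
  have hchr : ∀ᶠ y in 𝓝 a, ∀ v w, G y (christoffel G y v w) = christoffelForm G y v w := by
    filter_upwards [hinv'] with y hy v w
    exact hy.self_apply_inverse _
  have hform : ∀ v w : E, DifferentiableAt ℝ (fun y => christoffelForm G y v w) a := fun v w => by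
    have h1 : ContDiffAt ℝ 1 (fun y => christoffelForm G y v w) a := by
      refine contDiffAt_of_forall_apply fun z => ?_
      simp only [christoffelForm_apply]
      have h2 : ∀ u v w : E, ContDiffAt ℝ 1 (fun y => fderiv ℝ G y u v w) a := fun u v w =>
        ((hG'.clm_apply contDiffAt_const).clm_apply contDiffAt_const).clm_apply contDiffAt_const
      exact contDiffAt_const.mul (((h2 v w z).add (h2 w v z)).sub (h2 z v w))
    exact h1.differentiableAt (by norm_num)
  have hGam : ∀ v w : E, DifferentiableAt ℝ (fun y => christoffel G y v w) a := fun v w => by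
    have h1 : DifferentiableAt ℝ (fun y => (G y).inverse) a := by
      obtain ⟨e, he⟩ := hinv
      have h2 := contDiffAt_map_inverse (𝕜 := ℝ) (n := 1) e
      rw [he] at h2
      exact (h2.differentiableAt (by norm_num)).comp a hd
    exact h1.clm_apply (hform v w)
  have hop : curvatureOperator G (fun _ => x) (fun _ => y) (fun _ => z) a =
      fderiv ℝ (fun y' => christoffel G y' y z) a x + christoffel G a x (christoffel G a y z)
      - (fderiv ℝ (fun y' => christoffel G y' x z) a y
        + christoffel G a y (christoffel G a x z)) := by
    have h0 : ∀ w, christoffel G a 0 w = 0 := fun w => by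
      have : christoffelForm G a 0 w = 0 := by ext; simp [christoffelForm]
      simp [christoffel, this]
    have h1 : ∀ v w : E, nabla G (fun _ => v) (fun _ => w) = fun y' => christoffel G y' v w :=
      fun v w => by ext; simp [nabla]
    simp only [curvatureOperator, h1]
    simp [nabla, VectorField.lieBracket, h0]
  have key : ∀ x y : E, G a (fderiv ℝ (fun y' => christoffel G y' y z) a x
        + christoffel G a x (christoffel G a y z)) u =
      (1 / 2 : ℝ) * (secondDeriv G a x y z u + secondDeriv G a x z y u - secondDeriv G a x u y z)
      - christoffelForm G a x u (christoffel G a y z) := fun x y => by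
    have h1 := ((hd.hasFDerivAt.clm_apply (hGam y z).hasFDerivAt).clm_apply
      (hasFDerivAt_const u a))
    obtain ⟨L₁, hL₁, hL₁x⟩ := hasFDerivAt_fderiv_apply hdd y z u
    obtain ⟨L₂, hL₂, hL₂x⟩ := hasFDerivAt_fderiv_apply hdd z y u
    obtain ⟨L₃, hL₃, hL₃x⟩ := hasFDerivAt_fderiv_apply hdd u y z
    have h2 := ((hL₁.add hL₂).sub hL₃).const_mul (1 / 2 : ℝ)
    have h3 := h1.unique (h2.congr_of_eventuallyEq (by
      filter_upwards [hchr] with y' hy'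
      rw [hy', christoffelForm_apply]; rfl))
    have h4 := congrArg (fun L => L x) h3
    simp [hL₁x, hL₂x, hL₃x] at h4
    have h5 := hchr.self_of_nhds x (christoffel G a y z)
    rw [map_add, add_apply, h5]
    rw [christoffelForm_apply, christoffelForm_apply]
    -- Metric compatibility: the symbols of the first kind satisfy `Γ(x, v)(u) + Γ(x, u)(v) = ∂ₓG(v,
    -- u)`, here with `v = Γ(y, z)`.
    have h6 := fderiv_symm hsymm hd x (christoffel G a y z) u
    linarith
  have h7 : ∀ x y z u, christoffelForm G a x u (christoffel G a y z) =
      christoffelForm G a y z (christoffel G a x u) := fun x y z u => by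
    rw [← hchr.self_of_nhds, ← hchr.self_of_nhds, hsymm.self_of_nhds]
  rw [curvature, hop, map_sub, sub_apply, key, key, h7 x y z u, h7 y x z u]
  ring

-- In the coordinate formula the linear part is governed by the symmetry of second derivatives and
-- of the metric, the quadratic part by the symmetry of `Γ` and of the pairing `G(Γ(x, y), Γ(z,
-- u))`.
set_option synthInstance.maxHeartbeats 100000 in
theorem isCurvatureTensor_curvature (hG : ContDiffAt ℝ 2 G a)
    (hsymm : ∀ᶠ y in 𝓝 a, ∀ v w, G y v w = G y w v) (hinv : (G a).IsInvertible) :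
    IsCurvatureTensor (curvature G a) := by
  have hd : ∀ᶠ y in 𝓝 a, DifferentiableAt ℝ G y := by
    filter_upwards [hG.eventually (by norm_num)] with y hy
    exact hy.differentiableAt (by norm_num)
  have hd' : DifferentiableAt ℝ G a := hd.self_of_nhds
  have hdd : DifferentiableAt ℝ (fderiv ℝ G) a := by
    have h : ContDiffAt ℝ 1 (fderiv ℝ G) a := hG.fderiv_right (by norm_num)
    exact h.differentiableAt (by norm_num)
  have hS : ∀ x u v w : E, secondDeriv G a x u v w = secondDeriv G a x u w v :=
    secondDeriv_symm hsymm hd hdd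
  have hS' : ∀ x u v w : E, secondDeriv G a x u v w = secondDeriv G a u x v w := fun x u v w => by
    have h := hG.isSymmSndFDerivAt (by simp) x u
    rw [secondDeriv, secondDeriv, h]
  have hadd : ∀ x x' u v w : E, secondDeriv G a (x + x') u v w =
      secondDeriv G a x u v w + secondDeriv G a x' u v w := fun x x' u v w => by
    simp only [secondDeriv, map_add, add_apply]
  have hsmul : ∀ (c : ℝ) (x u v w : E), secondDeriv G a (c • x) u v w =
      c * secondDeriv G a x u v w := fun c x u v w => by
    simp only [secondDeriv, map_smul, smul_apply, smul_eq_mul]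
  have hadd' : ∀ u v x x' w : E, secondDeriv G a u v (x + x') w =
      secondDeriv G a u v x w + secondDeriv G a u v x' w := fun u v x x' w => by
    simp only [secondDeriv, map_add, add_apply]
  have hsmul' : ∀ (c : ℝ) (u v x w : E), secondDeriv G a u v (c • x) w =
      c * secondDeriv G a u v x w := fun c u v x w => by
    simp only [secondDeriv, map_smul, smul_apply, smul_eq_mul]
  have hΓ_add : ∀ x x' v, christoffelForm G a (x + x') v =
      christoffelForm G a x v + christoffelForm G a x' v := fun x x' v => by
    ext z
    simp only [christoffelForm_apply, map_add, add_apply]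
    ring
  have hΓ_smul : ∀ (c : ℝ) x v, christoffelForm G a (c • x) v =
      c • christoffelForm G a x v := fun c x v => by
    ext z
    simp only [christoffelForm_apply, map_smul, smul_apply, smul_eq_mul]
    ring
  have hQ : ∀ x y z u, christoffelForm G a x y (christoffel G a z u) =
      christoffelForm G a z u (christoffel G a x y) := fun x y z u => by
    have h : ∀ v w, christoffelForm G a v w = G a (christoffel G a v w) := fun v w =>
      (hinv.self_apply_inverse _).symm
    rw [h x y, h z u, hsymm.self_of_nhds]
  have hΓ : ∀ x y, christoffelForm G a x y = christoffelForm G a y x := fun x y => by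
    ext z
    rw [christoffelForm_apply, christoffelForm_apply, fderiv_symm hsymm hd' z x y]
    ring
  have hΓ' : ∀ x y, christoffel G a x y = christoffel G a y x := fun x y => by
    rw [christoffel, hΓ, christoffel]
  have hR := curvature_eq hG hsymm hinv
  constructor
  · intro x x' y z u
    simp only [hR, hadd, hadd', hS' y (x + x'), hS' y x, hS' y x', hΓ_add, christoffel, map_add,
      add_apply]
    ring
  · intro c x y z u
    simp only [hR, hsmul, hsmul', hS' y (c • x), hS' y x, hΓ_smul, christoffel, map_smul,
      smul_apply, smul_eq_mul]
    ring
  · intro x y z u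
    rw [hR, hR]
    ring
  · intro x y z u
    rw [hR, hR, hQ y u x z, hQ x u y z, hS' x y u z, hS' x y z u]
    ring
  · intro x y z u
    rw [hR, hR, hΓ z x, hΓ u x, hΓ' z y, hΓ' u y, hQ x z y u, hQ x u y z, hQ y u x z]
    linarith [hS' z u x y, hS' z x u y, hS x z u y, hS' z y u x, hS y z u x, hS' u x z y,
      hS x u z y, hS' u y z x, hS y u z x, hS' x y z u]
  · intro x y z u
    rw [hR, hR, hR, hΓ z x, hΓ z y, hΓ y x]
    linarith [hS' x y z u, hS' y z x u, hS' z x y u, hS x u y z, hS y u x z, hS z u x y]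

end LocalMetric

end

/-! ### The metric in a chart: regularity, nondegeneracy, curvature symmetries. -/

section

namespace AlmostHermitianStructure

open Filter Topology

variable {E : Type*} [NormedAddCommGroup E] [NormedSpace ℝ E]
  {M : Type*} [TopologicalSpace M] [ChartedSpace E M] [IsManifold 𝓘(ℝ, E) ∞ M] {n s : ℕ}

theorem chartMetric_apply (A : AlmostHermitianStructure E M n s) (p : M) (y v w : E) :
    A.chartMetric p y v w = A.g ((extChartAt 𝓘(ℝ, E) p).symm y)
      (mfderiv 𝓘(ℝ, E) 𝓘(ℝ, E) (extChartAt 𝓘(ℝ, E) p).symm y v)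
      (mfderiv 𝓘(ℝ, E) 𝓘(ℝ, E) (extChartAt 𝓘(ℝ, E) p).symm y w) :=
  rfl

/-- Coordinate vector fields are smooth; two derivatives suffice, since curvature involves two
derivatives of the metric. -/
theorem contMDiffAt_mfderiv_extChartAt_symm (p : M) (v : E) :
    ContMDiffAt 𝓘(ℝ, E) (𝓘(ℝ, E).prod 𝓘(ℝ, E)) 2
      (fun y => (⟨(extChartAt 𝓘(ℝ, E) p).symm y,
        mfderiv 𝓘(ℝ, E) 𝓘(ℝ, E) (extChartAt 𝓘(ℝ, E) p).symm y v⟩ : TangentBundle 𝓘(ℝ, E) M))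
      (extChartAt 𝓘(ℝ, E) p p) := by
  have hf : ContMDiffAt 𝓘(ℝ, E) 𝓘(ℝ, E) ∞ (extChartAt 𝓘(ℝ, E) p).symm
      (extChartAt 𝓘(ℝ, E) p p) :=
    (contMDiffOn_extChartAt_symm p).contMDiffAt (extChartAt_target_mem_nhds p)
  have := IsManifold.of_le (I := 𝓘(ℝ, E)) (M := M) (m := 1) (n := ∞) (by norm_cast)
  refine ContMDiffAt.clm_apply_of_inCoordinates (IB₁ := 𝓘(ℝ, E)) (IB₂ := 𝓘(ℝ, E))
    (F₁ := E) (E₁ := TangentSpace 𝓘(ℝ, E) (M := E)) (F₂ := E) (E₂ := TangentSpace 𝓘(ℝ, E) (M := M))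
    (b₁ := id) (b₂ := (extChartAt 𝓘(ℝ, E) p).symm)
    (ϕ := fun y => mfderiv 𝓘(ℝ, E) 𝓘(ℝ, E) (extChartAt 𝓘(ℝ, E) p).symm y)
    (v := fun _ => v) ?_ ?_ ?_
  · exact ContMDiffAt.mfderiv_const hf (by norm_cast)
  · exact contMDiffAt_vectorSpace_iff_contDiffAt.2 contDiffAt_const
  · exact hf.of_le (by norm_cast)

/-- The metric at a point as a bilinear form. -/
def form (A : AlmostHermitianStructure E M n s) (p : M) :
    TangentSpace 𝓘(ℝ, E) p →ₗ[ℝ] TangentSpace 𝓘(ℝ, E) p →ₗ[ℝ] ℝ :=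
  LinearMap.mk₂ ℝ (fun v w => A.g p v w) (fun _ _ _ => by rw [map_add, add_apply])
    (fun _ _ _ => by rw [map_smul, smul_apply]) (fun _ _ _ => map_add _ _ _)
    (fun _ _ _ => map_smul _ _ _)

theorem form_apply (A : AlmostHermitianStructure E M n s) (p : M)
    (v w : TangentSpace 𝓘(ℝ, E) p) : A.form p v w = A.g p v w := rfl

theorem eq_zero_of_forall_g_eq_zero (A : AlmostHermitianStructure E M n s) (p : M)
    (v : TangentSpace 𝓘(ℝ, E) p) (h : ∀ w, A.g p v w = 0) : v = 0 := by
  obtain ⟨b, hb⟩ := A.signature p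
  have hb' : HermitianAlgebra.IsOrthonormalBasis (fun x y => A.form p x y) b := by
    refine ⟨fun i => ?_, fun i j hij => ?_⟩
    · simp only [form_apply, hb, if_true]
      split_ifs <;> simp
    · simp only [form_apply, hb, if_neg hij]
  rw [HermitianAlgebra.expand (A.form p) b hb' v]
  simp only [form_apply, h, mul_zero, zero_smul, Finset.sum_const_zero]

variable [FiniteDimensional ℝ E]

theorem contDiffAt_chartMetric (A : AlmostHermitianStructure E M n s) (p : M) :
    ContDiffAt ℝ 2 (A.chartMetric p) (extChartAt 𝓘(ℝ, E) p p) := by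
  refine contDiffAt_of_forall_apply fun v => contDiffAt_of_forall_apply fun w => ?_
  have hv := contMDiffAt_mfderiv_extChartAt_symm p v
  have hw := contMDiffAt_mfderiv_extChartAt_symm p w
  have hb := (Bundle.contMDiffAt_totalSpace.1 hv).1
  have hg : ContMDiffAt 𝓘(ℝ, E) (𝓘(ℝ, E).prod 𝓘(ℝ, E →L[ℝ] E →L[ℝ] ℝ)) 2
      (fun y : E => Bundle.TotalSpace.mk' (E →L[ℝ] E →L[ℝ] ℝ)
        (E := fun p : M => TangentSpace 𝓘(ℝ, E) p →L[ℝ] TangentSpace 𝓘(ℝ, E) p →L[ℝ]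
          Bundle.Trivial M ℝ p)
        ((extChartAt 𝓘(ℝ, E) p).symm y) (A.g ((extChartAt 𝓘(ℝ, E) p).symm y)))
      (extChartAt 𝓘(ℝ, E) p p) :=
    ContMDiffAt.comp (extChartAt 𝓘(ℝ, E) p p)
      (A.contMDiff_g.contMDiffAt.of_le (by norm_cast)) hb
  have h := ContMDiffAt.clm_bundle_apply₂ (F₁ := E) (F₂ := E) (F₃ := ℝ)
    (E₃ := Bundle.Trivial M ℝ) hg hv hw
  exact (Bundle.contMDiffAt_totalSpace.1 h).2.contDiffAt

/-- The differential of the chart inverse is invertible and `g` is nondegenerate, so the chart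
metric is injective into the dual, which has the same dimension. -/
theorem isInvertible_chartMetric (A : AlmostHermitianStructure E M n s) (p : M) :
    (A.chartMetric p (extChartAt 𝓘(ℝ, E) p p)).IsInvertible := by
  have := IsManifold.of_le (I := 𝓘(ℝ, E)) (M := M) (m := 1) (n := ∞) (by norm_cast)
  have hD := isInvertible_mfderivWithin_extChartAt_symm (I := 𝓘(ℝ, E))
    (mem_extChartAt_target (I := 𝓘(ℝ, E)) p)
  rw [ModelWithCorners.range_eq_univ, mfderivWithin_univ] at hD
  have hker : ∀ v : E, A.chartMetric p (extChartAt 𝓘(ℝ, E) p p) v = 0 → v = 0 := fun v hv => by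
    obtain ⟨e, he⟩ := hD
    have h : ∀ w, A.g ((extChartAt 𝓘(ℝ, E) p).symm (extChartAt 𝓘(ℝ, E) p p)) (e v) w = 0 :=
      fun w => by
        have h1 : A.g ((extChartAt 𝓘(ℝ, E) p).symm (extChartAt 𝓘(ℝ, E) p p))
            (mfderiv 𝓘(ℝ, E) 𝓘(ℝ, E) (extChartAt 𝓘(ℝ, E) p).symm (extChartAt 𝓘(ℝ, E) p p) v)
            (mfderiv 𝓘(ℝ, E) 𝓘(ℝ, E) (extChartAt 𝓘(ℝ, E) p).symm (extChartAt 𝓘(ℝ, E) p p)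
              (e.symm w)) = 0 :=
          congrArg (fun L : E →L[ℝ] ℝ => L (e.symm w)) hv
        rw [← he] at h1
        have h2 : e (e.symm w) = w := e.apply_symm_apply w
        rw [← h2]
        exact h1
    exact e.injective ((A.eq_zero_of_forall_g_eq_zero _ _ h).trans (map_zero e).symm)
  have hbij : Bijective (A.chartMetric p (extChartAt 𝓘(ℝ, E) p p)) := by
    have hinj := (injective_iff_map_eq_zero (A.chartMetric p (extChartAt 𝓘(ℝ, E) p p))).2 hker
    refine ⟨hinj, ?_⟩
    refine (LinearMap.injective_iff_surjective_of_finrank_eq_finrank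
      (f := (A.chartMetric p (extChartAt 𝓘(ℝ, E) p p)).toLinearMap) ?_).1 hinj
    rw [(LinearMap.toContinuousLinearMap (𝕜 := ℝ) (E := E) (F' := ℝ)).symm.finrank_eq]
    exact (Subspace.dual_finrank_eq (K := ℝ) (V := E)).symm
  exact ⟨(LinearEquiv.ofBijective (A.chartMetric p (extChartAt 𝓘(ℝ, E) p p)).toLinearMap
    hbij).toContinuousLinearEquiv, rfl⟩

theorem isCurvatureTensor_curvature (A : AlmostHermitianStructure E M n s) (p : M) :
    IsCurvatureTensor (A.curvature p) := by
  have h := LocalMetric.isCurvatureTensor_curvature (A.contDiffAt_chartMetric p)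
    (Eventually.of_forall fun y v w => by
      rw [chartMetric_apply, chartMetric_apply, A.symm]) (A.isInvertible_chartMetric p)
  unfold curvature
  constructor
  · intro x x' y z u
    simp only [map_add]
    exact h.add_left ..
  · intro c x y z u
    simp only [map_smul]
    exact h.smul_left ..
  · exact fun x y z u => h.swap_left ..
  · exact fun x y z u => h.swap_right ..
  · exact fun x y z u => h.swap_pairs ..
  · exact fun x y z u => h.bianchi ..
end AlmostHermitianStructure

end

/-! ### Curvature tensors, Hermitian forms and unitary frames in arbitrary signature. -/

section

namespace IsCurvatureTensor

variable {V : Type*} [AddCommGroup V] [Module ℝ V] {T : V → V → V → V → ℝ}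

theorem add_second (hT : IsCurvatureTensor T) (x y y' z u : V) :
    T x (y + y') z u = T x y z u + T x y' z u := by
  rw [hT.swap_left, hT.add_left, hT.swap_left x y, hT.swap_left x y']
  ring

theorem add_third (hT : IsCurvatureTensor T) (x y z z' u : V) :
    T x y (z + z') u = T x y z u + T x y z' u := by
  rw [← hT.swap_pairs, hT.add_left, hT.swap_pairs x y z, hT.swap_pairs x y z']

theorem add_fourth (hT : IsCurvatureTensor T) (x y z u u' : V) :
    T x y z (u + u') = T x y z u + T x y z u' := by
  rw [← hT.swap_pairs, hT.add_second, hT.swap_pairs x y z u, hT.swap_pairs x y z u']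

theorem smul_second (hT : IsCurvatureTensor T) (c : ℝ) (x y z u : V) :
    T x (c • y) z u = c * T x y z u := by
  rw [hT.swap_left, hT.smul_left, hT.swap_left x y]
  ring

theorem smul_third (hT : IsCurvatureTensor T) (c : ℝ) (x y z u : V) :
    T x y (c • z) u = c * T x y z u := by
  rw [← hT.swap_pairs, hT.smul_left, hT.swap_pairs]

theorem smul_fourth (hT : IsCurvatureTensor T) (c : ℝ) (x y z u : V) :
    T x y z (c • u) = c * T x y z u := by
  rw [← hT.swap_pairs, hT.smul_second, hT.swap_pairs]

theorem neg_left (hT : IsCurvatureTensor T) (x y z u : V) : T (-x) y z u = -T x y z u := by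
  rw [← neg_one_smul ℝ x, hT.smul_left]; ring

theorem neg_second (hT : IsCurvatureTensor T) (x y z u : V) : T x (-y) z u = -T x y z u := by
  rw [← neg_one_smul ℝ y, hT.smul_second]; ring

theorem neg_third (hT : IsCurvatureTensor T) (x y z u : V) : T x y (-z) u = -T x y z u := by
  rw [← neg_one_smul ℝ z, hT.smul_third]; ring

theorem neg_fourth (hT : IsCurvatureTensor T) (x y z u : V) : T x y z (-u) = -T x y z u := by
  rw [← neg_one_smul ℝ u, hT.smul_fourth]; ring

theorem sub_second (hT : IsCurvatureTensor T) (x y y' z u : V) :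
    T x (y - y') z u = T x y z u - T x y' z u := by
  rw [sub_eq_add_neg, hT.add_second, hT.neg_second]; ring

theorem sub_third (hT : IsCurvatureTensor T) (x y z z' u : V) :
    T x y (z - z') u = T x y z u - T x y z' u := by
  rw [sub_eq_add_neg, hT.add_third, hT.neg_third]; ring

theorem sub_fourth (hT : IsCurvatureTensor T) (x y z u u' : V) :
    T x y z (u - u') = T x y z u - T x y z u' := by
  rw [sub_eq_add_neg, hT.add_fourth, hT.neg_fourth]; ring

theorem self_left (hT : IsCurvatureTensor T) (x z u : V) : T x x z u = 0 := by
  linarith [hT.swap_left x x z u]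

theorem self_right (hT : IsCurvatureTensor T) (x y z : V) : T x y z z = 0 := by
  linarith [hT.swap_right x y z z]

end IsCurvatureTensor

/-- A scalar product `g` with a compatible complex structure `J`. -/
structure IsHermitianForm {V : Type*} [AddCommGroup V] [Module ℝ V]
    (g : V →ₗ[ℝ] V →ₗ[ℝ] ℝ) (J : V →ₗ[ℝ] V) : Prop where
  symm : ∀ x y, g x y = g y x
  J_sq : ∀ x, J (J x) = -x
  J_isometry : ∀ x y, g (J x) (J y) = g x y

/-- The complex lines spanned by `x` and `y` are orthogonal. -/
def HermitianOrtho {V : Type*} [AddCommGroup V] [Module ℝ V]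
    (g : V →ₗ[ℝ] V →ₗ[ℝ] ℝ) (J : V →ₗ[ℝ] V) (x y : V) : Prop :=
  g x y = 0 ∧ g x (J y) = 0

/-- A unitary system of vectors. -/
structure IsUnitaryFrame {V : Type*} [AddCommGroup V] [Module ℝ V]
    (g : V →ₗ[ℝ] V →ₗ[ℝ] ℝ) (J : V →ₗ[ℝ] V) {ι : Type*} (e : ι → V) : Prop where
  unit : ∀ i, g (e i) (e i) = 1 ∨ g (e i) (e i) = -1
  ortho : ∀ i j, i ≠ j → HermitianOrtho g J (e i) (e j)

variable {V : Type*} [AddCommGroup V] [Module ℝ V]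
  {g : V →ₗ[ℝ] V →ₗ[ℝ] ℝ} {J : V →ₗ[ℝ] V}

namespace IsHermitianForm

variable (h : IsHermitianForm g J)
include h

theorem J_left (x y : V) : g (J x) y = -g x (J y) := by
  rw [← h.J_isometry x, h.J_sq, map_neg, neg_neg]

theorem self_J (x : V) : g x (J x) = 0 := by
  linarith [h.J_left x x, h.symm x (J x)]

theorem J_self (x : V) : g (J x) x = 0 := by
  rw [h.symm, h.self_J]

end IsHermitianForm

namespace HermitianOrtho

variable {x y z : V}

theorem symm (h : IsHermitianForm g J) (hxy : HermitianOrtho g J x y) :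
    HermitianOrtho g J y x :=
  ⟨by rw [h.symm, hxy.1], by rw [h.symm, h.J_left, hxy.2, neg_zero]⟩

theorem J_right (h : IsHermitianForm g J) (hxy : HermitianOrtho g J x y) :
    HermitianOrtho g J x (J y) :=
  ⟨hxy.2, by rw [h.J_sq, map_neg, hxy.1, neg_zero]⟩

theorem J_left (h : IsHermitianForm g J) (hxy : HermitianOrtho g J x y) :
    HermitianOrtho g J (J x) y :=
  ((hxy.symm h).J_right h).symm h

theorem add_right (hy : HermitianOrtho g J x y) (hz : HermitianOrtho g J x z) :
    HermitianOrtho g J x (y + z) :=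
  ⟨by rw [map_add, hy.1, hz.1, add_zero], by rw [map_add, map_add, hy.2, hz.2, add_zero]⟩

theorem smul_right (c : ℝ) (hy : HermitianOrtho g J x y) : HermitianOrtho g J x (c • y) :=
  ⟨by rw [map_smul, hy.1, smul_zero], by rw [map_smul, map_smul, hy.2, smul_zero]⟩

theorem sub_right (hy : HermitianOrtho g J x y) (hz : HermitianOrtho g J x z) :
    HermitianOrtho g J x (y - z) :=
  ⟨by rw [map_sub, hy.1, hz.1, sub_zero], by rw [map_sub, map_sub, hy.2, hz.2, sub_zero]⟩

theorem smul_left (c : ℝ) (hy : HermitianOrtho g J x y) : HermitianOrtho g J (c • x) y :=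
  ⟨by rw [map_smul, LinearMap.smul_apply, hy.1, smul_zero],
    by rw [map_smul, LinearMap.smul_apply, hy.2, smul_zero]⟩

end HermitianOrtho

namespace IsHermitianForm

/-- Subtracting from `v` its components in the complex line of `x`. -/
theorem exists_ortho_sub (h : IsHermitianForm g J) {σ : ℝ} {v x : V}
    (hσ : σ = 1 ∨ σ = -1) (hv : σ * g v v < 0) (hx : 0 < σ * g x x) :
    ∃ b, σ * g b b < 0 ∧ HermitianOrtho g J x b ∧
      ∀ w, HermitianOrtho g J w x → HermitianOrtho g J w v → HermitianOrtho g J w b := by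
  have hx0 : g x x ≠ 0 := by rintro h0; simp [h0] at hx
  refine ⟨v - (g x v / g x x) • x - (g (J x) v / g x x) • J x, ?_, ⟨?_, ?_⟩, ?_⟩
  · have h1 : g (v - (g x v / g x x) • x - (g (J x) v / g x x) • J x)
        (v - (g x v / g x x) • x - (g (J x) v / g x x) • J x)
        = g v v - (g x v ^ 2 + g (J x) v ^ 2) / g x x := by
      simp only [map_sub, map_smul, LinearMap.sub_apply, LinearMap.smul_apply, smul_eq_mul,
        h.symm v x, h.symm v (J x), h.self_J, h.J_self, h.J_isometry]
      field_simp
      ring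
    rw [h1]
    -- The removed component lies in a complex line on which `σ g` is positive, so removing it only
    -- makes `σ g(v, v)` more negative.
    have h2 : 0 ≤ σ * ((g x v ^ 2 + g (J x) v ^ 2) / g x x) := by
      rcases hσ with rfl | rfl
      · have : 0 < g x x := by linarith
        positivity
      · have h3 : 0 < -g x x := by linarith
        have h4 : 0 ≤ (g x v ^ 2 + g (J x) v ^ 2) / -g x x := by positivity
        rw [div_neg] at h4
        linarith
    rw [mul_sub]
    linarith
  · simp only [map_sub, map_smul, smul_eq_mul, h.self_J]
    field_simp
    ring
  · simp only [map_sub, map_smul, smul_eq_mul, h.self_J, h.J_sq, map_neg, h.J_left]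
    field_simp
    ring
  · intro w hw hwv
    exact (hwv.sub_right (hw.smul_right _)).sub_right ((hw.J_right h).smul_right _)

/-- A large enough negative definite subspace provides negative vectors orthogonal to given
positive lines and to one further line. -/
theorem exists_ortho_neg (h : IsHermitianForm g J) {σ : ℝ} (hσ : σ = 1 ∨ σ = -1)
    (hN : ∃ f : Fin 3 → V, ∀ i j, g (f i) (f j) = if i = j then -σ else 0)
    {x y z w : V} (hx : 0 < σ * g x x) (hy : 0 < σ * g y y) (hz : 0 < σ * g z z)
    (hxy : HermitianOrtho g J x y) (hxz : HermitianOrtho g J x z) (hxw : HermitianOrtho g J x w)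
    (hyz : HermitianOrtho g J y z) (hyw : HermitianOrtho g J y w) (hzw : HermitianOrtho g J z w) :
    ∃ b, σ * g b b < 0 ∧ HermitianOrtho g J x b ∧ HermitianOrtho g J y b ∧
      HermitianOrtho g J z b ∧ HermitianOrtho g J w b := by
  obtain ⟨f, hf⟩ := hN
  have hσ2 : σ * σ = 1 := by rcases hσ with rfl | rfl <;> norm_num
  have hv : ∃ v, σ * g v v < 0 ∧ HermitianOrtho g J w v := by
    let L : (Fin 3 → ℝ) →ₗ[ℝ] ℝ × ℝ :=
      ((g w).prod (g (J w))).comp (Fintype.linearCombination ℝ f)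
    -- Orthogonality to `w` and `J w` imposes two conditions on a three-dimensional definite
    -- subspace.
    have hL : LinearMap.ker L ≠ ⊥ := LinearMap.ker_ne_bot_of_finrank_lt (by simp)
    obtain ⟨c, hc, hc0⟩ := Submodule.exists_mem_ne_zero_of_ne_bot hL
    have hc' : g w (Fintype.linearCombination ℝ f c) = 0 ∧
        g (J w) (Fintype.linearCombination ℝ f c) = 0 := by
      simpa [L] using hc
    refine ⟨Fintype.linearCombination ℝ f c, ?_, hc'.1, ?_⟩
    · have h1 : g (Fintype.linearCombination ℝ f c) (Fintype.linearCombination ℝ f c) =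
          -σ * (c 0 ^ 2 + c 1 ^ 2 + c 2 ^ 2) := by
        simp [Fintype.linearCombination_apply, Fin.sum_univ_three, hf]
        ring
      have h2 : 0 < c 0 ^ 2 + c 1 ^ 2 + c 2 ^ 2 := by
        obtain ⟨i, hi⟩ := Function.ne_iff.1 hc0
        have hi' := pow_pos (abs_pos.2 hi) 2
        rw [sq_abs] at hi'
        fin_cases i <;> simp at hi' <;> nlinarith [sq_nonneg (c 0), sq_nonneg (c 1), sq_nonneg (c 2)]
      rw [h1]
      nlinarith
    · linarith [h.J_left w (Fintype.linearCombination ℝ f c)]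
  obtain ⟨v, hv, hwv⟩ := hv
  -- The lines of `x`, `y`, `z` are removed in turn; as they are orthogonal to each other and to
  -- `w`, each step keeps the orthogonality already achieved.
  obtain ⟨b₁, hb₁, hxb, H₁⟩ := h.exists_ortho_sub hσ hv hx
  obtain ⟨b₂, hb₂, hyb, H₂⟩ := h.exists_ortho_sub hσ hb₁ hy
  obtain ⟨b₃, hb₃, hzb, H₃⟩ := h.exists_ortho_sub hσ hb₂ hz
  exact ⟨b₃, hb₃, H₃ x hxz (H₂ x hxy hxb), H₃ y hyz hyb, hzb,
    H₃ w (hzw.symm h) (H₂ w (hyw.symm h) (H₁ w (hxw.symm h) hwv))⟩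

theorem exists_unit_smul {x : V} {σ : ℝ} (hσ : σ = 1 ∨ σ = -1) (hx : 0 < σ * g x x) :
    ∃ c : ℝ, c ≠ 0 ∧ g (c • x) (c • x) = σ := by
  refine ⟨(√(σ * g x x))⁻¹, inv_ne_zero (Real.sqrt_ne_zero'.2 hx), ?_⟩
  have hs := Real.mul_self_sqrt hx.le
  have hs0 := Real.sqrt_ne_zero'.2 hx
  have hσ2 : σ * σ = 1 := by rcases hσ with rfl | rfl <;> norm_num
  simp only [map_smul, LinearMap.smul_apply, smul_eq_mul]
  field_simp
  rw [pow_two, hs]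
  linear_combination (-g x x) * hσ2

end IsHermitianForm

namespace IsUnitaryFrame

/-- `P` is the orthogonal projection to the span of the system. If every vector of the complement
were null, polarisation would make the complement orthogonal to itself and to the span, hence zero
by nondegeneracy, and `2 k` vectors would span the space. -/
theorem exists_unit_ortho [FiniteDimensional ℝ V] (h : IsHermitianForm g J)
    (hg : ∀ v, (∀ w, g v w = 0) → v = 0) {k : ℕ} (hk : 2 * k < finrank ℝ V)
    {e : Fin k → V} (he : IsUnitaryFrame g J e) :
    ∃ v, (g v v = 1 ∨ g v v = -1) ∧ ∀ i, HermitianOrtho g J (e i) v := by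
  let P : V → V := fun v => ∑ i, ((g (e i) (e i) * g (e i) v) • e i
    + (g (e i) (e i) * g (J (e i)) v) • J (e i))
  have hP : ∀ v i, HermitianOrtho g J (e i) (v - P v) := fun v i => by
    have hi : g (e i) (e i) * g (e i) (e i) = 1 := by
      rcases he.unit i with h1 | h1 <;> rw [h1] <;> norm_num
    constructor
    · have h1 : g (e i) (P v) = g (e i) v := by
        rw [map_sum, Finset.sum_eq_single i]
        · simp only [map_add, map_smul, smul_eq_mul, h.self_J]
          linear_combination (g (e i) v) * hi
        · intro j _ hj
          simp [(he.ortho i j hj.symm).1, (he.ortho i j hj.symm).2]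
        · simp
      rw [map_sub, h1, sub_self]
    · have h1 : g (e i) (J (P v)) = g (e i) (J v) := by
        rw [map_sum, map_sum, Finset.sum_eq_single i]
        · simp only [map_add, map_smul, smul_eq_mul, h.self_J, h.J_sq, map_neg, h.J_left]
          linear_combination (g (e i) (J v)) * hi
        · intro j _ hj
          simp [(he.ortho i j hj.symm).1, (he.ortho i j hj.symm).2, h.J_sq]
        · simp
      rw [map_sub, map_sub, h1, sub_self]
  have hPo : ∀ v w, (∀ i, HermitianOrtho g J (e i) w) → g w (P v) = 0 := fun v w hw => by
    simp only [P, map_sum, map_add, map_smul, ((hw _).symm h).1, ((hw _).symm h).2, smul_zero,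
      add_zero, Finset.sum_const_zero]
  have hex : ∃ v, g v v ≠ 0 ∧ ∀ i, HermitianOrtho g J (e i) v := by
    by_contra! hcon
    have hself : ∀ v, (∀ i, HermitianOrtho g J (e i) v) → g v v = 0 := fun v hv => by
      by_contra h0
      obtain ⟨i, hi⟩ := hcon v h0
      exact hi (hv i)
    have hzero : ∀ v, v = P v := fun v => by
      refine sub_eq_zero.1 (hg _ fun w => ?_)
      have h1 := hself (v - P v + (w - P w)) fun i => (hP v i).add_right (hP w i)
      have h2 := hself _ (hP v)
      have h3 := hself _ (hP w)
      have h4 := hPo w (v - P v) (hP v)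
      rw [map_add, map_add, LinearMap.add_apply, LinearMap.add_apply, h2, h3,
        h.symm (w - P w)] at h1
      rw [map_sub (g (v - P v)) w, h4] at h1
      linarith
    have hspan : (⊤ : Submodule ℝ V) ≤ Submodule.span ℝ
        (Set.range (Sum.elim e fun i => J (e i))) := fun v _ => by
      rw [hzero v]
      refine Submodule.sum_mem _ fun i _ => Submodule.add_mem _ ?_ ?_
      · exact Submodule.smul_mem _ _ (Submodule.subset_span ⟨Sum.inl i, rfl⟩)
      · exact Submodule.smul_mem _ _ (Submodule.subset_span ⟨Sum.inr i, rfl⟩)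
    have hcard := finrank_range_le_card (R := ℝ) (Sum.elim e fun i => J (e i))
    rw [Set.finrank, top_le_iff.1 hspan, finrank_top, Fintype.card_sum, Fintype.card_fin] at hcard
    omega
  obtain ⟨v, hv, hev⟩ := hex
  rcases lt_or_gt_of_ne hv with hv | hv
  · obtain ⟨c, -, hc⟩ := IsHermitianForm.exists_unit_smul (g := g) (x := v) (σ := -1) (by simp)
      (by linarith)
    exact ⟨c • v, Or.inr hc, fun i => (hev i).smul_right c⟩
  · obtain ⟨c, -, hc⟩ := IsHermitianForm.exists_unit_smul (g := g) (x := v) (σ := 1) (by simp)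
      (by linarith)
    exact ⟨c • v, Or.inl hc, fun i => (hev i).smul_right c⟩

/-- Every unitary system can be completed. -/
theorem exists_extension [FiniteDimensional ℝ V] (h : IsHermitianForm g J)
    (hg : ∀ v, (∀ w, g v w = 0) → v = 0) {k : ℕ} {e : Fin k → V} (he : IsUnitaryFrame g J e)
    (m : ℕ) (hm : 2 * (k + m) ≤ finrank ℝ V) :
    ∃ e' : Fin (k + m) → V, IsUnitaryFrame g J e' ∧ ∀ i, e' (Fin.castAdd m i) = e i := by
  induction m with
  | zero => exact ⟨e, he, fun i => rfl⟩
  | succ m ih =>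
    obtain ⟨e', he', hee⟩ := ih (by omega)
    obtain ⟨v, hv, hev⟩ := he'.exists_unit_ortho h hg (by omega)
    refine ⟨Fin.snoc (α := fun _ => V) e' v, ⟨fun i => ?_, fun i j hij => ?_⟩, fun i => ?_⟩
    · induction i using Fin.lastCases with
      | last => simpa using hv
      | cast i => simpa using he'.unit i
    · induction i using Fin.lastCases with
      | last =>
        induction j using Fin.lastCases with
        | last => exact absurd rfl hij
        | cast j => simpa using (hev j).symm h
      | cast i =>
        induction j using Fin.lastCases with
        | last => simpa using hev i
        | cast j => simpa using he'.ortho i j (fun h0 => hij (by rw [h0]))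
    · rw [← hee i]
      exact Fin.snoc_castSucc (α := fun _ => V) v e' (Fin.castAdd m i)

end IsUnitaryFrame

end

/-! ### From isotropic planes to four orthogonal complex lines. -/

section

variable {V : Type*} [AddCommGroup V] [Module ℝ V]
  {g : V →ₗ[ℝ] V →ₗ[ℝ] ℝ} {J : V →ₗ[ℝ] V} {T : V → V → V → V → ℝ}

/-- All the components of `T` in which `x`, `y`, `z`, `w` occur once vanish. -/
def VanishesOn {V : Type*} (T : V → V → V → V → ℝ) (x y z w : V) : Prop :=
  T x y z w = 0 ∧ T x z y w = 0 ∧ T x w y z = 0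

namespace VanishesOn

variable {x y z w : V}

/-- The three adjacent transpositions generate all permutations, so the four vectors may be sorted
by sign. -/
theorem swap_first (hT : IsCurvatureTensor T) (h : VanishesOn T x y z w) :
    VanishesOn T y x z w := by
  obtain ⟨h1, h2, h3⟩ := h
  refine ⟨by linarith [hT.swap_left x y z w], ?_, ?_⟩
  · rw [← hT.swap_pairs, h3]
  · rw [← hT.swap_pairs, h2]

theorem swap_last (hT : IsCurvatureTensor T) (h : VanishesOn T x y z w) :
    VanishesOn T x y w z := by
  obtain ⟨h1, h2, h3⟩ := h
  exact ⟨by linarith [hT.swap_right x y z w], h3, h2⟩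

theorem swap_middle (hT : IsCurvatureTensor T) (h : VanishesOn T x y z w) :
    VanishesOn T x z y w := by
  obtain ⟨h1, h2, h3⟩ := h
  exact ⟨h2, h1, by linarith [hT.swap_right x w y z]⟩

theorem of_add_smul (hT : IsCurvatureTensor T) {t : ℝ} (ht : t ≠ 0) {u : V}
    (h : VanishesOn T x y z w) (h' : VanishesOn T x y z (w + t • u)) : VanishesOn T x y z u := by
  obtain ⟨h1, h2, h3⟩ := h
  obtain ⟨h1', h2', h3'⟩ := h'
  rw [hT.add_fourth, hT.smul_fourth, h1, zero_add] at h1'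
  rw [hT.add_fourth, hT.smul_fourth, h2, zero_add] at h2'
  rw [hT.add_second, hT.smul_second, h3, zero_add] at h3'
  exact ⟨(mul_eq_zero.1 h1').resolve_left ht, (mul_eq_zero.1 h2').resolve_left ht,
    (mul_eq_zero.1 h3').resolve_left ht⟩

theorem of_smul (hT : IsCurvatureTensor T) {a b c d : ℝ} (ha : a ≠ 0) (hb : b ≠ 0) (hc : c ≠ 0)
    (hd : d ≠ 0) (h : VanishesOn T (a • x) (b • y) (c • z) (d • w)) : VanishesOn T x y z w := by
  simpa [VanishesOn, hT.smul_left, hT.smul_second, hT.smul_third, hT.smul_fourth, ha, hb, hc, hd]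
    using h

end VanishesOn

/-- The four complex lines spanned by `x`, `y`, `z`, `w` are pairwise orthogonal. -/
structure HermitianOrtho₄ {V : Type*} [AddCommGroup V] [Module ℝ V]
    (g : V →ₗ[ℝ] V →ₗ[ℝ] ℝ) (J : V →ₗ[ℝ] V) (x y z w : V) : Prop where
  xy : HermitianOrtho g J x y
  xz : HermitianOrtho g J x z
  xw : HermitianOrtho g J x w
  yz : HermitianOrtho g J y z
  yw : HermitianOrtho g J y w
  zw : HermitianOrtho g J z w

/-- `T(ξ, η, η, ξ) = 0` for orthogonal isotropic `ξ = x + a` and `η = y + b` adapted to a unitary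
system. -/
def IsFlatOnIsotropic {V : Type*} [AddCommGroup V] [Module ℝ V]
    (g : V →ₗ[ℝ] V →ₗ[ℝ] ℝ) (J : V →ₗ[ℝ] V) (T : V → V → V → V → ℝ) : Prop :=
  ∀ x y a b, HermitianOrtho₄ g J x y a b → g x x = 1 → g y y = 1 → g a a = -1 → g b b = -1 →
    T (x + a) (y + b) (y + b) (x + a) = 0

/-- `g` has at least three negative (`σ = 1`) or positive (`σ = -1`) squares. -/
def HasThreeSquares {V : Type*} [AddCommGroup V] [Module ℝ V]
    (g : V →ₗ[ℝ] V →ₗ[ℝ] ℝ) (σ : ℝ) : Prop :=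
  ∃ f : Fin 3 → V, ∀ i j, g (f i) (f j) = if i = j then -σ else 0

theorem HermitianOrtho₄.neg_fourth {x y z w : V} (ho : HermitianOrtho₄ g J x y z w) :
    HermitianOrtho₄ g J x y z (-w) := by
  have := fun u (hu : HermitianOrtho g J u w) => hu.smul_right (-1)
  simp only [neg_one_smul] at this
  exact ⟨ho.xy, ho.xz, this _ ho.xw, ho.yz, this _ ho.yw, this _ ho.zw⟩

theorem HermitianOrtho₄.swap_middle (h : IsHermitianForm g J) {x y z w : V}
    (ho : HermitianOrtho₄ g J x y z w) : HermitianOrtho₄ g J x z y w :=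
  ⟨ho.xz, ho.xy, ho.xw, ho.yz.symm h, ho.zw, ho.yw⟩

theorem HermitianOrtho₄.swap_last (h : IsHermitianForm g J) {x y z w : V}
    (ho : HermitianOrtho₄ g J x y z w) : HermitianOrtho₄ g J x y w z :=
  ⟨ho.xy, ho.xw, ho.xz, ho.yw, ho.yz, ho.zw.symm h⟩

theorem HermitianOrtho₄.swap_first (h : IsHermitianForm g J) {x y z w : V}
    (ho : HermitianOrtho₄ g J x y z w) : HermitianOrtho₄ g J y x z w :=
  ⟨ho.xy.symm h, ho.yz, ho.yw, ho.xz, ho.xw, ho.zw⟩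

namespace IsFlatOnIsotropic

variable (h : IsHermitianForm g J) (hT : IsCurvatureTensor T) (hF : IsFlatOnIsotropic g J T)
include h hT hF

/-- The hypothesis also applies to `-a` and `-b`. The alternating sum over the four sign choices
isolates the terms containing `a` once and `b` once, and pair symmetry identifies these in twos. -/
theorem mixed_add_mixed {x y a b : V} (ho : HermitianOrtho₄ g J x y a b) (hx : g x x = 1)
    (hy : g y y = 1) (ha : g a a = -1) (hb : g b b = -1) :
    T x y b a + T x b y a = 0 := by
  have ho' := ((ho.swap_last h).neg_fourth).swap_last h
  have h1 := hF x y a b ho hx hy ha hb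
  have h2 := hF x y a (-b) ho.neg_fourth hx hy ha (by simpa using hb)
  have h3 := hF x y (-a) b ho' hx hy (by simpa using ha) hb
  have h4 := hF x y (-a) (-b) ho'.neg_fourth hx hy (by simpa using ha) (by simpa using hb)
  simp only [hT.add_left, hT.add_second, hT.add_third, hT.add_fourth, hT.neg_left, hT.neg_second,
    hT.neg_third, hT.neg_fourth] at h1 h2 h3 h4
  have h5 : T a y b x = T x b y a := by
    rw [← hT.swap_pairs, hT.swap_left, hT.swap_right]; ring
  have h6 : T a b y x = T x y b a := by
    rw [← hT.swap_pairs, hT.swap_left, hT.swap_right]; ring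
  linarith

/-- The polarised identity for `(a, b)` and for `(b, a)`, together with the Bianchi identity,
determines all three components. -/
theorem vanishesOn_unit {x y a b : V} (ho : HermitianOrtho₄ g J x y a b) (hx : g x x = 1)
    (hy : g y y = 1) (ha : g a a = -1) (hb : g b b = -1) : VanishesOn T x y a b := by
  have h1 := mixed_add_mixed h hT hF ho hx hy ha hb
  have h2 := mixed_add_mixed h hT hF (ho.swap_last h) hx hy hb ha
  have h3 := hT.bianchi x y b a
  have h4 := hT.swap_right x y a b
  have h5 := hT.swap_left x b y a
  have h6 : T y b x a = T x a y b := hT.swap_pairs ..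
  refine ⟨?_, ?_, ?_⟩ <;> linarith

theorem vanishesOn_two_two {σ : ℝ} (hσ : σ = 1 ∨ σ = -1) {x y a b : V}
    (ho : HermitianOrtho₄ g J x y a b) (hx : 0 < σ * g x x)
    (hy : 0 < σ * g y y) (ha : σ * g a a < 0) (hb : σ * g b b < 0) : VanishesOn T x y a b := by
  have hσ' : -σ = 1 ∨ -σ = -1 := by rcases hσ with rfl | rfl <;> simp
  obtain ⟨c₁, hc₁, hx'⟩ := IsHermitianForm.exists_unit_smul hσ hx
  obtain ⟨c₂, hc₂, hy'⟩ := IsHermitianForm.exists_unit_smul hσ hy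
  obtain ⟨c₃, hc₃, ha'⟩ := IsHermitianForm.exists_unit_smul (x := a) hσ' (by linarith)
  obtain ⟨c₄, hc₄, hb'⟩ := IsHermitianForm.exists_unit_smul (x := b) hσ' (by linarith)
  have ho' : HermitianOrtho₄ g J (c₁ • x) (c₂ • y) (c₃ • a) (c₄ • b) :=
    ⟨(ho.xy.smul_left _).smul_right _, (ho.xz.smul_left _).smul_right _,
      (ho.xw.smul_left _).smul_right _, (ho.yz.smul_left _).smul_right _,
      (ho.yw.smul_left _).smul_right _, (ho.zw.smul_left _).smul_right _⟩
  refine VanishesOn.of_smul hT hc₁ hc₂ hc₃ hc₄ ?_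
  rcases hσ with rfl | rfl
  · exact vanishesOn_unit h hT hF ho' hx' hy' ha' hb'
  · have h1 := vanishesOn_unit h hT hF
      ((((ho'.swap_middle h).swap_first h).swap_last h).swap_middle h)
      (by simpa using ha') (by simpa using hb') hx' hy'
    exact (((h1.swap_middle hT).swap_last hT).swap_first hT).swap_middle hT

-- The negative vectors form an open cone, so `b` may be moved slightly in the direction of `z`.
omit hT hF in
theorem _root_.IsHermitianForm.exists_small {σ : ℝ} {b z : V} (hb : σ * g b b < 0)
    (hz : 0 < σ * g z z) (hbz : HermitianOrtho g J z b) :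
    ∃ t : ℝ, t ≠ 0 ∧ σ * g (b + t • z) (b + t • z) < 0 := by
  have hA : 0 < -(σ * g b b) := by linarith
  -- With `A = -σ g(b, b)` and `B = σ g(z, z)`, the choice `t = A / (A + B)` gives `t² B < t B = A
  -- (1 - t) < A`.
  refine ⟨-(σ * g b b) / (-(σ * g b b) + σ * g z z), by positivity, ?_⟩
  generalize ht : -(σ * g b b) / (-(σ * g b b) + σ * g z z) = t
  have h1 : g (b + t • z) (b + t • z) = g b b + t ^ 2 * g z z := by
    simp only [map_add, map_smul, LinearMap.add_apply, LinearMap.smul_apply, smul_eq_mul, hbz.1,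
      (hbz.symm h).1]
    ring
  have ht0 : 0 < t := by rw [← ht]; positivity
  have ht1 : t * (-(σ * g b b) + σ * g z z) = -(σ * g b b) := by
    rw [← ht]; exact div_mul_cancel₀ _ (by positivity)
  have ht2 : t < 1 := by rw [← ht, div_lt_one (by positivity)]; linarith
  rw [h1]
  nlinarith [mul_pos ht0 hA, mul_pos ht0 hz, mul_pos (mul_pos ht0 hz) (sub_pos.2 ht2)]

/-- With an auxiliary negative `b`, both `(x, y, a, b)` and `(x, y, a, b + t z)` are of type two
plus two; by linearity the component with `z` in place of `b` vanishes. -/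
theorem vanishesOn_three_one {σ : ℝ} (hσ : σ = 1 ∨ σ = -1) (hN : HasThreeSquares g σ)
    {x y z a : V} (ho : HermitianOrtho₄ g J x y z a) (hx : 0 < σ * g x x)
    (hy : 0 < σ * g y y) (hz : 0 < σ * g z z) (ha : σ * g a a < 0) : VanishesOn T x y z a := by
  obtain ⟨b, hb, hxb, hyb, hzb, hab⟩ := h.exists_ortho_neg hσ hN hx hy hz ho.xy ho.xz ho.xw ho.yz
    ho.yw ho.zw
  obtain ⟨t, ht, hbt⟩ := h.exists_small hb hz hzb
  have h1 := vanishesOn_two_two h hT hF hσ ⟨ho.xy, ho.xw, hxb, ho.yw, hyb, hab⟩ hx hy ha hb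
  have h2 := vanishesOn_two_two h hT hF hσ ⟨ho.xy, ho.xw, hxb.add_right (ho.xz.smul_right t), ho.yw,
    hyb.add_right (ho.yz.smul_right t), hab.add_right ((ho.zw.symm h).smul_right t)⟩ hx hy ha hbt
  exact (VanishesOn.of_add_smul hT ht h1 h2).swap_last hT

/-- The same perturbation, from type three plus one. The auxiliary `b` is also orthogonal to `w`, so
the square of `b + t w` has no cross term. -/
theorem vanishesOn_four {σ : ℝ} (hσ : σ = 1 ∨ σ = -1) (hN : HasThreeSquares g σ)
    {x y z w : V} (ho : HermitianOrtho₄ g J x y z w) (hx : 0 < σ * g x x)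
    (hy : 0 < σ * g y y) (hz : 0 < σ * g z z) (hw : 0 < σ * g w w) : VanishesOn T x y z w := by
  obtain ⟨b, hb, hxb, hyb, hzb, hwb⟩ := h.exists_ortho_neg hσ hN hx hy hz ho.xy ho.xz ho.xw ho.yz
    ho.yw ho.zw
  obtain ⟨t, ht, hbt⟩ := h.exists_small hb hw hwb
  have h1 := vanishesOn_three_one h hT hF hσ hN ⟨ho.xy, ho.xz, hxb, ho.yz, hyb, hzb⟩ hx hy hz hb
  have h2 := vanishesOn_three_one h hT hF hσ hN ⟨ho.xy, ho.xz, hxb.add_right (ho.xw.smul_right t),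
    ho.yz, hyb.add_right (ho.yw.smul_right t), hzb.add_right (ho.zw.smul_right t)⟩ hx hy hz hbt
  exact VanishesOn.of_add_smul hT ht h1 h2

theorem vanishesOn (hN : HasThreeSquares g 1) (hP : HasThreeSquares g (-1))
    {x y z w : V} (ho : HermitianOrtho₄ g J x y z w) (hx : g x x ≠ 0)
    (hy : g y y ≠ 0) (hz : g z z ≠ 0) (hw : g w w ≠ 0) : VanishesOn T x y z w := by
  obtain ⟨σ, hσ, hxσ⟩ : ∃ σ : ℝ, (σ = 1 ∨ σ = -1) ∧ 0 < σ * g x x := by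
    rcases lt_or_gt_of_ne hx with h0 | h0
    · exact ⟨-1, Or.inr rfl, by linarith⟩
    · exact ⟨1, Or.inl rfl, by linarith⟩
  have hσ' : -σ = 1 ∨ -σ = -1 := by rcases hσ with rfl | rfl <;> simp
  have hS : HasThreeSquares g σ := by rcases hσ with rfl | rfl <;> assumption
  have hS' : HasThreeSquares g (-σ) := by
    rcases hσ' with h0 | h0 <;> rw [h0] <;> assumption
  have hne : ∀ v, g v v ≠ 0 → σ * g v v < 0 ∨ 0 < σ * g v v := fun v hv =>
    lt_or_gt_of_ne (mul_ne_zero (by rcases hσ with rfl | rfl <;> norm_num) hv)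
  -- The sign `σ` makes `x` positive. When the other three are all negative, the roles are exchanged
  -- by passing to `-σ`.
  rcases hne y hy with hy | hy <;> rcases hne z hz with hz | hz <;> rcases hne w hw with hw | hw
  · have := vanishesOn_three_one h hT hF hσ' hS'
      (((ho.swap_first h).swap_middle h).swap_last h) (by linarith) (by linarith) (by linarith)
      (by linarith)
    exact ((this.swap_last hT).swap_middle hT).swap_first hT
  · have := vanishesOn_two_two h hT hF hσ ((ho.swap_last h).swap_middle h) hxσ hw hy hz
    exact (this.swap_middle hT).swap_last hT
  · exact (vanishesOn_two_two h hT hF hσ (ho.swap_middle h) hxσ hz hy hw).swap_middle hT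
  · have := vanishesOn_three_one h hT hF hσ hS ((ho.swap_middle h).swap_last h) hxσ hz hw hy
    exact (this.swap_last hT).swap_middle hT
  · exact vanishesOn_two_two h hT hF hσ ho hxσ hy hz hw
  · exact (vanishesOn_three_one h hT hF hσ hS (ho.swap_last h) hxσ hy hw hz).swap_last hT
  · exact vanishesOn_three_one h hT hF hσ hS ho hxσ hy hz hw
  · exact vanishesOn_four h hT hF hσ hS ho hxσ hy hz hw

end IsFlatOnIsotropic

end

/-! ### Rotations in pairs of complex lines. -/

section

variable {V : Type*} [AddCommGroup V] [Module ℝ V]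
  {g : V →ₗ[ℝ] V →ₗ[ℝ] ℝ} {J : V →ₗ[ℝ] V} {T : V → V → V → V → ℝ}

/-- Four pairwise orthogonal nonnull complex lines. -/
structure IsFrame₄ {V : Type*} [AddCommGroup V] [Module ℝ V]
    (g : V →ₗ[ℝ] V →ₗ[ℝ] ℝ) (J : V →ₗ[ℝ] V) (x y z w : V) : Prop where
  ortho : HermitianOrtho₄ g J x y z w
  x_ne : g x x ≠ 0
  y_ne : g y y ≠ 0
  z_ne : g z z ≠ 0
  w_ne : g w w ≠ 0

/-- `T` vanishes on four pairwise orthogonal nonnull complex lines. -/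
def VanishesOnFrames {V : Type*} [AddCommGroup V] [Module ℝ V]
    (g : V →ₗ[ℝ] V →ₗ[ℝ] ℝ) (J : V →ₗ[ℝ] V) (T : V → V → V → V → ℝ) : Prop :=
  ∀ x y z w, IsFrame₄ g J x y z w → T x y z w = 0

/-- In indefinite signature `x + t y` may be null; one of `t = 1` and `t = 2` always avoids this. -/
theorem exists_rotation_parameter {q r : ℝ} (hr : r ≠ 0) :
    ∃ t : ℝ, t ≠ 0 ∧ q + t ^ 2 * r ≠ 0 := by
  by_cases h0 : q + r = 0
  · exact ⟨2, by norm_num, fun h1 => hr (by linarith)⟩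
  · exact ⟨1, by norm_num, by simpa using h0⟩

namespace HermitianOrtho

/-- An unnormalised rotation, free of square roots and valid for all signs of the two squares. -/
theorem rotate (h : IsHermitianForm g J) {x y : V} (hxy : HermitianOrtho g J x y) (t : ℝ) :
    HermitianOrtho g J (x + t • y) ((t * g y y) • x - g x x • y) := by
  have hyx := hxy.symm h
  constructor
  · simp only [map_add, map_sub, map_smul, LinearMap.add_apply, LinearMap.smul_apply, smul_eq_mul,
      hxy.1, hyx.1]
    ring
  · simp only [map_add, map_sub, map_smul, LinearMap.add_apply, LinearMap.smul_apply, smul_eq_mul,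
      hxy.2, hyx.2, h.self_J]
    ring

theorem self_rotate (h : IsHermitianForm g J) {x y : V} (hxy : HermitianOrtho g J x y) (t : ℝ) :
    g (x + t • y) (x + t • y) = g x x + t ^ 2 * g y y := by
  simp only [map_add, map_smul, LinearMap.add_apply, LinearMap.smul_apply, smul_eq_mul,
    hxy.1, (hxy.symm h).1]
  ring

theorem self_rotate' (h : IsHermitianForm g J) {x y : V} (hxy : HermitianOrtho g J x y) (t : ℝ) :
    g ((t * g y y) • x - g x x • y) ((t * g y y) • x - g x x • y) =
      g x x * g y y * (g x x + t ^ 2 * g y y) := by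
  simp only [map_sub, map_smul, LinearMap.sub_apply, LinearMap.smul_apply, smul_eq_mul,
    hxy.1, (hxy.symm h).1]
  ring

end HermitianOrtho

namespace IsFrame₄

variable {x y z w : V}

theorem swap_first (h : IsHermitianForm g J) (hf : IsFrame₄ g J x y z w) : IsFrame₄ g J y x z w :=
  ⟨hf.ortho.swap_first h, hf.y_ne, hf.x_ne, hf.z_ne, hf.w_ne⟩

theorem swap_middle (h : IsHermitianForm g J) (hf : IsFrame₄ g J x y z w) :
    IsFrame₄ g J x z y w :=
  ⟨hf.ortho.swap_middle h, hf.x_ne, hf.z_ne, hf.y_ne, hf.w_ne⟩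

theorem swap_last (h : IsHermitianForm g J) (hf : IsFrame₄ g J x y z w) : IsFrame₄ g J x y w z :=
  ⟨hf.ortho.swap_last h, hf.x_ne, hf.y_ne, hf.w_ne, hf.z_ne⟩

theorem J_first (h : IsHermitianForm g J) (hf : IsFrame₄ g J x y z w) :
    IsFrame₄ g J (J x) y z w :=
  ⟨⟨hf.ortho.xy.J_left h, hf.ortho.xz.J_left h, hf.ortho.xw.J_left h, hf.ortho.yz, hf.ortho.yw,
    hf.ortho.zw⟩, by rw [h.J_isometry]; exact hf.x_ne, hf.y_ne, hf.z_ne, hf.w_ne⟩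

theorem J_second (h : IsHermitianForm g J) (hf : IsFrame₄ g J x y z w) :
    IsFrame₄ g J x (J y) z w :=
  ((hf.swap_first h).J_first h).swap_first h

theorem J_third (h : IsHermitianForm g J) (hf : IsFrame₄ g J x y z w) :
    IsFrame₄ g J x y (J z) w :=
  ((hf.swap_middle h).J_second h).swap_middle h

theorem J_fourth (h : IsHermitianForm g J) (hf : IsFrame₄ g J x y z w) :
    IsFrame₄ g J x y z (J w) :=
  ((hf.swap_last h).J_third h).swap_last h

theorem rotate (h : IsHermitianForm g J) (hf : IsFrame₄ g J x y z w) {t : ℝ}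
    (ht : g x x + t ^ 2 * g y y ≠ 0) :
    IsFrame₄ g J (x + t • y) ((t * g y y) • x - g x x • y) z w := by
  have H : ∀ v, HermitianOrtho g J x v → HermitianOrtho g J y v →
      HermitianOrtho g J (x + t • y) v ∧
      HermitianOrtho g J ((t * g y y) • x - g x x • y) v := fun v hx hy =>
    ⟨((hx.symm h).add_right ((hy.symm h).smul_right _)).symm h,
      (((hx.symm h).smul_right _).sub_right ((hy.symm h).smul_right _)).symm h⟩
  refine ⟨⟨hf.ortho.xy.rotate h t, (H z hf.ortho.xz hf.ortho.yz).1, (H w hf.ortho.xw hf.ortho.yw).1,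
    (H z hf.ortho.xz hf.ortho.yz).2, (H w hf.ortho.xw hf.ortho.yw).2, hf.ortho.zw⟩,
    ?_, ?_, hf.z_ne, hf.w_ne⟩
  · rwa [hf.ortho.xy.self_rotate h]
  · rw [hf.ortho.xy.self_rotate' h]
    exact mul_ne_zero (mul_ne_zero hf.x_ne hf.y_ne) ht

end IsFrame₄

namespace VanishesOnFrames

variable (h : IsHermitianForm g J) (hT : IsCurvatureTensor T) (hV : VanishesOnFrames g J T)
include h hT hV

variable {x y z w : V} (hf : IsFrame₄ g J x y z w)
include hf

/-- Inserting the rotated pair of `x`, `y` in the first and third slots, the cross terms vanish by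
hypothesis and the two diagonal terms must cancel. So `T(x, z, x, w) / g(x, x)` is the same for `x`
and `y`. -/
theorem sectional_eq : g y y * T x z x w = g x x * T y z y w := by
  obtain ⟨t, ht, hq⟩ := exists_rotation_parameter (q := g x x) hf.y_ne
  have h1 := hV _ _ _ _ ((hf.rotate h hq).swap_middle h)
  have h2 := hV _ _ _ _ (hf.swap_middle h)
  have h3 := hV _ _ _ _ ((hf.swap_first h).swap_middle h)
  simp only [hT.add_left, hT.smul_left, hT.sub_third, hT.smul_third, h2, h3] at h1
  exact mul_left_cancel₀ ht (by linear_combination h1)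

theorem sectionalJ_eq : g y y * T x z (J x) w = g x x * T y z (J y) w := by
  obtain ⟨t, ht, hq⟩ := exists_rotation_parameter (q := g x x) hf.y_ne
  have h1 := hV _ _ _ _ (((hf.rotate h hq).J_second h).swap_middle h)
  have h2 := hV _ _ _ _ ((hf.J_second h).swap_middle h)
  have h3 := hV _ _ _ _ (((hf.swap_first h).J_second h).swap_middle h)
  simp only [map_sub, map_smul, hT.add_left, hT.smul_left, hT.sub_third, hT.smul_third, h2, h3]
    at h1
  exact mul_left_cancel₀ ht (by linear_combination h1)

/-- Both sides are compared with the same component on the line of `y`. -/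
theorem sectional_J_J : T (J x) z (J x) w = T x z x w := by
  have h1 := hV.sectional_eq h hT (hf.J_first h)
  have h2 := hV.sectional_eq h hT hf
  rw [h.J_isometry] at h1
  exact mul_left_cancel₀ hf.y_ne (by linear_combination h1 - h2)

theorem sectional_J_left : T (J x) z x w = -T x z (J x) w := by
  have h1 := hV.sectionalJ_eq h hT (hf.J_first h)
  have h2 := hV.sectionalJ_eq h hT hf
  rw [h.J_isometry, h.J_sq, hT.neg_third] at h1
  exact mul_left_cancel₀ hf.y_ne (by linear_combination h2 - h1)

theorem holomorphic_eq_two_mul : T x (J x) z w = 2 * T x z (J x) w := by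
  linarith [hT.bianchi x (J x) z w, hT.swap_left x z (J x) w, hV.sectional_J_left h hT hf]

/-- The components with three entries in the complex line of `x` and one in that of `w`, in terms
of those with two entries in the line of `y`. -/
theorem three_one_eq : g y y * T x (J x) x w =
    g x x * (T y (J x) y w + 3 * T y x (J y) w) := by
  obtain ⟨t, ht, hq⟩ := exists_rotation_parameter (q := g x x) hf.z_ne
  have hfr := hf.swap_middle h
  have hrot : ∀ t : ℝ, g x x + t ^ 2 * g z z ≠ 0 →
      g y y * T (x + t • z) (J ((t * g z z) • x - g x x • z)) (x + t • z) w =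
      (g x x + t ^ 2 * g z z) * T y (J ((t * g z z) • x - g x x • z)) y w := fun t ht => by
    have h1 := hV.sectional_eq h hT (((hfr.rotate h ht).J_second h).swap_middle h)
    rwa [hf.ortho.xz.self_rotate h] at h1
  -- The odd part in `t` is extracted from `t` and `-t`. It contains `T x (J x) x w`, while its
  -- other terms move to the line of `y` by the preceding relations; the factor 3 is 1 from `T x (J
  -- z) z w` and 2 from `T z (J z) x w`.
  have h1 := hrot t hq
  have h2 := hrot (-t) (by simpa using hq)
  have h3 := hV.sectional_eq h hT (x := z) (y := y) (z := J x) (w := w)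
    (((hfr.J_first h).swap_first h).swap_middle h)
  have hzxy : IsFrame₄ g J z y x w := ((hfr.swap_first h).swap_middle h)
  have h4 := hV.sectionalJ_eq h hT hzxy
  have h5 := hV.sectional_J_left h hT hzxy
  have h6 := hV.holomorphic_eq_two_mul h hT hzxy
  have h7 := hT.swap_left x (J z) z w
  simp only [map_sub, map_smul, hT.add_left, hT.smul_left, hT.add_third, hT.smul_third,
    hT.sub_second, hT.smul_second] at h1 h2
  refine mul_left_cancel₀ (mul_ne_zero ht hf.z_ne) ?_
  rw [h6] at h1 h2
  have h8 : T x (J z) z w = T z x (J z) w := by linarith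
  rw [h8] at h1 h2
  linear_combination (1 / 2) * (h1 - h2) - t ^ 3 * g z z * h3 + 3 * t * g x x * h4

end VanishesOnFrames

end

/-! ### The off-diagonal Ricci equations. -/

section

variable {V : Type*} [AddCommGroup V] [Module ℝ V]
  {g : V →ₗ[ℝ] V →ₗ[ℝ] ℝ} {J : V →ₗ[ℝ] V} {T : V → V → V → V → ℝ}

/-- The Ricci tensor and the Ricci `*`-tensor of `T`, computed in unitary frames, vanish. -/
def IsTraceFree {V : Type*} [AddCommGroup V] [Module ℝ V]
    (g : V →ₗ[ℝ] V →ₗ[ℝ] ℝ) (J : V →ₗ[ℝ] V) (T : V → V → V → V → ℝ) (n : ℕ) : Prop :=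
  ∀ e : Fin n → V, IsUnitaryFrame g J e → ∀ y z,
    ∑ i, g (e i) (e i) * (T (e i) y z (e i) + T (J (e i)) y z (J (e i))) = 0 ∧
    ∑ i, g (e i) (e i) * (T (e i) y (J z) (J (e i)) - T (J (e i)) y (J z) (e i)) = 0

theorem isUnitaryFrame_triple (h : IsHermitianForm g J) {x y z : V}
    (hx : g x x = 1 ∨ g x x = -1) (hy : g y y = 1 ∨ g y y = -1) (hz : g z z = 1 ∨ g z z = -1)
    (hxy : HermitianOrtho g J x y) (hxz : HermitianOrtho g J x z) (hyz : HermitianOrtho g J y z) :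
    IsUnitaryFrame g J ![x, y, z] := by
  refine ⟨fun i => ?_, fun i j hij => ?_⟩
  · fin_cases i <;> assumption
  · fin_cases i <;> fin_cases j
    · exact absurd rfl hij
    · exact hxy
    · exact hxz
    · exact hxy.symm h
    · exact absurd rfl hij
    · exact hyz
    · exact hxz.symm h
    · exact hyz.symm h
    · exact absurd rfl hij

theorem unit_ne_zero {x : V} (hx : g x x = 1 ∨ g x x = -1) : g x x ≠ 0 := by
  rcases hx with hx | hx <;> rw [hx] <;> norm_num

theorem unit_sq {x : V} (hx : g x x = 1 ∨ g x x = -1) : g x x * g x x = 1 := by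
  rcases hx with hx | hx <;> rw [hx] <;> norm_num

namespace IsUnitaryFrame

theorem isFrame₄ {ι : Type*} {e : ι → V} (he : IsUnitaryFrame g J e) {i j k l : ι} (hij : i ≠ j)
    (hik : i ≠ k) (hil : i ≠ l) (hjk : j ≠ k) (hjl : j ≠ l) (hkl : k ≠ l) :
    IsFrame₄ g J (e i) (e j) (e k) (e l) :=
  ⟨⟨he.ortho _ _ hij, he.ortho _ _ hik, he.ortho _ _ hil, he.ortho _ _ hjk, he.ortho _ _ hjl,
    he.ortho _ _ hkl⟩, unit_ne_zero (he.unit _), unit_ne_zero (he.unit _),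
    unit_ne_zero (he.unit _), unit_ne_zero (he.unit _)⟩

end IsUnitaryFrame

namespace VanishesOnFrames

variable [FiniteDimensional ℝ V] (h : IsHermitianForm g J) (hg : ∀ v, (∀ w, g v w = 0) → v = 0)
  (hT : IsCurvatureTensor T) (hV : VanishesOnFrames g J T) {m : ℕ} (hm : 1 ≤ m)
  (hdim : finrank ℝ V = 2 * (3 + m)) (htr : IsTraceFree g J T (3 + m))
include h hg hT hV hm hdim htr

variable {x y z w : V} (hy : g y y = 1 ∨ g y y = -1) (hz : g z z = 1 ∨ g z z = -1)
  (hw : g w w = 1 ∨ g w w = -1) (hzw : HermitianOrtho g J z w) (hzy : HermitianOrtho g J z y)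
  (hwy : HermitianOrtho g J w y)
include hy hz hw hzw hzy hwy

/-- These are `ρ(z, w) = 0` and `ρ*(z, w) = 0` in a unitary frame containing `z`, `w`, `y`, with
every term expressed on the line of `y`. -/
theorem ricci_relations :
    (-2 * ((3 + m : ℝ) - 1) * T y z y w + 3 * T y (J z) (J y) w - 3 * T y z (J y) (J w) = 0) ∧
    (-2 * ((3 + m : ℝ) + 1) * T y z (J y) (J w) - T y (J z) y (J w) - T y z y w = 0) := by
  obtain ⟨e, he, hee⟩ := (isUnitaryFrame_triple h hz hw hy hzw hzy hwy).exists_extension h hg m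
    (by omega)
  have hz' : e (Fin.castAdd m 0) = z := hee 0
  have hw' : e (Fin.castAdd m 1) = w := hee 1
  have hy' : e (Fin.castAdd m 2) = y := hee 2
  have hfr : ∀ k, IsFrame₄ g J (e (Fin.natAdd 3 k)) y z w := fun k => by
    rw [← hz', ← hw', ← hy']
    refine he.isFrame₄ ?_ ?_ ?_ ?_ ?_ ?_ <;> simp [Fin.ext_iff] <;> omega
  have hf : IsFrame₄ g J y (e (Fin.natAdd 3 ⟨0, hm⟩)) z w := (hfr _).swap_first h
  have hC := fun {v v' : V} (hfr' : IsFrame₄ g J v y z v') => hV.sectional_eq h hT hfr'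
  have hD := fun {v v' : V} (hfr' : IsFrame₄ g J v y z v') => hV.sectionalJ_eq h hT hfr'
  obtain ⟨h1, h2⟩ := htr e he z w
  rw [Fin.sum_univ_add, Fin.sum_univ_three] at h1 h2
  simp only [hz', hw', hy', hT.self_left, hT.self_right] at h1 h2
  have hyy := unit_sq hy
  have hzz := unit_sq hz
  have hww := unit_sq hw
  -- Each of the `m` lines other than those of `z`, `w`, `y` contributes as much as the line of `y`.
  have hk1 : ∀ k, g (e (Fin.natAdd 3 k)) (e (Fin.natAdd 3 k)) *
      (T (e (Fin.natAdd 3 k)) z w (e (Fin.natAdd 3 k)) +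
        T (J (e (Fin.natAdd 3 k))) z w (J (e (Fin.natAdd 3 k)))) =
      -2 * g y y * T y z y w := fun k => by
    have h3 := hV.sectional_J_J h hT ((hfr k).swap_middle h |>.swap_middle h)
    rw [hT.swap_right _ _ (e (Fin.natAdd 3 k)), hT.swap_right _ _ (J (e (Fin.natAdd 3 k))), h3]
    have h4 := hC (hfr k)
    have h5 := unit_sq (he.unit (Fin.natAdd 3 k))
    generalize g (e (Fin.natAdd 3 k)) (e (Fin.natAdd 3 k)) = q at *
    linear_combination (-2 * q * g y y) * h4 + 2 * q * T (e (Fin.natAdd 3 k)) z (e (Fin.natAdd 3 k)) w * hyy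
      - 2 * g y y * T y z y w * h5
  have hk2 : ∀ k, g (e (Fin.natAdd 3 k)) (e (Fin.natAdd 3 k)) *
      (T (e (Fin.natAdd 3 k)) z (J w) (J (e (Fin.natAdd 3 k))) -
        T (J (e (Fin.natAdd 3 k))) z (J w) (e (Fin.natAdd 3 k))) =
      -2 * g y y * T y z (J y) (J w) := fun k => by
    have h3 := hV.sectional_J_left h hT ((hfr k).J_fourth h)
    rw [hT.swap_right _ _ (e (Fin.natAdd 3 k)), hT.swap_right _ _ (J (e (Fin.natAdd 3 k))), h3]
    have h4 := hD ((hfr k).J_fourth h)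
    have h5 := unit_sq (he.unit (Fin.natAdd 3 k))
    generalize g (e (Fin.natAdd 3 k)) (e (Fin.natAdd 3 k)) = q at *
    linear_combination (-2 * q * g y y) * h4
      + 2 * q * T (e (Fin.natAdd 3 k)) z (J (e (Fin.natAdd 3 k))) (J w) * hyy
      - 2 * g y y * T y z (J y) (J w) * h5
  simp only [hk1, hk2, Finset.sum_const, Finset.card_univ, Fintype.card_fin, nsmul_eq_mul] at h1 h2
  have hy1 := hV.sectional_J_J h hT hf
  have hy2 := hV.sectional_J_left h hT (hf.J_fourth h)
  have hfz := (hf.swap_middle h).swap_first h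
  have hfw := ((((hfz.swap_last h).swap_middle h).swap_first h).swap_middle h).swap_last h
  -- The lines of `z` and `w` contribute components with three entries in one line, which are moved
  -- to the line of `y`.
  have ha := hV.three_one_eq h hT (hfz.J_first h)
  have hb := hV.three_one_eq h hT (hfw.J_first h)
  have hc := hV.three_one_eq h hT (hfz.J_fourth h)
  simp only [h.J_sq, h.J_isometry, hT.neg_second] at ha hb
  have e1 : T y w y z = T y z y w := hT.swap_pairs ..
  have e2 : T y (J w) (J y) z = -T y z (J y) (J w) := by rw [← hT.swap_pairs, hy2]
  have e3 : T (J z) z w (J z) = -T (J z) z (J z) w := hT.swap_right ..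
  have e4 : T (J w) z w (J w) = -T (J w) w (J w) z := by rw [hT.swap_right, hT.swap_pairs]
  have e5 : T (J z) z (J w) z = T z (J z) z (J w) := by
    rw [hT.swap_left, hT.swap_right]; ring
  have e6 : T (J w) z (J w) w = T (J w) w (J w) z := hT.swap_pairs ..
  have e7 : T y z w y + T (J y) z w (J y) = -2 * T y z y w := by
    rw [hT.swap_right _ _ y, hT.swap_right _ _ (J y), hy1]; ring
  have e8 : T y z (J w) (J y) - T (J y) z (J w) y = -2 * T y z (J y) (J w) := by
    rw [hT.swap_right _ _ y, hT.swap_right _ _ (J y), hy2]; ring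
  rw [e1, e2] at hb
  rw [e3, e4, e7] at h1
  rw [e5, e6, e8] at h2
  generalize g y y = r at *
  generalize g z z = p at *
  generalize g w w = q at *
  constructor
  · linear_combination r * h1 - p * ha - q * hb
      + (2 * T y z y w + 2 * m * T y z y w) * hyy
      - (-T y z y w + 3 * T y (J z) (J y) w) * hzz
      - (-T y z y w - 3 * T y z (J y) (J w)) * hww
  · linear_combination r * h2 + p * hc - q * hb
      + (2 * T y z (J y) (J w) + 2 * m * T y z (J y) (J w)) * hyy
      + (T y (J z) y (J w) + 3 * T y z (J y) (J w)) * hzz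
      - (-T y z y w - 3 * T y z (J y) (J w)) * hww

end VanishesOnFrames

end

/-! ### Vanishing on three lines, and its consequences for two lines. -/

section

variable {V : Type*} [AddCommGroup V] [Module ℝ V]
  {g : V →ₗ[ℝ] V →ₗ[ℝ] ℝ} {J : V →ₗ[ℝ] V} {T : V → V → V → V → ℝ}

theorem exists_smul_unit {x : V} (hx : g x x ≠ 0) :
    ∃ c : ℝ, c ≠ 0 ∧ (g (c • x) (c • x) = 1 ∨ g (c • x) (c • x) = -1) := by
  rcases lt_or_gt_of_ne hx with hx | hx
  · obtain ⟨c, hc, hcx⟩ := IsHermitianForm.exists_unit_smul (g := g) (x := x) (σ := -1) (by simp)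
      (by linarith)
    exact ⟨c, hc, Or.inr hcx⟩
  · obtain ⟨c, hc, hcx⟩ := IsHermitianForm.exists_unit_smul (g := g) (x := x) (σ := 1) (by simp)
      (by linarith)
    exact ⟨c, hc, Or.inl hcx⟩

theorem isUnitaryFrame_pair (h : IsHermitianForm g J) {x y : V}
    (hx : g x x = 1 ∨ g x x = -1) (hy : g y y = 1 ∨ g y y = -1) (hxy : HermitianOrtho g J x y) :
    IsUnitaryFrame g J ![x, y] := by
  refine ⟨fun i => ?_, fun i j hij => ?_⟩
  · fin_cases i <;> assumption
  · fin_cases i <;> fin_cases j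
    · exact absurd rfl hij
    · exact hxy
    · exact hxy.symm h
    · exact absurd rfl hij

/-- The components of `T` on three orthogonal complex lines, and those with three entries in one
line and one in an orthogonal line, vanish. -/
structure VanishesOnTriples {V : Type*} [AddCommGroup V] [Module ℝ V]
    (g : V →ₗ[ℝ] V →ₗ[ℝ] ℝ) (J : V →ₗ[ℝ] V) (T : V → V → V → V → ℝ) : Prop where
  sectional : ∀ x y z, HermitianOrtho g J x y → HermitianOrtho g J x z → HermitianOrtho g J y z →
    g x x ≠ 0 → g y y ≠ 0 → g z z ≠ 0 → T x y x z = 0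
  sectionalJ : ∀ x y z, HermitianOrtho g J x y → HermitianOrtho g J x z → HermitianOrtho g J y z →
    g x x ≠ 0 → g y y ≠ 0 → g z z ≠ 0 → T x y (J x) z = 0
  three_one : ∀ x w, HermitianOrtho g J x w → g x x ≠ 0 → g w w ≠ 0 → T x (J x) x w = 0

namespace VanishesOnFrames

variable [FiniteDimensional ℝ V] (h : IsHermitianForm g J) (hg : ∀ v, (∀ w, g v w = 0) → v = 0)
  (hT : IsCurvatureTensor T) (hV : VanishesOnFrames g J T) {m : ℕ} (hm : 1 ≤ m)
  (hdim : finrank ℝ V = 2 * (3 + m)) (htr : IsTraceFree g J T (3 + m))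
include h hg hT hV hm hdim htr

theorem unit_triple {y z w : V} (hy : g y y = 1 ∨ g y y = -1) (hz : g z z = 1 ∨ g z z = -1)
    (hw : g w w = 1 ∨ g w w = -1) (hzw : HermitianOrtho g J z w) (hzy : HermitianOrtho g J z y)
    (hwy : HermitianOrtho g J w y) : T y z y w = 0 ∧ T y z (J y) (J w) = 0 := by
  obtain ⟨h1, h2⟩ := hV.ricci_relations h hg hT hm hdim htr hy hz hw hzw hzy hwy
  obtain ⟨h3, h4⟩ := hV.ricci_relations h hg hT hm hdim htr hy (z := J z) (w := J w)
    (by rwa [h.J_isometry]) (by rwa [h.J_isometry]) ((hzw.J_left h).J_right h) (hzy.J_left h)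
    (hwy.J_left h)
  simp only [h.J_sq, hT.neg_second, hT.neg_fourth] at h3 h4
  have hm' : (1 : ℝ) ≤ m := by exact_mod_cast hm
  -- Replacing `z`, `w` by `J z`, `J w` leaves the other two terms of the first relation unchanged.
  have h5 : T y z y w = T y (J z) y (J w) := by
    refine mul_left_cancel₀ (a := (3 + m : ℝ) - 1) (by linarith) ?_
    linear_combination (-1 / 2) * h1 + (1 / 2) * h3
  rw [← h5] at h2 h4
  -- Eliminating the other unknowns leaves the factor `n² - 4`, where `n = 3 + m`.
  have h6 : T y z y w = 0 := by
    refine (mul_eq_zero.1 (?_ : ((3 + m : ℝ) ^ 2 - 4) * T y z y w = 0)).resolve_left ?_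
    · linear_combination (-1 / 2) * ((3 + m : ℝ) + 1) * h1 + (3 / 4) * h4 + (3 / 4) * h2
    · nlinarith
  refine ⟨h6, ?_⟩
  rw [h6] at h2
  exact (mul_eq_zero.1 (by linear_combination (-1 / 2) * h2 :
    ((3 + m : ℝ) + 1) * T y z (J y) (J w) = 0)).resolve_left (by linarith)

theorem vanishesOnTriples : VanishesOnTriples g J T := by
  have key : ∀ x y z, HermitianOrtho g J x y → HermitianOrtho g J x z → HermitianOrtho g J y z →
      g x x ≠ 0 → g y y ≠ 0 → g z z ≠ 0 → T x y x z = 0 ∧ T x y (J x) (J z) = 0 :=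
    fun x y z hxy hxz hyz hx hy hz => by
      obtain ⟨a, ha, hx⟩ := exists_smul_unit hx
      obtain ⟨b, hb, hy⟩ := exists_smul_unit hy
      obtain ⟨c, hc, hz⟩ := exists_smul_unit hz
      have h1 := hV.unit_triple h hg hT hm hdim htr hx hy hz ((hyz.smul_left b).smul_right c)
        (((hxy.symm h).smul_left b).smul_right a) (((hxz.symm h).smul_left c).smul_right a)
      simpa [hT.smul_left, hT.smul_second, hT.smul_third, hT.smul_fourth, ha, hb, hc] using h1
  have key' : ∀ x y z, HermitianOrtho g J x y → HermitianOrtho g J x z → HermitianOrtho g J y z →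
      g x x ≠ 0 → g y y ≠ 0 → g z z ≠ 0 → T x y (J x) z = 0 :=
    fun x y z hxy hxz hyz hx hy hz => by
      have h1 := (key x y (J z) hxy (hxz.J_right h) (hyz.J_right h) hx hy
        (by rwa [h.J_isometry])).2
      rw [h.J_sq, hT.neg_fourth] at h1
      linarith
  refine ⟨fun x y z hxy hxz hyz hx hy hz => (key x y z hxy hxz hyz hx hy hz).1, key',
    fun x w hxw hx hw => ?_⟩
  obtain ⟨a, ha, hx'⟩ := exists_smul_unit hx
  obtain ⟨c, hc, hw'⟩ := exists_smul_unit hw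
  have hxw' : HermitianOrtho g J (a • x) (c • w) := (hxw.smul_left a).smul_right c
  -- Two auxiliary lines complete `x`, `w` to a frame in which `three_one_eq` expresses the
  -- component by components on three lines, already known to vanish.
  obtain ⟨y, hy, hey⟩ := (isUnitaryFrame_pair h hx' hw' hxw').exists_unit_ortho h hg (by omega)
  have hxy : HermitianOrtho g J (a • x) y := hey 0
  have hwy : HermitianOrtho g J (c • w) y := hey 1
  obtain ⟨z, hz, hez⟩ := (isUnitaryFrame_triple h hx' hw' hy hxw' hxy hwy).exists_unit_ortho h hg
    (by omega)
  have hxz : HermitianOrtho g J (a • x) z := hez 0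
  have hwz : HermitianOrtho g J (c • w) z := hez 1
  have hyz : HermitianOrtho g J y z := hez 2
  have h1 := hV.three_one_eq h hT (x := a • x) (y := y) (z := z) (w := c • w)
    ⟨⟨hxy, hxz, hxw', hyz, hwy.symm h, hwz.symm h⟩, unit_ne_zero hx', unit_ne_zero hy,
      unit_ne_zero hz, unit_ne_zero hw'⟩
  have h2 := (key y (J (a • x)) (c • w) ((hxy.symm h).J_right h) (hwy.symm h) (hxw'.J_left h)
    (unit_ne_zero hy) (by rw [h.J_isometry]; exact unit_ne_zero hx') (unit_ne_zero hw')).1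
  have h3 := key' y (a • x) (c • w) (hxy.symm h) (hwy.symm h) hxw'
    (unit_ne_zero hy) (unit_ne_zero hx') (unit_ne_zero hw')
  rw [h2, h3] at h1
  simpa [hT.smul_left, hT.smul_second, hT.smul_third, hT.smul_fourth, ha, hc, unit_ne_zero hy]
    using h1

end VanishesOnFrames

namespace VanishesOnTriples

variable (h : IsHermitianForm g J) (hT : IsCurvatureTensor T) (hV : VanishesOnTriples g J T)
include h hT hV

/-- Now the second and fourth slots are rotated: `T(x, z, x, z) / g(z, z)` and its variants with `J`
do not depend on the line of `z`. -/
theorem rotate_eq {x z w : V} (hxz : HermitianOrtho g J x z) (hxw : HermitianOrtho g J x w)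
    (hzw : HermitianOrtho g J z w) (hx : g x x ≠ 0) (hz : g z z ≠ 0) (hw : g w w ≠ 0) :
    g w w * T x z x z = g z z * T x w x w ∧ g w w * T x z x (J z) = g z z * T x w x (J w) ∧
    g w w * T x z (J x) (J z) = g z z * T x w (J x) (J w) := by
  obtain ⟨t, ht, hq⟩ := exists_rotation_parameter (q := g z z) hw
  have ho1 : HermitianOrtho g J x (z + t • w) := hxz.add_right (hxw.smul_right t)
  have ho2 : HermitianOrtho g J x ((t * g w w) • z - g z z • w) :=
    (hxz.smul_right _).sub_right (hxw.smul_right _)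
  have ho3 := hzw.rotate h t
  have hn1 : g (z + t • w) (z + t • w) ≠ 0 := by rwa [hzw.self_rotate h]
  have hn2 : g ((t * g w w) • z - g z z • w) ((t * g w w) • z - g z z • w) ≠ 0 := by
    rw [hzw.self_rotate' h]
    exact mul_ne_zero (mul_ne_zero hz hw) hq
  have hn3 : ∀ {v}, g v v ≠ 0 → g (J v) (J v) ≠ 0 := fun hv => by rwa [h.J_isometry]
  have h1 := hV.sectional _ _ _ ho1 ho2 ho3 hx hn1 hn2
  have h2 := hV.sectional _ _ _ ho1 (ho2.J_right h) (ho3.J_right h) hx hn1 (hn3 hn2)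
  have h3 := hV.sectionalJ _ _ _ ho1 (ho2.J_right h) (ho3.J_right h) hx hn1 (hn3 hn2)
  have z1 := hV.sectional _ _ _ hxz hxw hzw hx hz hw
  have z2 := hV.sectional _ _ _ hxw hxz (hzw.symm h) hx hw hz
  have z3 := hV.sectional _ _ _ hxz (hxw.J_right h) (hzw.J_right h) hx hz (hn3 hw)
  have z4 := hV.sectional _ _ _ hxw (hxz.J_right h) ((hzw.symm h).J_right h) hx hw (hn3 hz)
  have z5 := hV.sectionalJ _ _ _ hxz (hxw.J_right h) (hzw.J_right h) hx hz (hn3 hw)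
  have z6 := hV.sectionalJ _ _ _ hxw (hxz.J_right h) ((hzw.symm h).J_right h) hx hw (hn3 hz)
  simp only [map_sub, map_smul, hT.add_second, hT.smul_second, hT.sub_fourth, hT.smul_fourth, z1,
    z2, z3, z4, z5, z6] at h1 h2 h3
  exact ⟨mul_left_cancel₀ ht (by linear_combination h1),
    mul_left_cancel₀ ht (by linear_combination h2), mul_left_cancel₀ ht (by linear_combination h3)⟩

/-- Comparing `w` and `J w` through the third line `z` gives the first three identities. Rotating
`x` towards `w` in a vanishing three-plus-one component gives the holomorphic one. -/
theorem holomorphic_eq {x z w : V} (hxz : HermitianOrtho g J x z) (hxw : HermitianOrtho g J x w)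
    (hzw : HermitianOrtho g J z w) (hx : g x x = 1 ∨ g x x = -1) (hz : g z z ≠ 0)
    (hw : g w w = 1 ∨ g w w = -1) :
    T x w x (J w) = 0 ∧ T x (J w) x (J w) = T x w x w ∧ T x (J w) (J x) w = -T x w (J x) (J w) ∧
    g w w * T x (J x) x (J x) = g x x * (3 * T x w (J x) (J w) + T x w x w) := by
  have hx0 := unit_ne_zero hx
  have hw0 := unit_ne_zero hw
  have hn3 : ∀ {v}, g v v ≠ 0 → g (J v) (J v) ≠ 0 := fun hv => by rwa [h.J_isometry]
  obtain ⟨a1, a2, a3⟩ := hV.rotate_eq h hT hxw hxz (hzw.symm h) hx0 hw0 hz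
  obtain ⟨b1, b2, b3⟩ := hV.rotate_eq h hT (hxw.J_right h) hxz ((hzw.symm h).J_left h) hx0
    (hn3 hw0) hz
  simp only [h.J_isometry, h.J_sq, hT.neg_fourth] at b1 b2 b3
  have c2 : T x w x (J w) = 0 := by
    have h0 : T x (J w) x w = T x w x (J w) := hT.swap_pairs ..
    rw [h0] at b2
    exact mul_left_cancel₀ hz (by linarith)
  have c1 : T x (J w) x (J w) = T x w x w := mul_left_cancel₀ hz (by linarith)
  have c3 : T x (J w) (J x) w = -T x w (J x) (J w) := mul_left_cancel₀ hz (by linarith)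
  refine ⟨c2, c1, c3, ?_⟩
  have hrot : ∀ t : ℝ, g x x + t ^ 2 * g w w ≠ 0 →
      T (x + t • w) (J (x + t • w)) (x + t • w) (J ((t * g w w) • x - g x x • w)) = 0 :=
    fun t ht => by
      refine hV.three_one _ _ ((hxw.rotate h t).J_right h) ?_ (hn3 ?_)
      · rwa [hxw.self_rotate h]
      · rw [hxw.self_rotate' h]
        exact mul_ne_zero (mul_ne_zero hx0 hw0) ht
  -- The value `t = 1` could make the rotated vectors null; 2 and 3 cannot, as the squares of `x`
  -- and `w` are `±1`.
  have h2 := hrot 2 (by rcases hx with hx | hx <;> rcases hw with hw | hw <;> rw [hx, hw] <;>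
    norm_num)
  have h3 := hrot 3 (by rcases hx with hx | hx <;> rcases hw with hw | hw <;> rw [hx, hw] <;>
    norm_num)
  have hwx := hxw.symm h
  have z1 := hV.three_one _ _ (hxw.J_right h) hx0 (hn3 hw0)
  have z2 := hV.three_one _ _ (hxw.J_left h) (hn3 hx0) hw0
  have y1 := hV.three_one _ _ (hwx.J_right h) hw0 (hn3 hx0)
  have y2 := hV.three_one _ _ (hwx.J_left h) (hn3 hw0) hx0
  simp only [h.J_sq, hT.neg_second] at z2 y2
  have d1 : T x (J x) w (J x) = 0 := by
    rw [hT.swap_right, hT.swap_left]; linarith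
  have d2 : T w (J x) x (J x) = 0 := by rw [← hT.swap_pairs, d1]
  have d3 : T x (J w) x (J x) = 0 := by rw [← hT.swap_pairs, z1]
  have f1 : T w (J w) x (J w) = 0 := by
    rw [hT.swap_right, hT.swap_left]; linarith
  have f2 : T x (J w) w (J w) = 0 := by rw [← hT.swap_pairs, f1]
  have f3 : T w (J x) w (J w) = 0 := by rw [← hT.swap_pairs, y1]
  have k1 : T w (J x) x (J w) = T x w (J x) (J w) := by
    rw [hT.swap_left, hT.swap_pairs, c3]; ring
  have k2 : T x (J x) w (J w) = 2 * T x w (J x) (J w) := by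
    linarith [hT.bianchi x (J x) w (J w), hT.swap_left x w (J x) (J w), hT.swap_left w (J x) x (J w)]
  simp only [map_add, map_sub, map_smul, hT.add_left, hT.smul_left, hT.add_second, hT.smul_second,
    hT.add_third, hT.smul_third, hT.sub_fourth, hT.smul_fourth, z1, y1, d1, d2, d3, f1, f2, f3,
    k1, k2, c1] at h2 h3
  -- The equations have the form `t A + t³ B = 0` for `t = 2, 3`, and this combination eliminates
  -- `B`.
  linear_combination (27 / 30) * h2 - (8 / 30) * h3

end VanishesOnTriples

/-- A complete unitary frame and its image under `J` form a basis. -/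
theorem IsUnitaryFrame.basis_exists [FiniteDimensional ℝ V] (h : IsHermitianForm g J) {n : ℕ}
    (hdim : finrank ℝ V = 2 * n) {e : Fin n → V} (he : IsUnitaryFrame g J e) :
    ∃ b : Basis (Fin n ⊕ Fin n) ℝ V, (∀ i, b (Sum.inl i) = e i) ∧ ∀ i, b (Sum.inr i) = J (e i) := by
  have hli : LinearIndependent ℝ (Sum.elim e fun i => J (e i)) := by
    rw [Fintype.linearIndependent_iff]
    intro c hc
    rw [Fintype.sum_sum_type] at hc
    simp only [Sum.elim_inl, Sum.elim_inr] at hc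
    have h1 : ∀ i, g (e i) (∑ j, c (Sum.inl j) • e j + ∑ j, c (Sum.inr j) • J (e j)) =
        c (Sum.inl i) * g (e i) (e i) := fun i => by
      rw [map_add, map_sum, map_sum, Finset.sum_eq_single i, Finset.sum_eq_single i]
      · simp [h.self_J]
      · intro j _ hj
        simp [(he.ortho i j hj.symm).2]
      · simp
      · intro j _ hj
        simp [(he.ortho i j hj.symm).1]
      · simp
    have h2 : ∀ i, g (J (e i)) (∑ j, c (Sum.inl j) • e j + ∑ j, c (Sum.inr j) • J (e j)) =
        c (Sum.inr i) * g (e i) (e i) := fun i => by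
      rw [map_add, map_sum, map_sum, Finset.sum_eq_single i, Finset.sum_eq_single i]
      · simp [h.J_self, h.J_isometry]
      · intro j _ hj
        simp [h.J_isometry, (he.ortho i j hj.symm).1]
      · simp
      · intro j _ hj
        simp [h.J_left, (he.ortho i j hj.symm).2]
      · simp
    rintro (i | i)
    · have := h1 i
      rw [hc, map_zero] at this
      exact (mul_eq_zero.1 this.symm).resolve_right (unit_ne_zero (he.unit i))
    · have := h2 i
      rw [hc, map_zero] at this
      exact (mul_eq_zero.1 this.symm).resolve_right (unit_ne_zero (he.unit i))
  refine ⟨basisOfLinearIndependentOfCardEqFinrank' _ hli (by simp [hdim]; ring), fun i => ?_,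
    fun i => ?_⟩ <;> simp

end

/-! ### The diagonal Ricci equations and the vanishing of the tensor. -/

section

variable {V : Type*} [AddCommGroup V] [Module ℝ V]
  {g : V →ₗ[ℝ] V →ₗ[ℝ] ℝ} {J : V →ₗ[ℝ] V} {T : V → V → V → V → ℝ}

theorem eq_zero_of_basis {ι : Type*} (b : Basis ι ℝ V) {f : V → ℝ}
    (hadd : ∀ v w, f (v + w) = f v + f w) (hsmul : ∀ (c : ℝ) v, f (c • v) = c * f v)
    (hb : ∀ i, f (b i) = 0) (v : V) : f v = 0 := by
  let F : V →ₗ[ℝ] ℝ := { toFun := f, map_add' := hadd, map_smul' := hsmul }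
  exact LinearMap.congr_fun (b.ext (f₁ := F) (f₂ := 0) hb) v

namespace VanishesOnTriples

variable [FiniteDimensional ℝ V] (h : IsHermitianForm g J) (hg : ∀ v, (∀ w, g v w = 0) → v = 0)
  (hT : IsCurvatureTensor T) (hV : VanishesOnTriples g J T) {m : ℕ} (hm : 2 ≤ m)
  (hdim : finrank ℝ V = 2 * (1 + m)) (htr : IsTraceFree g J T (1 + m))
include h hg hT hV hm hdim htr

theorem unit_eq_zero {x : V} (hx : g x x = 1 ∨ g x x = -1) (v v' : V) : T x v x v' = 0 := by
  have hfx : IsUnitaryFrame g J ![x] :=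
    ⟨fun i => by fin_cases i; exact hx, fun i j hij => absurd (Subsingleton.elim i j) hij⟩
  obtain ⟨e, he, hee⟩ := hfx.exists_extension h hg m (by omega)
  have hx0 : e (Fin.castAdd m 0) = x := hee 0
  obtain ⟨w, hw⟩ : ∃ w : Fin m → V, ∀ k, e (Fin.natAdd 1 k) = w k := ⟨_, fun k => rfl⟩
  have hwu : ∀ k, g (w k) (w k) = 1 ∨ g (w k) (w k) = -1 := fun k => by
    rw [← hw]; exact he.unit _
  have hxw : ∀ k, HermitianOrtho g J x (w k) := fun k => by
    rw [← hw, ← hx0]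
    exact he.ortho _ _ (by simp [Fin.ext_iff]; omega)
  have hww : ∀ k l, k ≠ l → HermitianOrtho g J (w k) (w l) := fun k l hkl => by
    rw [← hw, ← hw]
    exact he.ortho _ _ (by simpa using hkl)
  have hxn := unit_ne_zero hx
  have hwn := fun k => unit_ne_zero (hwu k)
  have hJn : ∀ {v}, g v v ≠ 0 → g (J v) (J v) ≠ 0 := fun hv => by rwa [h.J_isometry]
  have hhol : ∀ k, T x (w k) x (J (w k)) = 0 ∧ T x (J (w k)) x (J (w k)) = T x (w k) x (w k) ∧
      T x (J (w k)) (J x) (w k) = -T x (w k) (J x) (J (w k)) ∧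
      g (w k) (w k) * T x (J x) x (J x) =
        g x x * (3 * T x (w k) (J x) (J (w k)) + T x (w k) x (w k)) := fun k => by
    obtain ⟨l, hl⟩ : ∃ l : Fin m, l ≠ k := by
      have : Nontrivial (Fin m) := Fin.nontrivial_iff_two_le.2 hm
      exact exists_ne k
    exact hV.holomorphic_eq h hT (hxw l) (hxw k) (hww l k hl) hx (hwn l) (hwu k)
  set w₀ := w ⟨0, by omega⟩ with hw₀
  have hconst : ∀ k, g w₀ w₀ * T x (w k) x (w k) = g (w k) (w k) * T x w₀ x w₀ ∧
      g w₀ w₀ * T x (w k) (J x) (J (w k)) = g (w k) (w k) * T x w₀ (J x) (J w₀) := fun k => by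
    by_cases hk : k = ⟨0, by omega⟩
    · rw [hw₀, hk]; exact ⟨rfl, rfl⟩
    · obtain ⟨h1, -, h3⟩ := hV.rotate_eq h hT (hxw k) (hxw _) (hww k _ hk) hxn (hwn k)
        (hwn ⟨0, by omega⟩)
      exact ⟨h1, h3⟩
  obtain ⟨h1, h2⟩ := htr e he x x
  rw [Fin.sum_univ_add, Fin.sum_univ_one] at h1 h2
  simp only [hx0, hw, hT.self_left] at h1 h2
  have hs0 := unit_sq (hwu ⟨0, by omega⟩)
  rw [← hw₀] at hs0
  have hk1 : ∀ k, g (w k) (w k) * (T (w k) x x (w k) + T (J (w k)) x x (J (w k))) =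
      -2 * (g w₀ w₀ * T x w₀ x w₀) := fun k => by
    have e1 : T (w k) x x (w k) = -T x (w k) x (w k) := hT.swap_left ..
    have e2 : T (J (w k)) x x (J (w k)) = -T x (J (w k)) x (J (w k)) := hT.swap_left ..
    rw [e1, e2, (hhol k).2.1]
    have hs := unit_sq (hwu k)
    linear_combination (-2 * g (w k) (w k) * g w₀ w₀) * (hconst k).1
      + 2 * g (w k) (w k) * T x (w k) x (w k) * hs0 - 2 * g w₀ w₀ * T x w₀ x w₀ * hs
  have hk2 : ∀ k, g (w k) (w k) * (T (w k) x (J x) (J (w k)) - T (J (w k)) x (J x) (w k)) =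
      -2 * (g w₀ w₀ * T x w₀ (J x) (J w₀)) := fun k => by
    have e1 : T (w k) x (J x) (J (w k)) = -T x (w k) (J x) (J (w k)) := hT.swap_left ..
    have e2 : T (J (w k)) x (J x) (w k) = -T x (J (w k)) (J x) (w k) := hT.swap_left ..
    rw [e1, e2, (hhol k).2.2.1]
    have hs := unit_sq (hwu k)
    linear_combination (-2 * g (w k) (w k) * g w₀ w₀) * (hconst k).2
      + 2 * g (w k) (w k) * T x (w k) (J x) (J (w k)) * hs0
      - 2 * g w₀ w₀ * T x w₀ (J x) (J w₀) * hs
  simp only [hk1, hk2, Finset.sum_const, Finset.card_univ, Fintype.card_fin, nsmul_eq_mul] at h1 h2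
  have e1 : T (J x) x x (J x) = -T x (J x) x (J x) := hT.swap_left ..
  have e2 : T (J x) x (J x) x = T x (J x) x (J x) := by
    rw [hT.swap_left, hT.swap_right, neg_neg]
  rw [e1] at h1
  rw [e2] at h2
  have hH := (hhol ⟨0, by omega⟩).2.2.2
  rw [← hw₀] at hH
  have hxs := unit_sq hx
  have hm' : (2 : ℝ) ≤ m := by exact_mod_cast hm
  -- All `m` lines orthogonal to `x` contribute equally to `ρ(x, x)` and `ρ*(x, x)`, and the line of
  -- `x` contributes through `holomorphic_eq`. The resulting two equations have determinant `(2 m +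
  -- 1)(2 m + 3) - 3 = 4 m (m + 2)`.
  have hK : (2 * m + 1 : ℝ) * (g w₀ w₀ * T x w₀ x w₀)
      + 3 * (g w₀ w₀ * T x w₀ (J x) (J w₀)) = 0 := by
    linear_combination -h1 + g x x * g w₀ w₀ * (-hH) + g x x * T x (J x) x (J x) * hs0
      - (g w₀ w₀ * (3 * T x w₀ (J x) (J w₀) + T x w₀ x w₀)) * hxs
  have hL : (2 * m + 3 : ℝ) * (g w₀ w₀ * T x w₀ (J x) (J w₀)) + g w₀ w₀ * T x w₀ x w₀ = 0 := by
    linear_combination -h2 + g x x * g w₀ w₀ * (-hH) + g x x * T x (J x) x (J x) * hs0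
      - (g w₀ w₀ * (3 * T x w₀ (J x) (J w₀) + T x w₀ x w₀)) * hxs
  have hw₀n : g w₀ w₀ ≠ 0 := hwn _
  have hL0 : g w₀ w₀ * T x w₀ (J x) (J w₀) = 0 := by
    refine (mul_eq_zero.1 (?_ : ((2 * m + 1 : ℝ) * (2 * m + 3) - 3) * _ = 0)).resolve_left ?_
    · linear_combination (2 * m + 1 : ℝ) * hL - hK
    · nlinarith
  have hK0 : g w₀ w₀ * T x w₀ x w₀ = 0 := by
    rw [hL0] at hL; linarith
  have hL1 := (mul_eq_zero.1 hL0).resolve_left hw₀n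
  have hK1 := (mul_eq_zero.1 hK0).resolve_left hw₀n
  have hH0 : T x (J x) x (J x) = 0 := by
    rw [hL1, hK1] at hH
    exact (mul_eq_zero.1 (by linarith : g w₀ w₀ * T x (J x) x (J x) = 0)).resolve_left hw₀n
  have hKk : ∀ k, T x (w k) x (w k) = 0 := fun k => by
    have h3 := (hconst k).1
    rw [hK1, mul_zero] at h3
    exact (mul_eq_zero.1 h3).resolve_left hw₀n
  have hJxw : ∀ k, T x (J x) x (w k) = 0 := fun k => hV.three_one _ _ (hxw k) hxn (hwn k)
  have hJxJw : ∀ k, T x (J x) x (J (w k)) = 0 := fun k =>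
    hV.three_one _ _ ((hxw k).J_right h) hxn (hJn (hwn k))
  have hsec := hV.sectional
  have hbase : ∀ u u' : V, (u = x ∨ u = J x ∨ ∃ k, u = w k ∨ u = J (w k)) →
      (u' = x ∨ u' = J x ∨ ∃ k, u' = w k ∨ u' = J (w k)) → T x u x u' = 0 := by
    have hsymm : ∀ u u', T x u x u' = T x u' x u := fun u u' => hT.swap_pairs ..
    have hkl : ∀ k l u u', (u = w k ∨ u = J (w k)) → (u' = w l ∨ u' = J (w l)) →
        T x u x u' = 0 := by
      intro k l u u' hu hu'
      by_cases hkl : k = l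
      · subst hkl
        rcases hu with rfl | rfl <;> rcases hu' with rfl | rfl
        · exact hKk k
        · exact (hhol k).1
        · rw [hsymm]; exact (hhol k).1
        · rw [(hhol k).2.1]; exact hKk k
      · have ho := hww k l hkl
        rcases hu with rfl | rfl <;> rcases hu' with rfl | rfl
        · exact hsec _ _ _ (hxw k) (hxw l) ho hxn (hwn k) (hwn l)
        · exact hsec _ _ _ (hxw k) ((hxw l).J_right h) (ho.J_right h) hxn (hwn k) (hJn (hwn l))
        · exact hsec _ _ _ ((hxw k).J_right h) (hxw l) (ho.J_left h) hxn (hJn (hwn k)) (hwn l)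
        · exact hsec _ _ _ ((hxw k).J_right h) ((hxw l).J_right h) ((ho.J_left h).J_right h) hxn
            (hJn (hwn k)) (hJn (hwn l))
    rintro u u' (rfl | rfl | ⟨k, hu⟩) hu'
    · exact hT.self_left ..
    · rcases hu' with rfl | rfl | ⟨l, rfl | rfl⟩
      · rw [hsymm, hT.self_left]
      · exact hH0
      · exact hJxw l
      · exact hJxJw l
    · rcases hu' with rfl | rfl | ⟨l, hu'⟩
      · rw [hsymm, hT.self_left]
      · rw [hsymm]
        rcases hu with rfl | rfl
        · exact hJxw k
        · exact hJxJw k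
      · exact hkl k l u u' hu hu'
  obtain ⟨b, hb₁, hb₂⟩ := he.basis_exists h hdim
  have hb : ∀ i, b i = x ∨ b i = J x ∨ ∃ k, b i = w k ∨ b i = J (w k) := by
    rintro (i | i)
    · rw [hb₁]
      induction i using Fin.addCases with
      | left i => exact Or.inl (by rw [Subsingleton.elim i 0, hx0])
      | right k => exact Or.inr (Or.inr ⟨k, Or.inl (hw k)⟩)
    · rw [hb₂]
      induction i using Fin.addCases with
      | left i => exact Or.inr (Or.inl (by rw [Subsingleton.elim i 0, hx0]))
      | right k => exact Or.inr (Or.inr ⟨k, Or.inr (by rw [hw k])⟩)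
  refine eq_zero_of_basis b (f := fun v => T x v x v') (fun v w => hT.add_second ..)
    (fun c v => hT.smul_second ..)
    (fun i => ?_) v
  exact eq_zero_of_basis b (f := fun v' => T x (b i) x v') (fun v w => hT.add_fourth ..)
    (fun c v => hT.smul_fourth ..)
    (fun j => hbase _ _ (hb i) (hb j)) v'

theorem eq_zero (x y z u : V) : T x y z u = 0 := by
  have hnn : ∀ x : V, g x x ≠ 0 → ∀ v v', T x v x v' = 0 := fun x hx v v' => by
    obtain ⟨c, hc, hcx⟩ := exists_smul_unit hx
    have h1 := hV.unit_eq_zero h hg hT hm hdim htr hcx v v'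
    simpa [hT.smul_left, hT.smul_third, hc] using h1
  obtain ⟨p, hp⟩ : ∃ p : V, g p p ≠ 0 := by
    have he0 : IsUnitaryFrame g J (Fin.elim0 : Fin 0 → V) := ⟨fun i => i.elim0, fun i => i.elim0⟩
    obtain ⟨p, hp, -⟩ := he0.exists_unit_ortho h hg (by omega)
    exact ⟨p, unit_ne_zero hp⟩
  -- For null `x` the expression at `x + t p` is affine in `t`, as the quadratic term vanishes for
  -- the nonnull `p`. Two parameters with `x + t p` nonnull therefore suffice.
  have hall : ∀ x v v' : V, T x v x v' = 0 := fun x v v' => by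
    by_cases hx : g x x = 0
    · have hq : ∀ t : ℝ, g (x + t • p) (x + t • p) = t * (2 * g x p + t * g p p) := fun t => by
        simp only [map_add, map_smul, LinearMap.add_apply, LinearMap.smul_apply, smul_eq_mul, hx,
          h.symm p x]
        ring
      have ht : ∀ t : ℝ, t * (2 * g x p + t * g p p) ≠ 0 →
          T x v x v' + t * (T x v p v' + T p v x v') = 0 := fun t ht => by
        have h1 := hnn (x + t • p) (by rwa [hq]) v v'
        simp only [hT.add_left, hT.add_third, hT.smul_left, hT.smul_third, hnn p hp] at h1
        linarith
      by_cases hxp : g x p = 0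
      · have h1 := ht 1 (by simpa [hxp] using hp)
        have h2 := ht (-1) (by simpa [hxp] using hp)
        linarith
      · have h1 := ht (2 * g x p / g p p) (by
          rw [div_mul_cancel₀ _ hp]
          exact mul_ne_zero (div_ne_zero (mul_ne_zero two_ne_zero hxp) hp)
            (by intro h0; exact hxp (by linarith)))
        have h2 := ht (-(4 * g x p / g p p)) (by
          have e3 : -(4 * g x p / g p p) * g p p = -(4 * g x p) := by field_simp
          rw [e3]
          refine mul_ne_zero (neg_ne_zero.2 (div_ne_zero (mul_ne_zero four_ne_zero hxp) hp)) ?_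
          intro h0
          exact hxp (by linarith))
        have h3 : 4 * g x p / g p p = 2 * (2 * g x p / g p p) := by ring
        rw [h3] at h2
        linarith
    · exact hnn x hx v v'
  -- `T` becomes alternating in its first three entries, so the Bianchi sum equals `3 T`.
  have hskew : ∀ x v x' v' : V, T x v x' v' = -T x' v x v' := fun x v x' v' => by
    have h1 := hall (x + x') v v'
    simp only [hT.add_left, hT.add_third, hall] at h1
    linarith
  have h1 := hT.bianchi x y z u
  have h2 := hskew x y z u
  have h3 := hT.swap_left z y x u
  have h4 := hskew z x y u
  have h5 := hT.swap_left y x z u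
  linarith

end VanishesOnTriples

/-- A curvature tensor which is trace-free and vanishes on the isotropic antiholomorphic planes
spanned by `x + a` and `y + b` is zero. -/
theorem IsFlatOnIsotropic.eq_zero [FiniteDimensional ℝ V] (h : IsHermitianForm g J)
    (hg : ∀ v, (∀ w, g v w = 0) → v = 0) (hT : IsCurvatureTensor T)
    (hF : IsFlatOnIsotropic g J T) (hN : HasThreeSquares g 1) (hP : HasThreeSquares g (-1))
    {n : ℕ} (hn : 4 ≤ n) (hdim : finrank ℝ V = 2 * n) (htr : IsTraceFree g J T n)
    (x y z u : V) : T x y z u = 0 := by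
  have hV : VanishesOnFrames g J T := fun x y z w hf =>
    (hF.vanishesOn h hT hN hP hf.ortho hf.x_ne hf.y_ne hf.z_ne hf.w_ne).1
  have hV' : VanishesOnTriples g J T := by
    obtain ⟨m, rfl⟩ : ∃ m, n = 3 + m := ⟨n - 3, by omega⟩
    exact hV.vanishesOnTriples h hg hT (by omega) hdim htr
  obtain ⟨m, rfl⟩ : ∃ m, n = 1 + m := ⟨n - 1, by omega⟩
  exact hV'.eq_zero h hg hT (by omega) hdim htr x y z u

end

/-! ### The tensors `phi` and `psi` and their contractions. -/

section

namespace IsCurvatureTensor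

variable {V : Type*} [AddCommGroup V] [Module ℝ V] {T T' : V → V → V → V → ℝ}

theorem add (hT : IsCurvatureTensor T) (hT' : IsCurvatureTensor T') :
    IsCurvatureTensor fun x y z u => T x y z u + T' x y z u where
  add_left _ _ _ _ _ := by rw [hT.add_left, hT'.add_left]; ring
  smul_left _ _ _ _ _ := by rw [hT.smul_left, hT'.smul_left]; ring
  swap_left _ _ _ _ := by rw [hT.swap_left, hT'.swap_left]; ring
  swap_right _ _ _ _ := by rw [hT.swap_right, hT'.swap_right]; ring
  swap_pairs _ _ _ _ := by rw [hT.swap_pairs, hT'.swap_pairs]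
  bianchi x y z u := by linarith [hT.bianchi x y z u, hT'.bianchi x y z u]

theorem const_mul (c : ℝ) (hT : IsCurvatureTensor T) :
    IsCurvatureTensor fun x y z u => c * T x y z u where
  add_left _ _ _ _ _ := by rw [hT.add_left]; ring
  smul_left _ _ _ _ _ := by rw [hT.smul_left]; ring
  swap_left _ _ _ _ := by rw [hT.swap_left]; ring
  swap_right _ _ _ _ := by rw [hT.swap_right]; ring
  swap_pairs _ _ _ _ := by rw [hT.swap_pairs]
  bianchi x y z u := by linear_combination c * hT.bianchi x y z u

end IsCurvatureTensor

variable {V : Type*} [AddCommGroup V] [Module ℝ V]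
  {g : V →ₗ[ℝ] V →ₗ[ℝ] ℝ} {J : V →ₗ[ℝ] V}

theorem isCurvatureTensor_phi (hg : ∀ x y, g x y = g y x) {S : V →ₗ[ℝ] V →ₗ[ℝ] ℝ}
    (hS : ∀ x y, S x y = S y x) :
    IsCurvatureTensor (HermitianAlgebra.phi (fun x y => g x y) fun x y => S x y) where
  add_left _ _ _ _ _ := by
    simp only [HermitianAlgebra.phi, map_add, LinearMap.add_apply]; ring
  smul_left _ _ _ _ _ := by
    simp only [HermitianAlgebra.phi, map_smul, LinearMap.smul_apply, smul_eq_mul]; ring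
  swap_left _ _ _ _ := by simp only [HermitianAlgebra.phi]; ring
  swap_right _ _ _ _ := by simp only [HermitianAlgebra.phi]; ring
  swap_pairs x y z u := by
    simp only [HermitianAlgebra.phi]
    rw [hg u x, hg z x, hg z y, hg u y, hS u x, hS z x, hS z y, hS u y]; ring
  bianchi x y z u := by
    simp only [HermitianAlgebra.phi]
    rw [hg z x, hg z y, hg y x, hS y x, hS z x, hS z y]; ring

/-- The condition on `S` says that `S(x, J y)` is skew, like `g(x, J y)`; for a product of two skew
forms the terms with factor 2 are what the Bianchi identity requires. -/
theorem isCurvatureTensor_psi (h : IsHermitianForm g J) {S : V →ₗ[ℝ] V →ₗ[ℝ] ℝ}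
    (hS : ∀ x y, S x (J y) = -S y (J x)) :
    IsCurvatureTensor
      (HermitianAlgebra.psi (fun x y => g x y) (fun x => J x) fun x y => S x y) := by
  have hg : ∀ x y, g x (J y) = -g y (J x) := fun x y => by rw [← h.J_left, h.symm]
  refine ⟨fun x x' y z u => ?_, fun c x y z u => ?_, fun x y z u => ?_, fun x y z u => ?_,
    fun x y z u => ?_, fun x y z u => ?_⟩ <;> simp only [HermitianAlgebra.psi]
  · simp only [map_add, LinearMap.add_apply]; ring
  · simp only [map_smul, LinearMap.smul_apply, smul_eq_mul]; ring
  · rw [hg y x, hS y x]; ring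
  · rw [hg u z, hS u z]; ring
  · rw [hg u x, hg z x, hg z y, hg u y, hS u x, hS z x, hS z y, hS u y]; ring
  · rw [hg z x, hg z y, hg y x, hS y x, hS z x, hS z y]; ring

/-- The trace of `b` with respect to `g`, computed in the basis `f`. -/
def frameTrace {V : Type*} [AddCommGroup V] [Module ℝ V] {ι : Type*} [Fintype ι]
    (g : V →ₗ[ℝ] V →ₗ[ℝ] ℝ) (f : Basis ι ℝ V) (b : V → V → ℝ) : ℝ :=
  ∑ i, g (f i) (f i) * b (f i) (f i)

section frameTrace

variable {ι : Type*} [Fintype ι] {f : Basis ι ℝ V}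

theorem frameTrace_add (b b' : V → V → ℝ) :
    frameTrace g f (fun x y => b x y + b' x y) = frameTrace g f b + frameTrace g f b' := by
  simp only [frameTrace, mul_add, Finset.sum_add_distrib]

theorem frameTrace_sub (b b' : V → V → ℝ) :
    frameTrace g f (fun x y => b x y - b' x y) = frameTrace g f b - frameTrace g f b' := by
  simp only [frameTrace, mul_sub, Finset.sum_sub_distrib]

theorem frameTrace_neg (b : V → V → ℝ) :
    frameTrace g f (fun x y => -b x y) = -frameTrace g f b := by
  simp only [frameTrace, mul_neg, Finset.sum_neg_distrib]

theorem frameTrace_const_mul (c : ℝ) (b : V → V → ℝ) :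
    frameTrace g f (fun x y => c * b x y) = c * frameTrace g f b := by
  simp only [frameTrace, Finset.mul_sum]
  exact Finset.sum_congr rfl fun i _ => by ring

theorem frameTrace_mul_const (c : ℝ) (b : V → V → ℝ) :
    frameTrace g f (fun x y => b x y * c) = frameTrace g f b * c := by
  simp only [frameTrace, Finset.sum_mul]
  exact Finset.sum_congr rfl fun i _ => by ring

theorem frameTrace_congr {b b' : V → V → ℝ} (hb : ∀ x, b x x = b' x x) :
    frameTrace g f b = frameTrace g f b' := by
  simp only [frameTrace, hb]

theorem frameTrace_eq_zero_of_antisymm {b : V → V → ℝ} (hb : ∀ x y, b x y = -b y x) :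
    frameTrace g f b = 0 :=
  Finset.sum_eq_zero fun i _ => by rw [show b (f i) (f i) = 0 by linarith [hb (f i) (f i)], mul_zero]

variable (hf : HermitianAlgebra.IsOrthonormalBasis (fun x y => g x y) f)
include hf

theorem frameTrace_contract (hg : ∀ x y, g x y = g y x) (F : V →ₗ[ℝ] ℝ) (z : V) :
    frameTrace g f (fun x y => g x z * F y) = F z := by
  conv_rhs => rw [HermitianAlgebra.expand g f hf z, map_sum]
  refine Finset.sum_congr rfl fun i _ => ?_
  rw [map_smul, smul_eq_mul, hg z]
  ring

theorem frameTrace_self : frameTrace g f (fun x y => g x y) = finrank ℝ V := by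
  rw [finrank_eq_card_basis f, frameTrace, Fintype.card, Finset.cast_card]
  refine Finset.sum_congr rfl fun i _ => ?_
  rcases hf.1 i with h1 | h1 <;> simp only at h1 <;> rw [h1] <;> norm_num

/-- `J` maps orthonormal bases to orthonormal bases, and traces do not depend on the basis. -/
theorem frameTrace_J (h : IsHermitianForm g J) (b : V →ₗ[ℝ] V →ₗ[ℝ] ℝ) :
    frameTrace g f (fun x y => b (J x) (J y)) = frameTrace g f (fun x y => b x y) := by
  let e : V ≃ₗ[ℝ] V := LinearEquiv.ofLinearMap J (-J) (by ext x; simp [h.J_sq])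
    (by ext x; simp [h.J_sq])
  have he : ∀ i, f.map e i = J (f i) := fun i => rfl
  have hJ : HermitianAlgebra.IsOrthonormalBasis (fun x y => g x y) (f.map e) := by
    refine ⟨fun i => ?_, fun i j hij => ?_⟩
    · simpa only [he, h.J_isometry] using hf.1 i
    · simpa only [he, h.J_isometry] using hf.2 i j hij
  have h1 := HermitianAlgebra.sum_eq_sum g b h.symm (f.map e) hJ f hf
  simpa only [he, h.J_isometry, frameTrace] using h1

theorem frameTrace_phi (h : IsHermitianForm g J) (S : V →ₗ[ℝ] V →ₗ[ℝ] ℝ) (y z : V) :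
    frameTrace g f (fun a b => HermitianAlgebra.phi (fun x y => g x y) (fun x y => S x y) a y z b) =
      (finrank ℝ V - 2) * S y z + frameTrace g f (fun x y => S x y) * g y z := by
  have h1 := frameTrace_contract hf h.symm (S y) z
  have h2 := frameTrace_contract hf h.symm (S.flip z) y
  rw [frameTrace_congr (b' := fun a b => g y z * S a b - g a z * S y b + g a b * S y z
    - g a y * S.flip z b) (fun x => by
      simp only [HermitianAlgebra.phi, LinearMap.flip_apply, h.symm y x])]
  rw [frameTrace_sub, frameTrace_add, frameTrace_sub, frameTrace_const_mul, frameTrace_mul_const,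
    frameTrace_self hf, h1, h2, LinearMap.flip_apply]
  ring

theorem frameTrace_phi_J (h : IsHermitianForm g J) {S : V →ₗ[ℝ] V →ₗ[ℝ] ℝ}
    (hS : ∀ x y, S x y = S y x) (y z : V) :
    frameTrace g f (fun a b =>
      HermitianAlgebra.phi (fun x y => g x y) (fun x y => S x y) a y (J z) (J b)) =
      S y z + S (J y) (J z) := by
  have h0 : frameTrace g f (fun a b => S a (J b)) = 0 := by
    have h1 := frameTrace_J hf h (S.compl₂ J)
    simp only [LinearMap.compl₂_apply, h.J_sq, map_neg] at h1
    rw [frameTrace_neg] at h1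
    have h2 : frameTrace g f (fun a b => S (J a) b) = frameTrace g f (fun a b => S a (J b)) :=
      frameTrace_congr fun x => hS _ _
    linarith
  have h1 := frameTrace_contract hf h.symm ((S y).comp J) (J z)
  have h2 := frameTrace_contract hf h.symm (S.flip (J z)) (J y)
  have h3 : frameTrace g f (fun a b => g a (J b)) = 0 :=
    frameTrace_eq_zero_of_antisymm fun x y => by rw [h.symm y, h.J_left, neg_neg]
  rw [frameTrace_congr (b' := fun a b => g y (J z) * S a (J b) - g a (J z) * (S y).comp J b
    + g a (J b) * S y (J z) + g a (J y) * S.flip (J z) b) (fun x => by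
      simp only [HermitianAlgebra.phi, LinearMap.flip_apply, LinearMap.comp_apply, h.symm x (J y),
        h.J_left]; ring)]
  rw [frameTrace_add, frameTrace_add, frameTrace_sub, frameTrace_const_mul, frameTrace_mul_const,
    h0, h1, h2, h3, LinearMap.flip_apply, LinearMap.comp_apply, h.J_sq, map_neg]
  ring

theorem frameTrace_psi (h : IsHermitianForm g J) {S : V →ₗ[ℝ] V →ₗ[ℝ] ℝ}
    (hS : ∀ x y, S x (J y) = -S y (J x)) (y z : V) :
    frameTrace g f (fun a b =>
      HermitianAlgebra.psi (fun x y => g x y) (fun x => J x) (fun x y => S x y) a y z b) =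
      S y z + 2 * S z y + S (J y) (J z) + 2 * S (J z) (J y) := by
  have h0 : frameTrace g f (fun a b => S a (J b)) = 0 := frameTrace_eq_zero_of_antisymm hS
  have h3 : frameTrace g f (fun a b => g a (J b)) = 0 :=
    frameTrace_eq_zero_of_antisymm fun x y => by rw [h.symm y, h.J_left, neg_neg]
  have h1 := frameTrace_contract hf h.symm ((S y).comp J) (J z)
  have h2 := frameTrace_contract hf h.symm ((S z).comp J) (J y)
  have h4 := frameTrace_contract hf h.symm (S.flip (J z)) (J y)
  have h5 := frameTrace_contract hf h.symm (S.flip (J y)) (J z)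
  rw [frameTrace_congr (b' := fun a b => g y (J z) * S a (J b) - g a (J z) * (S y).comp J b
    - 2 * (g a (J y) * (S z).comp J b) + g a (J b) * S y (J z) + g a (J y) * S.flip (J z) b
    + 2 * (g a (J z) * S.flip (J y) b)) (fun x => by
      simp only [HermitianAlgebra.psi, LinearMap.flip_apply, LinearMap.comp_apply, h.symm x (J y),
        h.symm x (J z), h.J_left]; ring)]
  rw [frameTrace_add, frameTrace_add, frameTrace_add, frameTrace_sub, frameTrace_sub,
    frameTrace_const_mul, frameTrace_const_mul, frameTrace_const_mul, frameTrace_mul_const,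
    h0, h1, h2, h3, h4, h5]
  simp only [LinearMap.flip_apply, LinearMap.comp_apply, h.J_sq, map_neg]
  ring

theorem frameTrace_psi_J (h : IsHermitianForm g J) (S : V →ₗ[ℝ] V →ₗ[ℝ] ℝ) (y z : V) :
    frameTrace g f (fun a b =>
      HermitianAlgebra.psi (fun x y => g x y) (fun x => J x) (fun x y => S x y) a y (J z) (J b)) =
      (finrank ℝ V - 2) * S y z + 4 * S (J z) (J y) + frameTrace g f (fun x y => S x y) * g y z := by
  have h1 := frameTrace_contract hf h.symm (S y) z
  have h2 := frameTrace_contract hf h.symm (S (J z)) (J y)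
  have h3 := frameTrace_contract hf h.symm (S.flip z) y
  have h4 := frameTrace_contract hf h.symm (S.flip (J y)) (J z)
  rw [frameTrace_congr (b' := fun a b => g y z * S a b - g a z * S y b
    + 2 * (g a (J y) * S (J z) b) + g a b * S y z - g a y * S.flip z b
    + 2 * (g a (J z) * S.flip (J y) b)) (fun x => by
      simp only [HermitianAlgebra.psi, LinearMap.flip_apply, h.J_sq, map_neg,
        h.symm y x, h.symm (J z) x]; ring)]
  rw [frameTrace_add, frameTrace_sub, frameTrace_add, frameTrace_add, frameTrace_sub,
    frameTrace_const_mul, frameTrace_const_mul, frameTrace_const_mul, frameTrace_mul_const,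
    frameTrace_self hf, h1, h2, h3, h4]
  simp only [LinearMap.flip_apply]
  ring

end frameTrace

end

/-! ### Ricci forms and the Bochner tensor as a combination of `phi` and `psi`. -/

section

variable {V : Type*} [AddCommGroup V] [Module ℝ V]
  {g : V →ₗ[ℝ] V →ₗ[ℝ] ℝ} {J : V →ₗ[ℝ] V} {T : V → V → V → V → ℝ}

namespace IsCurvatureTensor

/-- The bilinear form `(a, b) ↦ T(a, y, z, b)`. -/
def outerForm (hT : IsCurvatureTensor T) (y z : V) : V →ₗ[ℝ] V →ₗ[ℝ] ℝ :=
  LinearMap.mk₂ ℝ (fun a b => T a y z b) (fun _ _ _ => hT.add_left ..)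
    (fun _ _ _ => hT.smul_left ..) (fun _ _ _ => hT.add_fourth ..) fun _ _ _ => hT.smul_fourth ..

theorem outerForm_apply (hT : IsCurvatureTensor T) (y z a b : V) :
    hT.outerForm y z a b = T a y z b := rfl

variable {ι : Type*} [Fintype ι]

/-- The Ricci tensor as a bilinear form. -/
def ricciForm (hT : IsCurvatureTensor T) (g : V →ₗ[ℝ] V →ₗ[ℝ] ℝ) (f : Basis ι ℝ V) :
    V →ₗ[ℝ] V →ₗ[ℝ] ℝ :=
  LinearMap.mk₂ ℝ (fun y z => frameTrace g f fun a b => T a y z b)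
    (fun _ _ _ => by simp only [hT.add_second, frameTrace_add])
    (fun _ _ _ => by simp only [hT.smul_second, frameTrace_const_mul, smul_eq_mul])
    (fun _ _ _ => by simp only [hT.add_third, frameTrace_add])
    fun _ _ _ => by simp only [hT.smul_third, frameTrace_const_mul, smul_eq_mul]

/-- The Ricci `*`-tensor as a bilinear form. -/
def ricciStarForm (hT : IsCurvatureTensor T) (g : V →ₗ[ℝ] V →ₗ[ℝ] ℝ) (J : V →ₗ[ℝ] V)
    (f : Basis ι ℝ V) : V →ₗ[ℝ] V →ₗ[ℝ] ℝ :=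
  LinearMap.mk₂ ℝ (fun y z => frameTrace g f fun a b => T a y (J z) (J b))
    (fun _ _ _ => by simp only [hT.add_second, frameTrace_add])
    (fun _ _ _ => by simp only [hT.smul_second, frameTrace_const_mul, smul_eq_mul])
    (fun _ _ _ => by simp only [map_add, hT.add_third, frameTrace_add])
    fun _ _ _ => by simp only [map_smul, hT.smul_third, frameTrace_const_mul, smul_eq_mul]

variable {f : Basis ι ℝ V}

theorem ricciForm_apply (hT : IsCurvatureTensor T) (y z : V) :
    hT.ricciForm g f y z = frameTrace g f fun a b => T a y z b := rfl

theorem ricciStarForm_apply (hT : IsCurvatureTensor T) (y z : V) :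
    hT.ricciStarForm g J f y z = frameTrace g f fun a b => T a y (J z) (J b) := rfl

theorem ricciForm_symm (hT : IsCurvatureTensor T) (y z : V) :
    hT.ricciForm g f y z = hT.ricciForm g f z y := by
  rw [ricciForm_apply, ricciForm_apply]
  exact frameTrace_congr fun x => by rw [← hT.swap_pairs, hT.swap_left, hT.swap_right, neg_neg]

theorem ricciForm_bar (hT : IsCurvatureTensor T) (h : IsHermitianForm g J)
    (hf : HermitianAlgebra.IsOrthonormalBasis (fun x y => g x y) f) (y z : V) :
    frameTrace g f (fun a b => T (J a) (J y) (J z) (J b)) = hT.ricciForm g f (J y) (J z) :=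
  frameTrace_J hf h (hT.outerForm (J y) (J z))

theorem ricciStarForm_bar (hT : IsCurvatureTensor T) (h : IsHermitianForm g J)
    (hf : HermitianAlgebra.IsOrthonormalBasis (fun x y => g x y) f) (y z : V) :
    frameTrace g f (fun a b => T (J a) (J y) (J (J z)) (J (J b))) =
      hT.ricciStarForm g J f (J y) (J z) :=
  frameTrace_J hf h ((hT.outerForm (J y) (J (J z))).compl₂ J)

/-- Apply `J` to the contracted pair, then use pair symmetry. Consequently the `J`-invariant part of
`ρ*` is symmetric and the anti-invariant part is skew. -/
theorem ricciStarForm_J_J (hT : IsCurvatureTensor T) (h : IsHermitianForm g J)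
    (hf : HermitianAlgebra.IsOrthonormalBasis (fun x y => g x y) f) (y z : V) :
    hT.ricciStarForm g J f (J z) (J y) = hT.ricciStarForm g J f y z := by
  rw [ricciStarForm_apply, ricciStarForm_apply]
  refine (frameTrace_J hf h ((hT.outerForm (J z) (J (J y))).compl₂ J)).symm.trans
    (frameTrace_congr fun x => ?_)
  simp only [LinearMap.compl₂_apply, outerForm_apply, h.J_sq, hT.neg_third, hT.neg_fourth, neg_neg]
  rw [← hT.swap_pairs, hT.swap_left, hT.swap_right, neg_neg]

end IsCurvatureTensor

namespace HermitianAlgebra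

/-- The basis chosen in `metricTrace` depends on `g` alone, so one `f` serves for every `b`,
bilinear or not. -/
theorem exists_metricTrace_eq (hf : ∃ e : Basis (Fin (finrank ℝ V)) ℝ V,
    IsOrthonormalBasis (fun x y => g x y) e) :
    ∃ f : Basis (Fin (finrank ℝ V)) ℝ V, IsOrthonormalBasis (fun x y => g x y) f ∧
      ∀ b : V → V → ℝ, metricTrace (fun x y => g x y) b = frameTrace g f b :=
  ⟨hf.choose, hf.choose_spec, fun b => by rw [metricTrace, dif_pos hf, frameTrace]⟩

end HermitianAlgebra

/-- A curvature-like combination of `T` and of the tensors `φ(S)` and `ψ(S)`. -/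
def bochnerCombination {V : Type*} [AddCommGroup V] [Module ℝ V]
    (g : V →ₗ[ℝ] V →ₗ[ℝ] ℝ) (J : V →ₗ[ℝ] V) (T : V → V → V → V → ℝ)
    (S₁ S₂ A D : V →ₗ[ℝ] V →ₗ[ℝ] ℝ) (k : Fin 7 → ℝ) (x y z u : V) : ℝ :=
  let φ := fun S : V →ₗ[ℝ] V →ₗ[ℝ] ℝ =>
    HermitianAlgebra.phi (fun x y => g x y) (fun x y => S x y)
  let ψ := fun S : V →ₗ[ℝ] V →ₗ[ℝ] ℝ =>
    HermitianAlgebra.psi (fun x y => g x y) (fun x => J x) (fun x y => S x y)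
  T x y z u + k 0 * φ S₁ x y z u + k 0 * ψ S₁ x y z u + k 1 * φ S₂ x y z u + k 2 * ψ S₂ x y z u
    + k 3 * ψ A x y z u + k 4 * φ D x y z u + k 5 * φ g x y z u + k 6 * ψ g x y z u

theorem isCurvatureTensor_bochnerCombination (h : IsHermitianForm g J) (hT : IsCurvatureTensor T)
    {S₁ S₂ A D : V →ₗ[ℝ] V →ₗ[ℝ] ℝ} (hS₁ : ∀ x y, S₁ x y = S₁ y x)
    (hS₁J : ∀ x y, S₁ x (J y) = -S₁ y (J x)) (hS₂ : ∀ x y, S₂ x y = S₂ y x)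
    (hS₂J : ∀ x y, S₂ x (J y) = -S₂ y (J x)) (hAJ : ∀ x y, A x (J y) = -A y (J x))
    (hD : ∀ x y, D x y = D y x) (k : Fin 7 → ℝ) :
    IsCurvatureTensor (bochnerCombination g J T S₁ S₂ A D k) := by
  have hgJ : ∀ x y, g x (J y) = -g y (J x) := fun x y => by rw [← h.J_left, h.symm]
  exact (((((((hT.add ((isCurvatureTensor_phi h.symm hS₁).const_mul _)).add
    ((isCurvatureTensor_psi h hS₁J).const_mul _)).add
    ((isCurvatureTensor_phi h.symm hS₂).const_mul _)).add
    ((isCurvatureTensor_psi h hS₂J).const_mul _)).add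
    ((isCurvatureTensor_psi h hAJ).const_mul _)).add
    ((isCurvatureTensor_phi h.symm hD).const_mul _)).add
    ((isCurvatureTensor_phi h.symm h.symm).const_mul _)).add
    ((isCurvatureTensor_psi h hgJ).const_mul _)

section BochnerForms

variable {ι : Type*} [Fintype ι]

namespace IsCurvatureTensor

variable (hT : IsCurvatureTensor T) (g J) (f : Basis ι ℝ V)

/-- The Ricci tensor of `T + T̄`. -/
def ricciPlus : V →ₗ[ℝ] V →ₗ[ℝ] ℝ := hT.ricciForm g f + (hT.ricciForm g f).compl₁₂ J J

/-- The Ricci tensor of `T - T̄`. -/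
def ricciMinus : V →ₗ[ℝ] V →ₗ[ℝ] ℝ := hT.ricciForm g f - (hT.ricciForm g f).compl₁₂ J J

/-- The Ricci `*`-tensor of `T + T̄`. -/
def ricciStarPlus : V →ₗ[ℝ] V →ₗ[ℝ] ℝ :=
  hT.ricciStarForm g J f + (hT.ricciStarForm g J f).compl₁₂ J J

/-- The Ricci `*`-tensor of `T - T̄`. -/
def ricciStarMinus : V →ₗ[ℝ] V →ₗ[ℝ] ℝ :=
  hT.ricciStarForm g J f - (hT.ricciStarForm g J f).compl₁₂ J J

end IsCurvatureTensor

/-- The coefficients of the Bochner tensor. -/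
def bochnerCoefficients (n : ℕ) (τ τs : ℝ) : Fin 7 → ℝ :=
  ![-(1 / (16 * ((n : ℝ) + 2))), -(3 / (16 * ((n : ℝ) - 2))), 1 / (16 * ((n : ℝ) - 2)),
    -(1 / (4 * ((n : ℝ) + 1))), -(1 / (4 * ((n : ℝ) - 1))),
    (1 / (16 * ((n : ℝ) + 1) * ((n : ℝ) + 2)) * (τ + 3 * τs)
      + 3 * (1 / (16 * ((n : ℝ) - 1) * ((n : ℝ) - 2)) * (τ - τs))) / 2,
    (1 / (16 * ((n : ℝ) + 1) * ((n : ℝ) + 2)) * (τ + 3 * τs)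
      - 1 / (16 * ((n : ℝ) - 1) * ((n : ℝ) - 2)) * (τ - τs)) / 2]

/-- The terms in `pi1` and `pi2` are absorbed through `φ(g) = 2 π₁` and `ψ(g) = 2 π₂`, whence the
halves in the last two coefficients. -/
theorem bochner_eq_combination (h : IsHermitianForm g J) (hT : IsCurvatureTensor T)
    {f : Basis ι ℝ V} (hf : HermitianAlgebra.IsOrthonormalBasis (fun x y => g x y) f)
    (htr : ∀ b : V → V → ℝ, HermitianAlgebra.metricTrace (fun x y => g x y) b = frameTrace g f b)
    (n : ℕ) (x y z u : V) :
    HermitianAlgebra.bochner n (fun x y => g x y) (fun x => J x) T x y z u =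
      bochnerCombination g J T (hT.ricciPlus g J f + (3 : ℝ) • hT.ricciStarPlus g J f)
        (hT.ricciPlus g J f - hT.ricciStarPlus g J f) (hT.ricciStarMinus g J f)
        (hT.ricciMinus g J f)
        (bochnerCoefficients n (frameTrace g f fun x y => hT.ricciForm g f x y)
          (frameTrace g f fun x y => hT.ricciStarForm g J f x y)) x y z u := by
  have h1 : ∀ y z, HermitianAlgebra.ricci (fun x y => g x y)
      (T + HermitianAlgebra.bar (fun x => J x) T) y z = hT.ricciPlus g J f y z := fun y z => by
    rw [HermitianAlgebra.ricci, htr]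
    exact (frameTrace_add _ _).trans (congrArg₂ _ rfl (hT.ricciForm_bar h hf y z))
  have h2 : ∀ y z, HermitianAlgebra.ricci (fun x y => g x y)
      (T - HermitianAlgebra.bar (fun x => J x) T) y z = hT.ricciMinus g J f y z := fun y z => by
    rw [HermitianAlgebra.ricci, htr]
    exact (frameTrace_sub _ _).trans (congrArg₂ _ rfl (hT.ricciForm_bar h hf y z))
  have h3 : ∀ y z, HermitianAlgebra.ricciStar (fun x y => g x y) (fun x => J x)
      (T + HermitianAlgebra.bar (fun x => J x) T) y z = hT.ricciStarPlus g J f y z := fun y z => by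
    rw [HermitianAlgebra.ricciStar, htr]
    exact (frameTrace_add _ _).trans (congrArg₂ _ rfl (hT.ricciStarForm_bar h hf y z))
  have h4 : ∀ y z, HermitianAlgebra.ricciStar (fun x y => g x y) (fun x => J x)
      (T - HermitianAlgebra.bar (fun x => J x) T) y z = hT.ricciStarMinus g J f y z := fun y z => by
    rw [HermitianAlgebra.ricciStar, htr]
    exact (frameTrace_sub _ _).trans (congrArg₂ _ rfl (hT.ricciStarForm_bar h hf y z))
  have h5 : HermitianAlgebra.scalar (fun x y => g x y) T =
      frameTrace g f fun x y => hT.ricciForm g f x y := by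
    rw [HermitianAlgebra.scalar, htr]
    exact frameTrace_congr fun x => htr _
  have h6 : HermitianAlgebra.scalarStar (fun x y => g x y) (fun x => J x) T =
      frameTrace g f fun x y => hT.ricciStarForm g J f x y := by
    rw [HermitianAlgebra.scalarStar, htr]
    exact frameTrace_congr fun x => htr _
  have e0 : ∀ τ τs : ℝ, bochnerCoefficients n τ τs 0 = -(1 / (16 * ((n : ℝ) + 2))) :=
    fun _ _ => rfl
  have e1 : ∀ τ τs : ℝ, bochnerCoefficients n τ τs 1 = -(3 / (16 * ((n : ℝ) - 2))) :=
    fun _ _ => rfl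
  have e2 : ∀ τ τs : ℝ, bochnerCoefficients n τ τs 2 = 1 / (16 * ((n : ℝ) - 2)) :=
    fun _ _ => rfl
  have e3 : ∀ τ τs : ℝ, bochnerCoefficients n τ τs 3 = -(1 / (4 * ((n : ℝ) + 1))) :=
    fun _ _ => rfl
  have e4 : ∀ τ τs : ℝ, bochnerCoefficients n τ τs 4 = -(1 / (4 * ((n : ℝ) - 1))) :=
    fun _ _ => rfl
  have e5 : ∀ τ τs : ℝ, bochnerCoefficients n τ τs 5 =
      (1 / (16 * ((n : ℝ) + 1) * ((n : ℝ) + 2)) * (τ + 3 * τs)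
        + 3 * (1 / (16 * ((n : ℝ) - 1) * ((n : ℝ) - 2)) * (τ - τs))) / 2 := fun _ _ => rfl
  have e6 : ∀ τ τs : ℝ, bochnerCoefficients n τ τs 6 =
      (1 / (16 * ((n : ℝ) + 1) * ((n : ℝ) + 2)) * (τ + 3 * τs)
        - 1 / (16 * ((n : ℝ) - 1) * ((n : ℝ) - 2)) * (τ - τs)) / 2 := fun _ _ => rfl
  simp only [HermitianAlgebra.bochner, bochnerCombination, HermitianAlgebra.phi,
    HermitianAlgebra.psi, HermitianAlgebra.pi1, HermitianAlgebra.pi2, Pi.add_apply, Pi.sub_apply,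
    Pi.smul_apply, smul_eq_mul, LinearMap.add_apply, LinearMap.sub_apply, LinearMap.smul_apply,
    h1, h2, h3, h4, h5, h6, e0, e1, e2, e3, e4, e5, e6]
  ring

end BochnerForms

end

/-! ### The Bochner tensor is trace free. -/

section

variable {V : Type*} [AddCommGroup V] [Module ℝ V]
  {g : V →ₗ[ℝ] V →ₗ[ℝ] ℝ} {J : V →ₗ[ℝ] V} {T : V → V → V → V → ℝ}

section

variable {ι : Type*} [Fintype ι] {f : Basis ι ℝ V} {S₁ S₂ A D : V →ₗ[ℝ] V →ₗ[ℝ] ℝ}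

theorem apply_J_eq_neg (h : IsHermitianForm g J) {S : V →ₗ[ℝ] V →ₗ[ℝ] ℝ}
    (hS : ∀ x y, S (J x) (J y) = S y x) (x y : V) : S x (J y) = -S y (J x) := by
  rw [← hS, h.J_sq, map_neg, LinearMap.neg_apply]

/-- The term `ψ(A)` drops out of this contraction because `A` is skew and `J`-anti-invariant, and
`D` has trace zero because it is `J`-anti-invariant. -/
theorem frameTrace_bochnerCombination (h : IsHermitianForm g J)
    (hf : HermitianAlgebra.IsOrthonormalBasis (fun x y => g x y) f)
    (hS₁ : ∀ x y, S₁ x y = S₁ y x) (hS₁J : ∀ x y, S₁ (J x) (J y) = S₁ y x)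
    (hS₂ : ∀ x y, S₂ x y = S₂ y x) (hS₂J : ∀ x y, S₂ (J x) (J y) = S₂ y x)
    (hA : ∀ x y, A x y = -A y x) (hAJ : ∀ x y, A (J x) (J y) = A y x)
    (hDJ : ∀ x y, D (J x) (J y) = -D x y) (k : Fin 7 → ℝ) (y z : V) :
    frameTrace g f (fun a b => bochnerCombination g J T S₁ S₂ A D k a y z b) =
      frameTrace g f (fun a b => T a y z b)
      + k 0 * ((finrank ℝ V + 4) * S₁ y z + frameTrace g f (fun x y => S₁ x y) * g y z)
      + k 1 * ((finrank ℝ V - 2) * S₂ y z + frameTrace g f (fun x y => S₂ x y) * g y z)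
      + 6 * k 2 * S₂ y z + k 4 * (finrank ℝ V - 2) * D y z
      + (k 5 * (2 * finrank ℝ V - 2) + 6 * k 6) * g y z := by
  have hgJ : ∀ x y, g (J x) (J y) = g y x := fun x y => by rw [h.J_isometry, h.symm]
  have hD0 : frameTrace g f (fun x y => D x y) = 0 := by
    have h1 := frameTrace_J hf h D
    rw [frameTrace_congr (b' := fun x y => -D x y) fun x => hDJ x x, frameTrace_neg] at h1
    linarith
  simp only [bochnerCombination, frameTrace_add, frameTrace_const_mul,
    frameTrace_phi hf h, frameTrace_psi hf h (apply_J_eq_neg h hS₁J),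
    frameTrace_psi hf h (apply_J_eq_neg h hS₂J), frameTrace_psi hf h (apply_J_eq_neg h hAJ),
    frameTrace_psi hf h (apply_J_eq_neg h hgJ), hS₁J, hS₂J, hAJ, hgJ, hD0, frameTrace_self hf]
  rw [hS₁ z y, hS₂ z y, hA z y, h.symm z y]
  ring

/-- Here it is `φ(D)` that drops out, because `D y z + D (J y) (J z) = 0`, while `ψ(A)` survives. -/
theorem frameTrace_bochnerCombination_J (h : IsHermitianForm g J)
    (hf : HermitianAlgebra.IsOrthonormalBasis (fun x y => g x y) f)
    (hS₁ : ∀ x y, S₁ x y = S₁ y x) (hS₁J : ∀ x y, S₁ (J x) (J y) = S₁ y x)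
    (hS₂ : ∀ x y, S₂ x y = S₂ y x) (hS₂J : ∀ x y, S₂ (J x) (J y) = S₂ y x)
    (hA : ∀ x y, A x y = -A y x) (hAJ : ∀ x y, A (J x) (J y) = A y x)
    (hD : ∀ x y, D x y = D y x) (hDJ : ∀ x y, D (J x) (J y) = -D x y)
    (k : Fin 7 → ℝ) (y z : V) :
    frameTrace g f (fun a b => bochnerCombination g J T S₁ S₂ A D k a y (J z) (J b)) =
      frameTrace g f (fun a b => T a y (J z) (J b))
      + k 0 * ((finrank ℝ V + 4) * S₁ y z + frameTrace g f (fun x y => S₁ x y) * g y z)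
      + 2 * k 1 * S₂ y z
      + k 2 * ((finrank ℝ V + 2) * S₂ y z + frameTrace g f (fun x y => S₂ x y) * g y z)
      + k 3 * (finrank ℝ V + 2) * A y z
      + (2 * k 5 + k 6 * (2 * finrank ℝ V + 2)) * g y z := by
  have hgJ : ∀ x y, g (J x) (J y) = g y x := fun x y => by rw [h.J_isometry, h.symm]
  have hA0 : frameTrace g f (fun x y => A x y) = 0 := frameTrace_eq_zero_of_antisymm hA
  simp only [bochnerCombination, frameTrace_add, frameTrace_const_mul,
    frameTrace_phi_J hf h hS₁, frameTrace_phi_J hf h hS₂, frameTrace_phi_J hf h hD,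
    frameTrace_phi_J hf h h.symm,
    frameTrace_psi_J hf h, hS₁J, hS₂J, hAJ, hgJ, hDJ, hA0, frameTrace_self hf]
  rw [hS₁ z y, hS₂ z y, h.symm z y]
  ring

end

section

variable {ι : Type*} [Fintype ι] {f : Basis ι ℝ V}

namespace IsCurvatureTensor

variable (hT : IsCurvatureTensor T)

theorem ricciPlus_symm (x y : V) : hT.ricciPlus g J f x y = hT.ricciPlus g J f y x := by
  simp only [ricciPlus, LinearMap.add_apply, LinearMap.compl₁₂_apply]
  rw [hT.ricciForm_symm x, hT.ricciForm_symm (J x)]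

theorem ricciMinus_symm (x y : V) : hT.ricciMinus g J f x y = hT.ricciMinus g J f y x := by
  simp only [ricciMinus, LinearMap.sub_apply, LinearMap.compl₁₂_apply]
  rw [hT.ricciForm_symm x, hT.ricciForm_symm (J x)]

variable (h : IsHermitianForm g J)
include h

theorem ricciPlus_J (x y : V) :
    hT.ricciPlus g J f (J x) (J y) = hT.ricciPlus g J f y x := by
  rw [hT.ricciPlus_symm y]
  simp only [ricciPlus, LinearMap.add_apply, LinearMap.compl₁₂_apply, h.J_sq, map_neg,
    LinearMap.neg_apply, neg_neg]
  ring

theorem ricciMinus_J (x y : V) :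
    hT.ricciMinus g J f (J x) (J y) = -hT.ricciMinus g J f x y := by
  simp only [ricciMinus, LinearMap.sub_apply, LinearMap.compl₁₂_apply, h.J_sq, map_neg,
    LinearMap.neg_apply, neg_neg]
  ring

variable (hf : HermitianAlgebra.IsOrthonormalBasis (fun x y => g x y) f)
include hf

theorem ricciStarPlus_symm (x y : V) :
    hT.ricciStarPlus g J f x y = hT.ricciStarPlus g J f y x := by
  simp only [ricciStarPlus, LinearMap.add_apply, LinearMap.compl₁₂_apply,
    hT.ricciStarForm_J_J h hf]
  ring

theorem ricciStarPlus_J (x y : V) :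
    hT.ricciStarPlus g J f (J x) (J y) = hT.ricciStarPlus g J f y x := by
  simp only [ricciStarPlus, LinearMap.add_apply, LinearMap.compl₁₂_apply,
    hT.ricciStarForm_J_J h hf]

theorem ricciStarMinus_antisymm (x y : V) :
    hT.ricciStarMinus g J f x y = -hT.ricciStarMinus g J f y x := by
  simp only [ricciStarMinus, LinearMap.sub_apply, LinearMap.compl₁₂_apply,
    hT.ricciStarForm_J_J h hf]
  ring

theorem ricciStarMinus_J (x y : V) :
    hT.ricciStarMinus g J f (J x) (J y) = hT.ricciStarMinus g J f y x := by
  simp only [ricciStarMinus, LinearMap.sub_apply, LinearMap.compl₁₂_apply,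
    hT.ricciStarForm_J_J h hf]

theorem frameTrace_ricciPlus : frameTrace g f (fun x y => hT.ricciPlus g J f x y) =
    2 * frameTrace g f fun x y => hT.ricciForm g f x y := by
  simp only [ricciPlus, LinearMap.add_apply, LinearMap.compl₁₂_apply]
  rw [frameTrace_add, frameTrace_J hf h]
  ring

theorem frameTrace_ricciStarPlus : frameTrace g f (fun x y => hT.ricciStarPlus g J f x y) =
    2 * frameTrace g f fun x y => hT.ricciStarForm g J f x y := by
  simp only [ricciStarPlus, LinearMap.add_apply, LinearMap.compl₁₂_apply]
  rw [frameTrace_add, frameTrace_J hf h]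
  ring

end IsCurvatureTensor

/-- The Bochner tensor, computed in the basis `f`. -/
def bochnerTensor (hT : IsCurvatureTensor T) (g : V →ₗ[ℝ] V →ₗ[ℝ] ℝ) (J : V →ₗ[ℝ] V)
    (f : Basis ι ℝ V) (n : ℕ) : V → V → V → V → ℝ :=
  bochnerCombination g J T (hT.ricciPlus g J f + (3 : ℝ) • hT.ricciStarPlus g J f)
    (hT.ricciPlus g J f - hT.ricciStarPlus g J f) (hT.ricciStarMinus g J f)
    (hT.ricciMinus g J f)
    (bochnerCoefficients n (frameTrace g f fun x y => hT.ricciForm g f x y)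
      (frameTrace g f fun x y => hT.ricciStarForm g J f x y))

section

variable (h : IsHermitianForm g J) (hT : IsCurvatureTensor T)
  (hf : HermitianAlgebra.IsOrthonormalBasis (fun x y => g x y) f)
include h hf

theorem isCurvatureTensor_bochnerTensor (n : ℕ) :
    IsCurvatureTensor (bochnerTensor hT g J f n) := by
  refine isCurvatureTensor_bochnerCombination h hT (fun x y => ?_)
    (apply_J_eq_neg h fun x y => ?_) (fun x y => ?_) (apply_J_eq_neg h fun x y => ?_)
    (apply_J_eq_neg h (hT.ricciStarMinus_J h hf)) hT.ricciMinus_symm _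
  · simp only [LinearMap.add_apply, LinearMap.smul_apply, hT.ricciPlus_symm x,
      hT.ricciStarPlus_symm h hf x]
  · simp only [LinearMap.add_apply, LinearMap.smul_apply, hT.ricciPlus_J h,
      hT.ricciStarPlus_J h hf]
  · simp only [LinearMap.sub_apply, hT.ricciPlus_symm x, hT.ricciStarPlus_symm h hf x]
  · simp only [LinearMap.sub_apply, hT.ricciPlus_J h, hT.ricciStarPlus_J h hf]

/-- In the first contraction `S₁` and `S₂` enter with total coefficients `-1/8` and `-3/8`, in the
second with `-1/8` and `1/8`. They sum to `-1/2` times the invariant part of `ρ` or `ρ*`, and the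
last correction removes the anti-invariant part. The multiples of `g` cancel by the choice of the
scalar coefficients. -/
theorem frameTrace_bochnerTensor {n : ℕ} (hn : 4 ≤ n) (hdim : finrank ℝ V = 2 * n) (y z : V) :
    frameTrace g f (fun a b => bochnerTensor hT g J f n a y z b) = 0 ∧
    frameTrace g f (fun a b => bochnerTensor hT g J f n a y (J z) (J b)) = 0 := by
  have hn' : (4 : ℝ) ≤ n := by exact_mod_cast hn
  have hS₁ : ∀ x y, (hT.ricciPlus g J f + (3 : ℝ) • hT.ricciStarPlus g J f) x y =
      (hT.ricciPlus g J f + (3 : ℝ) • hT.ricciStarPlus g J f) y x := fun x y => by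
    simp only [LinearMap.add_apply, LinearMap.smul_apply, hT.ricciPlus_symm x,
      hT.ricciStarPlus_symm h hf x]
  have hS₁J : ∀ x y, (hT.ricciPlus g J f + (3 : ℝ) • hT.ricciStarPlus g J f) (J x) (J y) =
      (hT.ricciPlus g J f + (3 : ℝ) • hT.ricciStarPlus g J f) y x := fun x y => by
    simp only [LinearMap.add_apply, LinearMap.smul_apply, hT.ricciPlus_J h,
      hT.ricciStarPlus_J h hf]
  have hS₂ : ∀ x y, (hT.ricciPlus g J f - hT.ricciStarPlus g J f) x y =
      (hT.ricciPlus g J f - hT.ricciStarPlus g J f) y x := fun x y => by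
    simp only [LinearMap.sub_apply, hT.ricciPlus_symm x, hT.ricciStarPlus_symm h hf x]
  have hS₂J : ∀ x y, (hT.ricciPlus g J f - hT.ricciStarPlus g J f) (J x) (J y) =
      (hT.ricciPlus g J f - hT.ricciStarPlus g J f) y x := fun x y => by
    simp only [LinearMap.sub_apply, hT.ricciPlus_J h, hT.ricciStarPlus_J h hf]
  have t₁ : frameTrace g f
      (fun x y => (hT.ricciPlus g J f + (3 : ℝ) • hT.ricciStarPlus g J f) x y) =
      2 * (frameTrace g f fun x y => hT.ricciForm g f x y)
        + 6 * frameTrace g f fun x y => hT.ricciStarForm g J f x y := by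
    simp only [LinearMap.add_apply, LinearMap.smul_apply, smul_eq_mul]
    rw [frameTrace_add, frameTrace_const_mul, hT.frameTrace_ricciPlus h hf,
      hT.frameTrace_ricciStarPlus h hf]
    ring
  have t₂ : frameTrace g f (fun x y => (hT.ricciPlus g J f - hT.ricciStarPlus g J f) x y) =
      2 * (frameTrace g f fun x y => hT.ricciForm g f x y)
        - 2 * frameTrace g f fun x y => hT.ricciStarForm g J f x y := by
    simp only [LinearMap.sub_apply]
    rw [frameTrace_sub, hT.frameTrace_ricciPlus h hf, hT.frameTrace_ricciStarPlus h hf]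
  have c1 : (n : ℝ) + 2 ≠ 0 := by linarith
  have c2 : (n : ℝ) - 2 ≠ 0 := by linarith
  have c3 : (n : ℝ) + 1 ≠ 0 := by linarith
  have c4 : (n : ℝ) - 1 ≠ 0 := by linarith
  have e0 : ∀ τ τs : ℝ, bochnerCoefficients n τ τs 0 = -(1 / (16 * ((n : ℝ) + 2))) :=
    fun _ _ => rfl
  have e1 : ∀ τ τs : ℝ, bochnerCoefficients n τ τs 1 = -(3 / (16 * ((n : ℝ) - 2))) :=
    fun _ _ => rfl
  have e2 : ∀ τ τs : ℝ, bochnerCoefficients n τ τs 2 = 1 / (16 * ((n : ℝ) - 2)) :=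
    fun _ _ => rfl
  have e3 : ∀ τ τs : ℝ, bochnerCoefficients n τ τs 3 = -(1 / (4 * ((n : ℝ) + 1))) :=
    fun _ _ => rfl
  have e4 : ∀ τ τs : ℝ, bochnerCoefficients n τ τs 4 = -(1 / (4 * ((n : ℝ) - 1))) :=
    fun _ _ => rfl
  have e5 : ∀ τ τs : ℝ, bochnerCoefficients n τ τs 5 =
      (1 / (16 * ((n : ℝ) + 1) * ((n : ℝ) + 2)) * (τ + 3 * τs)
        + 3 * (1 / (16 * ((n : ℝ) - 1) * ((n : ℝ) - 2)) * (τ - τs))) / 2 := fun _ _ => rfl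
  have e6 : ∀ τ τs : ℝ, bochnerCoefficients n τ τs 6 =
      (1 / (16 * ((n : ℝ) + 1) * ((n : ℝ) + 2)) * (τ + 3 * τs)
        - 1 / (16 * ((n : ℝ) - 1) * ((n : ℝ) - 2)) * (τ - τs)) / 2 := fun _ _ => rfl
  have hdim' : (finrank ℝ V : ℝ) = 2 * n := by exact_mod_cast hdim
  constructor
  · rw [bochnerTensor, frameTrace_bochnerCombination h hf hS₁ hS₁J hS₂ hS₂J
      (hT.ricciStarMinus_antisymm h hf) (hT.ricciStarMinus_J h hf) (hT.ricciMinus_J h),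
      t₁, t₂, e0, e1, e2, e4, e5, e6, hdim', ← hT.ricciForm_apply]
    simp only [IsCurvatureTensor.ricciPlus, IsCurvatureTensor.ricciStarPlus,
      IsCurvatureTensor.ricciMinus, LinearMap.add_apply, LinearMap.sub_apply,
      LinearMap.smul_apply, smul_eq_mul, LinearMap.compl₁₂_apply]
    field_simp
    ring
  · rw [bochnerTensor, frameTrace_bochnerCombination_J h hf hS₁ hS₁J hS₂ hS₂J
      (hT.ricciStarMinus_antisymm h hf) (hT.ricciStarMinus_J h hf) hT.ricciMinus_symm
      (hT.ricciMinus_J h),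
      t₁, t₂, e0, e1, e2, e3, e5, e6, hdim', ← hT.ricciStarForm_apply]
    simp only [IsCurvatureTensor.ricciPlus, IsCurvatureTensor.ricciStarPlus,
      IsCurvatureTensor.ricciStarMinus, LinearMap.add_apply, LinearMap.sub_apply,
      LinearMap.smul_apply, smul_eq_mul, LinearMap.compl₁₂_apply]
    field_simp
    ring

end

/-- A tensor both of whose Ricci contractions vanish is trace free in every unitary frame. -/
theorem isTraceFree_of_frameTrace [FiniteDimensional ℝ V] (h : IsHermitianForm g J)
    (hT : IsCurvatureTensor T)
    (hf : HermitianAlgebra.IsOrthonormalBasis (fun x y => g x y) f) {n : ℕ}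
    (hdim : finrank ℝ V = 2 * n)
    (hr : ∀ y z, frameTrace g f (fun a b => T a y z b) = 0)
    (hrs : ∀ y z, frameTrace g f (fun a b => T a y (J z) (J b)) = 0) :
    IsTraceFree g J T n := by
  intro e he y z
  obtain ⟨b, hb, hbJ⟩ := IsUnitaryFrame.basis_exists h hdim he
  have hbo : HermitianAlgebra.IsOrthonormalBasis (fun x y => g x y) b := by
    constructor
    · rintro (i | i) <;> simp only [hb, hbJ, h.J_isometry] <;> exact he.unit i
    · rintro (i | i) (j | j) hij <;> simp only [hb, hbJ, h.J_isometry]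
      · exact (he.ortho i j fun hh => hij (congrArg _ hh)).1
      · by_cases hh : i = j
        · rw [hh, h.self_J]
        · exact (he.ortho i j hh).2
      · by_cases hh : i = j
        · rw [hh, h.J_self]
        · rw [h.J_left, (he.ortho i j hh).2, neg_zero]
      · exact (he.ortho i j fun hh => hij (congrArg _ hh)).1
  have key : ∀ c : V →ₗ[ℝ] V →ₗ[ℝ] ℝ, frameTrace g f (fun x y => c x y) = 0 →
      ∑ i, g (e i) (e i) * (c (e i) (e i) + c (J (e i)) (J (e i))) = 0 := fun c hc => by
    rw [frameTrace, ← HermitianAlgebra.sum_eq_sum g c h.symm b hbo f hf, Fintype.sum_sum_type] at hc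
    simpa only [hb, hbJ, h.J_isometry, mul_add, Finset.sum_add_distrib] using hc
  refine ⟨key (hT.outerForm y z) (hr y z), ?_⟩
  -- On the basis vectors `J (e i)` the inner `J` gives `J (J (e i)) = -e i`, whence the minus sign
  -- in `IsTraceFree`.
  have h2 := key ((hT.outerForm y (J z)).compl₂ J) (hrs y z)
  simpa only [LinearMap.compl₂_apply, hT.outerForm_apply, h.J_sq, hT.neg_fourth, ← sub_eq_add_neg]
    using h2

end

/-- The tensors `φ(S)` and `ψ(S)` do not contribute to the curvature of isotropic antiholomorphic
planes. -/
theorem bochnerCombination_isotropic (h : IsHermitianForm g J)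
    (S₁ S₂ A D : V →ₗ[ℝ] V →ₗ[ℝ] ℝ) (k : Fin 7 → ℝ) {x y : V} (hx : g x x = 0) (hy : g y y = 0)
    (hxy : HermitianOrtho g J x y) :
    bochnerCombination g J T S₁ S₂ A D k x y y x = T x y y x := by
  have h1 : g y x = 0 := (hxy.symm h).1
  have h2 : g y (J x) = 0 := (hxy.symm h).2
  simp only [bochnerCombination, HermitianAlgebra.phi, HermitianAlgebra.psi, h.self_J, hx, hy, h1,
    h2, hxy.1, hxy.2]
  ring

end

/-! ### Isotropic planes from unitary systems, and the tangent spaces. -/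

section

section

variable {V : Type*} [AddCommGroup V] [Module ℝ V]
  {g : V →ₗ[ℝ] V →ₗ[ℝ] ℝ} {J : V →ₗ[ℝ] V} {T : V → V → V → V → ℝ}

/-- The sums of two orthogonal pairs of vectors with opposite squares span an isotropic
antiholomorphic plane. -/
theorem HermitianOrtho₄.isotropic (h : IsHermitianForm g J) {x y a b : V}
    (ho : HermitianOrtho₄ g J x y a b) (hx : g x x = 1) (hy : g y y = 1) (ha : g a a = -1)
    (hb : g b b = -1) :
    g (x + a) (x + a) = 0 ∧ g (y + b) (y + b) = 0 ∧ HermitianOrtho g J (x + a) (y + b) := by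
  refine ⟨?_, ?_, ?_, ?_⟩ <;> simp only [map_add, LinearMap.add_apply, hx, hy, ha, hb, ho.xz.1,
    (ho.xz.symm h).1, ho.yw.1, (ho.yw.symm h).1, ho.xy.1, ho.xy.2, ho.xw.1, ho.xw.2,
    (ho.yz.symm h).1, (ho.yz.symm h).2, ho.zw.1, ho.zw.2] <;> norm_num

theorem IsFlatOnIsotropic.bochnerCombination (h : IsHermitianForm g J)
    (hT : IsFlatOnIsotropic g J T) (S₁ S₂ A D : V →ₗ[ℝ] V →ₗ[ℝ] ℝ) (k : Fin 7 → ℝ) :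
    IsFlatOnIsotropic g J (bochnerCombination g J T S₁ S₂ A D k) := by
  intro x y a b ho hx hy ha hb
  obtain ⟨h1, h2, h3⟩ := ho.isotropic h hx hy ha hb
  rw [bochnerCombination_isotropic h _ _ _ _ _ h1 h2 h3]
  exact hT x y a b ho hx hy ha hb

theorem apply_eq_zero_of_mem_span_pair {x y v w : V} {b : V →ₗ[ℝ] V →ₗ[ℝ] ℝ} (hxx : b x x = 0)
    (hxy : b x y = 0) (hyx : b y x = 0) (hyy : b y y = 0) (hv : v ∈ Submodule.span ℝ {x, y})
    (hw : w ∈ Submodule.span ℝ {x, y}) : b v w = 0 := by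
  obtain ⟨s, t, rfl⟩ := Submodule.mem_span_pair.1 hv
  obtain ⟨s', t', rfl⟩ := Submodule.mem_span_pair.1 hw
  simp [hxx, hxy, hyx, hyy]

theorem isFlatOnIsotropic_of_forall (h : IsHermitianForm g J)
    (hT : ∀ ξ η, HermitianAlgebra.IsStronglyIsotropicPlane (fun v w => g v w)
        (Submodule.span ℝ {ξ, η}) →
      HermitianAlgebra.IsAntiholomorphicPlane (fun v w => g v w) J (Submodule.span ℝ {ξ, η}) →
      T ξ η η ξ = 0) : IsFlatOnIsotropic g J T := by
  intro x y a b ho hx hy ha hb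
  have pair : ∀ s t w, g (s • (x + a) + t • (y + b)) w =
      s * (g x w + g a w) + t * (g y w + g b w) := fun s t w => by
    simp only [map_add, map_smul, LinearMap.add_apply, LinearMap.smul_apply, smul_eq_mul]
  have hli : LinearIndependent ℝ ![x + a, y + b] := by
    refine LinearIndependent.pair_iff.2 fun s t hst => ?_
    have h1 := pair s t x
    have h2 := pair s t y
    rw [hst, map_zero, LinearMap.zero_apply, hx, (ho.xz.symm h).1, (ho.xy.symm h).1,
      (ho.xw.symm h).1] at h1
    rw [hst, map_zero, LinearMap.zero_apply, hy, (ho.yw.symm h).1, (ho.yz.symm h).1, ho.xy.1] at h2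
    constructor <;> linarith
  have hrank : finrank ℝ (Submodule.span ℝ {x + a, y + b}) = 2 := by
    have h1 := finrank_span_eq_card hli
    rwa [Matrix.range_cons, Matrix.range_cons, Matrix.range_empty, Set.union_empty,
      Set.singleton_union, Fintype.card_fin] at h1
  obtain ⟨hxa, hyb, hor⟩ := ho.isotropic h hx hy ha hb
  have hor' := hor.symm h
  refine hT _ _ ⟨hrank, fun v hv w hw => ?_⟩ ⟨hrank, fun v hv w hw => ?_, fun heq => ?_⟩
  · exact apply_eq_zero_of_mem_span_pair hxa hor.1 hor'.1 hyb hv hw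
  · exact apply_eq_zero_of_mem_span_pair (b := g.comp J) (h.J_self _)
      (by rw [LinearMap.comp_apply, h.J_left, hor.2, neg_zero])
      (by rw [LinearMap.comp_apply, h.J_left, hor'.2, neg_zero]) (h.J_self _) hv hw
  -- Pairing with `J x` separates: it annihilates the plane, but takes the value `g x x = 1` on `J
  -- (x + a)`.
  · have hmem : J (x + a) ∈ Submodule.span ℝ {x + a, y + b} := by
      rw [← heq]
      exact Submodule.mem_map_of_mem (Submodule.subset_span (Set.mem_insert _ _))
    obtain ⟨s, t, hst⟩ := Submodule.mem_span_pair.1 hmem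
    have h1 := pair s t (J x)
    rw [hst, map_add, map_add, LinearMap.add_apply, h.J_isometry, h.J_isometry, hx,
      (ho.xz.symm h).1, h.self_J, (ho.xz.symm h).2, (ho.xy.symm h).2, (ho.xw.symm h).2] at h1
    norm_num at h1

end

namespace AlmostHermitianStructure

variable {E : Type*} [NormedAddCommGroup E] [NormedSpace ℝ E]
  {M : Type*} [TopologicalSpace M] [ChartedSpace E M] [IsManifold 𝓘(ℝ, E) ∞ M] {n s : ℕ}

theorem isHermitianForm (A : AlmostHermitianStructure E M n s) (p : M) :
    IsHermitianForm (A.form p) (A.J p).toLinearMap where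
  symm := A.symm p
  J_sq := A.J_sq p
  J_isometry := A.J_isometry p

theorem finrank_tangentSpace (A : AlmostHermitianStructure E M n s) (p : M) :
    finrank ℝ (TangentSpace 𝓘(ℝ, E) p) = 2 * n := by
  obtain ⟨b, -⟩ := A.signature p
  rw [finrank_eq_card_basis b, Fintype.card_fin]

theorem exists_isOrthonormalBasis (A : AlmostHermitianStructure E M n s) (p : M) :
    ∃ b : Basis (Fin (finrank ℝ (TangentSpace 𝓘(ℝ, E) p))) ℝ (TangentSpace 𝓘(ℝ, E) p),
      HermitianAlgebra.IsOrthonormalBasis (fun x y => A.form p x y) b := by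
  rw [A.finrank_tangentSpace p]
  obtain ⟨b, hb⟩ := A.signature p
  refine ⟨b, fun i => ?_, fun i j hij => ?_⟩
  · simp only [form_apply, hb, if_true]
    split_ifs <;> simp
  · simp only [form_apply, hb, if_neg hij]

theorem hasThreeSquares_one (A : AlmostHermitianStructure E M n s) (hs : 2 ≤ s) (hn : s ≤ n)
    (p : M) : HasThreeSquares (A.form p) 1 := by
  obtain ⟨b, hb⟩ := A.signature p
  refine ⟨fun i => b ⟨i, by omega⟩, fun i j => ?_⟩
  rw [form_apply, hb]
  simp only [Fin.ext_iff]
  rw [if_pos (show (i : ℕ) < 2 * s by omega)]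

theorem hasThreeSquares_neg_one (A : AlmostHermitianStructure E M n s) (hn : s + 2 ≤ n)
    (p : M) : HasThreeSquares (A.form p) (-1) := by
  obtain ⟨b, hb⟩ := A.signature p
  refine ⟨fun i => b ⟨2 * s + i, by omega⟩, fun i j => ?_⟩
  rw [form_apply, hb]
  simp only [add_right_inj, Fin.ext_iff, neg_neg]
  rw [if_neg (show ¬2 * s + (i : ℕ) < 2 * s by omega)]

end AlmostHermitianStructure

end

end

theorem theorem6 {E : Type*} [NormedAddCommGroup E] [NormedSpace ℝ E] [FiniteDimensional ℝ E]
    {M : Type*} [TopologicalSpace M] [ChartedSpace E M] [IsManifold 𝓘(ℝ, E) ∞ M]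
    (n s : ℕ) (hs : 2 ≤ s) (hn : s + 2 ≤ n) (A : AlmostHermitianStructure E M n s) :
    (∀ (p : M) (ξ η : TangentSpace 𝓘(ℝ, E) p),
        HermitianAlgebra.IsStronglyIsotropicPlane (fun v w => A.g p v w)
          (Submodule.span ℝ {ξ, η}) →
        HermitianAlgebra.IsAntiholomorphicPlane (fun v w => A.g p v w) (A.J p).toLinearMap
          (Submodule.span ℝ {ξ, η}) →
        A.curvature p ξ η η ξ = 0) ↔
      (∀ (p : M) (x y z u : TangentSpace 𝓘(ℝ, E) p),
        HermitianAlgebra.bochner n (fun v w => A.g p v w) (fun v => A.J p v)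
          (A.curvature p) x y z u = 0) := by
  have key (p : M) : ∃ f : Basis (Fin (finrank ℝ (TangentSpace 𝓘(ℝ, E) p))) ℝ
      (TangentSpace 𝓘(ℝ, E) p),
      HermitianAlgebra.IsOrthonormalBasis (fun x y => A.form p x y) f ∧
      ∀ x y z u, HermitianAlgebra.bochner n (fun v w => A.g p v w) (fun v => A.J p v)
          (A.curvature p) x y z u =
        bochnerTensor (A.isCurvatureTensor_curvature p) (A.form p) (A.J p).toLinearMap f n
          x y z u := by
    obtain ⟨f, hf, htr⟩ := HermitianAlgebra.exists_metricTrace_eq (A.exists_isOrthonormalBasis p)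
    exact ⟨f, hf, bochner_eq_combination (A.isHermitianForm p) (A.isCurvatureTensor_curvature p)
      hf htr n⟩
  constructor
  · intro hR p x y z u
    obtain ⟨f, hf, hB⟩ := key p
    have h := A.isHermitianForm p
    have hT := A.isCurvatureTensor_curvature p
    have hdim := A.finrank_tangentSpace p
    have : FiniteDimensional ℝ (TangentSpace 𝓘(ℝ, E) p) := inferInstanceAs (FiniteDimensional ℝ E)
    have hBT := isCurvatureTensor_bochnerTensor h hT hf n
    have hflat := isFlatOnIsotropic_of_forall h (hR p)
    have htr := frameTrace_bochnerTensor h hT hf (by omega : 4 ≤ n) hdim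
    rw [hB]
    refine IsFlatOnIsotropic.eq_zero h (A.eq_zero_of_forall_g_eq_zero p) hBT ?_
      (A.hasThreeSquares_one hs (by omega) p) (A.hasThreeSquares_neg_one hn p)
      (by omega : 4 ≤ n) hdim
      (isTraceFree_of_frameTrace h hBT hf hdim (fun y z => (htr y z).1) fun y z => (htr y z).2)
      x y z u
    exact hflat.bochnerCombination h _ _ _ _ _
  · intro hB p ξ η hi ha
    obtain ⟨f, hf, hBf⟩ := key p
    have hξ : ξ ∈ Submodule.span ℝ {ξ, η} := Submodule.subset_span (Set.mem_insert _ _)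
    have hη : η ∈ Submodule.span ℝ {ξ, η} :=
      Submodule.subset_span (Set.mem_insert_of_mem _ (Set.mem_singleton _))
    have h0 := hB p ξ η η ξ
    rw [hBf] at h0
    rw [← h0]
    refine (bochnerCombination_isotropic (A.isHermitianForm p) _ _ _ _ _ (hi.2 ξ hξ ξ hξ)
      (hi.2 η hη η hη) ⟨hi.2 ξ hξ η hη, ?_⟩).symm
    exact ((A.isHermitianForm p).symm _ _).trans (ha.2.1 η hη ξ hξ)
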